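/- Let $Q$ be a smooth manifold, $L=\tfrac12\kappa-U$ a mechanical Lagrangian on $TQ$ ($\kappa$ a Riemannian metric, $U$ smooth), and $D\subset TQ$ a smooth constant-rank distribution. Let $\mathcal M=\kappa^\flat(D)\subset T^*Q$ be the constraint manifold (an embedded submanifold), with projection $\tau:\mathcal M\to Q$, let $\Theta_{\mathcal M}$ and $\Omega_{\mathcal M}$ be the pullbacks to $\mathcal M$ of the Liouville 1-form $\Theta_Q$ and of $\Omega_Q=-d\Theta_Q$, let $\mathcal C=\{v\in T\mathcal M: T\tau(v)\in D\}$, and let $X_{nh}$ be the vector field with values in $\mathcal C$ such that $\Omega_{\mathcal M}(X_{nh},v)=d\mathcal H_{\mathcal M}(v)$ for all $v\in\mathcal C$, where $\mathcal H_{\mathcal M}$ is the restriction to $\mathcal M$ of the Hamiltonian of $L$. Let a connected Lie group $G$ with Lie algebra $\mathfrak g$ act smoothly, freely and properly on $Q$, preserving $L$ and $D$; write $\chi_Q,\chi_{\mathcal M}$ for the infinitesimal generators of $\chi\in\mathfrak g$ on $Q$ and $\mathcal M$, and $V$, $\mathcal V$ for the tangent distributions to the orbits in $Q$, $\mathcal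 M$. Assume $TQ=D+V$ and put $S=D\cap V$, $(\mathfrak g_S)_q=\{\chi\in\mathfrak g:\chi_Q(q)\in S_q\}$. Let $W\subset V$ be a smooth $G$-invariant distribution with $TQ=D\oplus W$, put $(\mathfrak g_W)_q=\{\chi:\chi_Q(q)\in W_q\}$, and let $H$ be a smooth $G$-invariant distribution with $D=H\oplus S$, so that $TQ=H\oplus S\oplus W$. Let $J:\mathcal M\to\mathfrak g^*$, $\langle J(m),\chi\rangle=\Theta_{\mathcal M}(\chi_{\mathcal M})(m)$. Assume that there are sections $\eta_1,\dots,\eta_l$ forming a global basis of $\mathfrak g_S$ such that the functions $J_i=\langle J,\eta_i\rangle$ are $G$-invariant first integrals of $X_{nh}$ ($G$-invariant horizontal gauge momenta). Define $\mathfrak g$-valued 1-forms on $Q$ by $A_W(X)=\xi\in\mathfrak g_W$ with $\xi_Q=P_W(X)$, $A_S(X)=\eta\in\mathfrak g_S$ with $\eta_Q=P_S(X)$, and $A_V=A_S+A_W$, where $P_S,P_W$ are the projections of $TQ=H\oplus S\oplus W$; write $A_S=\sum_i A_S^i\otimes\eta_i$, and let $\mathcal A_W,\mathcal A_S^i,\mathcal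 A_V$ be the pullbacks by $\tau$. Let $\mathcal W_m=\{\xi_{\mathcal M}(m):\xi\in(\mathfrak g_W)_{\tau(m)}\}$ and $\mathcal H=\ker\mathcal A_V$; let $P_{\mathcal C}$ be the projection for $T\mathcal M=\mathcal C\oplus\mathcal W$ and $P_{\mathcal H},P_{\mathcal V}$ those for $T\mathcal M=\mathcal H\oplus\mathcal V$. Put $d^{\mathcal C}\theta(X,Y)=d\theta(P_{\mathcal C}X,P_{\mathcal C}Y)$, $\mathcal K_W=d^{\mathcal C}\mathcal A_W$, $\mathcal K_V(X,Y)=d\mathcal A_V(P_{\mathcal H}X,P_{\mathcal H}Y)$, $\mathcal K=\mathcal K_W+\sum_i d^{\mathcal C}\mathcal A_S^i\otimes\eta_i$, $\langle\kappa_{\mathfrak g}(X),\chi\rangle=\kappa(T\tau X,\chi_Q)$, and define the 2-forms on $\mathcal M$ $$B_1=\langle J,\mathcal K\rangle,\qquad \mathcal B(X,Y)=-\langle J,\mathcal K_V(X,Y)\rangle-\tfrac12\Big(\langle\kappa_{\mathfrak g}(P_{\mathcal H}X),\mathcal K(P_{\mathcal V}X_{nh},P_{\mathcal H}Y)\rangle-\langle\kappa_{\mathfrak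 g}(P_{\mathcal H}Y),\mathcal K(P_{\mathcal V}X_{nh},P_{\mathcal H}X)\rangle\Big),\qquad B=B_1+\mathcal B.$$ On an open set of $Q$ let $\{X_\alpha\}$ be a smooth $G$-invariant basis of sections of $H$, $Y_i=(\eta_i)_Q$, and $Z_a=(\xi_a)_Q$ for a smooth basis $\{\xi_a\}$ of sections of $\mathfrak g_W$, with dual basis $\{X^\alpha,Y^i,\epsilon^a\}$; let $\tilde X^\alpha,\tilde Y^i$ be the pullbacks of $X^\alpha,Y^i$ by $\tau$. Write $C_{IJ}^K$ for the component along the $K$-th basis field of the Lie bracket of the $I$-th and $J$-th ones, $\kappa_{IJ}$ for the coefficients of $\kappa$, $p_I$ for the value of a point of $\mathcal M\subset T^*Q$ on the $I$-th basis field, and $v^I$ for the components of the velocity $v\in D$ with $\kappa^\flat(v)$ that point. Then, over this open set, with summation over repeated indices and with $A$ running over the vertical indices $i$ and $a$ only: (i) $B_1=-\tfrac12\,p_AC_{ij}^A\,\tilde Y^i\wedge\tilde Y^j-p_AC_{i\alpha}^A\,\tilde Y^i\wedge\tilde X^\alpha-\tfrac12\,p_AC_{\alpha\beta}^A\,\tilde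 X^\alpha\wedge\tilde X^\beta$; (ii) $\mathcal B=\tfrac12\big(p_AC_{\alpha\beta}^A+v^i\kappa_{\alpha A}C_{i\beta}^A\big)\tilde X^\alpha\wedge\tilde X^\beta$; (iii) $B=-\tfrac12\,p_AC_{ij}^A\,\tilde Y^i\wedge\tilde Y^j-p_AC_{i\alpha}^A\,\tilde Y^i\wedge\tilde X^\alpha+\tfrac12\,v^i\kappa_{\alpha A}C_{i\beta}^A\,\tilde X^\alpha\wedge\tilde X^\beta$. -/

import Mathlib

open Set Manifold
open scoped ContDiff Topology

noncomputable section

namespace Nonholonomic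

/-! ### Linear algebra -/

/-- The projection of `V` onto `p` along `q` for a direct sum decomposition `V = p ⊕ q`. -/
def projAlong {V : Type*} [AddCommGroup V] [Module ℝ V] (p q : Submodule ℝ V) : V →ₗ[ℝ] V :=
  open Classical in if h : IsCompl p q then p.projection q h else 0

/-- A linear left inverse of an injective linear map. -/
def linLeftInv {V W : Type*} [AddCommGroup V] [Module ℝ V] [AddCommGroup W] [Module ℝ W]
    (f : V →ₗ[ℝ] W) : W →ₗ[ℝ] V :=
  open Classical in
  if h : LinearMap.ker f = ⊥ then (f.exists_leftInverse_of_injective h).choose else 0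

theorem linLeftInv_apply {V W : Type*} [AddCommGroup V] [Module ℝ V] [AddCommGroup W]
    [Module ℝ W] {f : V →ₗ[ℝ] W} (h : Function.Injective f) (x : V) :
    linLeftInv f (f x) = x := by
  have hk : LinearMap.ker f = ⊥ := LinearMap.ker_eq_bot.2 h
  rw [linLeftInv, dif_pos hk]
  exact LinearMap.congr_fun (f.exists_leftInverse_of_injective hk).choose_spec x

/-- The functional dual to the `i`-th vector of a basis `b` of `V`. -/
def dualVec {V ι : Type*} [AddCommGroup V] [Module ℝ V] (b : ι → V) (i : ι) : V →ₗ[ℝ] ℝ :=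
  open Classical in
  if h : LinearIndependent ℝ b ∧ ⊤ ≤ Submodule.span ℝ (range b) then
    (Module.Basis.mk h.1 h.2).coord i else 0

/-- The wedge product of two functionals, `(α ∧ β)(u, v) = α(u) β(v) - α(v) β(u)`. -/
def wedge {V : Type*} [AddCommGroup V] [Module ℝ V] (α β : V →ₗ[ℝ] ℝ) (u v : V) : ℝ :=
  α u * β v - α v * β u

/-! ### Differential forms of degree one on a manifold -/

section Forms

variable {E H M F : Type*} [NormedAddCommGroup E] [NormedSpace ℝ E] [TopologicalSpace H]
  [TopologicalSpace M] [ChartedSpace H M] [NormedAddCommGroup F] [NormedSpace ℝ F]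
  {E' H' M' : Type*} [NormedAddCommGroup E'] [NormedSpace ℝ E'] [TopologicalSpace H']
  [TopologicalSpace M'] [ChartedSpace H' M']

/-- The exterior derivative of an `F`-valued 1-form on a manifold, computed in the preferred chart
at the point (whose derivative there is the identity of the tangent space). -/
def extDer (I : ModelWithCorners ℝ E H) (θ : ∀ x : M, TangentSpace I x →L[ℝ] F) (x : M) :
    TangentSpace I x [⋀^Fin 2]→L[ℝ] F :=
  let θ' : E → E [⋀^Fin 1]→L[ℝ] F := fun y =>
    ContinuousAlternatingMap.ofSubsingleton ℝ E F (0 : Fin 1)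
      ((θ ((extChartAt I x).symm y)).comp
        (mfderivWithin 𝓘(ℝ, E) I (extChartAt I x).symm (range I) y))
  let dθ' : E [⋀^Fin 2]→L[ℝ] F := extDerivWithin θ' (range I) (extChartAt I x x)
  dθ'

/-- The pullback `f^* θ` of a 1-form. -/
def pullback (I : ModelWithCorners ℝ E H) (I' : ModelWithCorners ℝ E' H') (f : M → M')
    (θ : ∀ x : M', TangentSpace I' x →L[ℝ] F) (x : M) : TangentSpace I x →L[ℝ] F :=
  (θ (f x)).comp (mfderiv I I' f x)

/-- A linear map on a finite-dimensional tangent space, as a continuous linear map. -/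
def toCovector [FiniteDimensional ℝ E] (I : ModelWithCorners ℝ E H) {x : M}
    (f : TangentSpace I x →ₗ[ℝ] F) : TangentSpace I x →L[ℝ] F :=
  let f' : E →ₗ[ℝ] F := f
  let c : E →L[ℝ] F := LinearMap.toContinuousLinearMap f'
  c

end Forms

variable {E : Type*} [NormedAddCommGroup E] [NormedSpace ℝ E]
  {Q : Type*} [TopologicalSpace Q] [ChartedSpace E Q]

/-- Smoothness on `s` of a vector field on `Q`. -/
def SmoothFieldOn (X : ∀ q : Q, TangentSpace 𝓘(ℝ, E) q) (s : Set Q) [IsManifold 𝓘(ℝ, E) ∞ Q] :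
    Prop :=
  ContMDiffOn 𝓘(ℝ, E) 𝓘(ℝ, E).tangent ∞
    (fun q => (⟨q, X q⟩ : TangentBundle 𝓘(ℝ, E) Q)) s

/-- A smooth distribution of constant rank: locally spanned by a smooth frame. -/
def IsSmoothDistribution [IsManifold 𝓘(ℝ, E) ∞ Q]
    (D : ∀ q : Q, Submodule ℝ (TangentSpace 𝓘(ℝ, E) q)) : Prop :=
  ∃ r : ℕ, ∀ q₀ : Q, ∃ U : Set Q, IsOpen U ∧ q₀ ∈ U ∧
    ∃ X : Fin r → ∀ q : Q, TangentSpace 𝓘(ℝ, E) q,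
      (∀ k, SmoothFieldOn (X k) U) ∧
      ∀ q ∈ U, LinearIndependent ℝ (fun k => X k q) ∧
        Submodule.span ℝ (range fun k => X k q) = D q

variable (E Q) in
/-- The cotangent bundle `T^*Q`. -/
abbrev Cotangent : Type _ :=
  Bundle.TotalSpace (E →L[ℝ] ℝ) (fun q : Q => TangentSpace 𝓘(ℝ, E) q →L[ℝ] ℝ)

variable [IsManifold 𝓘(ℝ, E) ∞ Q]

variable (E) in
/-- The model with corners of the cotangent bundle. -/
abbrev cotModel : ModelWithCorners ℝ (E × (E →L[ℝ] ℝ)) (ModelProd E (E →L[ℝ] ℝ)) :=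
  𝓘(ℝ, E).prod 𝓘(ℝ, E →L[ℝ] ℝ)

/-- The Liouville 1-form on `T^*Q`. -/
def liouville (p : Cotangent E Q) : TangentSpace (cotModel E) p →L[ℝ] ℝ :=
  p.2.comp (mfderiv (cotModel E) 𝓘(ℝ, E) (fun p : Cotangent E Q => p.proj) p)


/-- The canonical 2-form `Ω_Q = -dΘ_Q` on `T^*Q`. -/
def canonicalForm (p : Cotangent E Q) : TangentSpace (cotModel E) p [⋀^Fin 2]→L[ℝ] ℝ :=
  -extDer (cotModel E) (fun p : Cotangent E Q => liouville p) p

/-! ### Nonholonomic systems -/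

variable (E Q) in
/-- A mechanical Lagrangian `L = κ/2 - U` on `Q` with a constraint distribution `D`. -/
structure System where
  /-- The kinetic energy metric. -/
  metric : Bundle.ContMDiffRiemannianMetric 𝓘(ℝ, E) ∞ E (fun q : Q => TangentSpace 𝓘(ℝ, E) q)
  /-- The potential energy. -/
  potential : Q → ℝ
  contMDiff_potential : ContMDiff 𝓘(ℝ, E) 𝓘(ℝ, ℝ) ∞ potential
  /-- The constraint distribution. -/
  D : ∀ q : Q, Submodule ℝ (TangentSpace 𝓘(ℝ, E) q)
  smooth_D : IsSmoothDistribution D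

namespace System

variable (N : System E Q)

/-- The Lagrangian `L : TQ → ℝ`. -/
def lagrangian (v : TangentBundle 𝓘(ℝ, E) Q) : ℝ :=
  1 / 2 * N.metric.inner v.1 v.2 v.2 - N.potential v.1

/-- The Legendre transform `κ^♭ : TQ → T^*Q`. -/
def legendre (v : TangentBundle 𝓘(ℝ, E) Q) : Cotangent E Q := ⟨v.1, N.metric.inner v.1 v.2⟩

/-- The inverse of the Legendre transform on the fibre through `p`: the velocity `v` with
`κ(v, ·) = p`. -/
def velocity (p : Cotangent E Q) : TangentSpace 𝓘(ℝ, E) p.proj :=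
  Function.invFun (fun v : TangentSpace 𝓘(ℝ, E) p.proj => N.metric.inner p.proj v) p.2

/-- The Hamiltonian `H(p) = ⟨p, v⟩ - L(v)` with `v` the velocity of `p`. -/
def hamiltonian (p : Cotangent E Q) : ℝ :=
  p.2 (N.velocity p) - N.lagrangian ⟨p.proj, N.velocity p⟩

/-- The constraint manifold `M = Leg(D)`, a subset of `T^*Q`. -/
def constraintSet : Set (Cotangent E Q) := N.legendre '' {v | v.2 ∈ N.D v.1}

/-- The constraint manifold as a type, with the subspace topology. -/
abbrev M : Type _ := ↥N.constraintSet

/-- The projection `τ_M : M → Q`. -/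
def tau (m : N.M) : Q := m.1.proj

/-! ### The nonholonomic vector field

From here on the model space `EM` and the manifold structure of `M` are those of `M` as an embedded
submanifold of `T^*Q`. -/

section Dynamics

variable (EM : Type*) [NormedAddCommGroup EM] [NormedSpace ℝ EM] [ChartedSpace EM N.M]

/-- The tangent map of `τ_M`. -/
def dtau (m : N.M) : TangentSpace 𝓘(ℝ, EM) m →L[ℝ] TangentSpace 𝓘(ℝ, E) (N.tau m) :=
  mfderiv 𝓘(ℝ, EM) 𝓘(ℝ, E) N.tau m

/-- The tangent map of the inclusion `M → T^*Q`. -/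
def dincl (m : N.M) : TangentSpace 𝓘(ℝ, EM) m →L[ℝ] TangentSpace (cotModel E) m.1 :=
  mfderiv 𝓘(ℝ, EM) (cotModel E) (fun m : N.M => m.1) m

/-- The Liouville 1-form restricted to `M`. -/
def liouvilleM (m : N.M) : TangentSpace 𝓘(ℝ, EM) m →L[ℝ] ℝ :=
  (liouville m.1).comp (N.dincl EM m)

/-- The 2-form `Ω_M`, the pullback of `Ω_Q` to `M`. -/
def omegaM (m : N.M) (u v : TangentSpace 𝓘(ℝ, EM) m) : ℝ :=
  canonicalForm m.1 ![N.dincl EM m u, N.dincl EM m v]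

/-- The distribution `C` on `M`: the vectors projecting into `D`. -/
def distC (m : N.M) : Submodule ℝ (TangentSpace 𝓘(ℝ, EM) m) :=
  (N.D (N.tau m)).comap (N.dtau EM m).toLinearMap

/-- The differential of the Hamiltonian restricted to `M`. -/
def dH (m : N.M) : TangentSpace 𝓘(ℝ, EM) m →L[ℝ] ℝ :=
  mfderiv 𝓘(ℝ, EM) 𝓘(ℝ, ℝ) (fun m : N.M => N.hamiltonian m.1) m

/-- The nonholonomic vector field: the unique `X ∈ C` with `Ω_M(X, v) = dH_M(v)` for `v ∈ C`. -/
def Xnh (m : N.M) : TangentSpace 𝓘(ℝ, EM) m :=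
  Classical.epsilon fun X => X ∈ N.distC EM m ∧ ∀ v ∈ N.distC EM m, N.omegaM EM m X v = N.dH EM m v

end Dynamics

/-! ### Symmetries -/

section Symmetry

variable (EG : Type*) [NormedAddCommGroup EG] [NormedSpace ℝ EG]
  (G : Type*) [TopologicalSpace G] [ChartedSpace EG G] [Group G] [MulAction G Q]

/-- The action of `G` on `Q` is smooth and its tangent lift preserves the Lagrangian and `D`. -/
structure IsSymmetry : Prop where
  contMDiff_smul : ContMDiff (𝓘(ℝ, EG).prod 𝓘(ℝ, E)) 𝓘(ℝ, E) ∞ (fun p : G × Q => p.1 • p.2)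
  lagrangian_inv : ∀ (g : G) (v : TangentBundle 𝓘(ℝ, E) Q),
    N.lagrangian (tangentMap 𝓘(ℝ, E) 𝓘(ℝ, E) (fun q : Q => g • q) v) = N.lagrangian v
  D_inv : ∀ (g : G) (q : Q), ∀ v ∈ N.D q,
    mfderiv 𝓘(ℝ, E) 𝓘(ℝ, E) (fun q : Q => g • q) q v ∈ N.D (g • q)

end Symmetry

end System

/-- The cotangent lift of the diffeomorphism `q ↦ g • q`. -/
def cotangentLift {G : Type*} [Group G] [MulAction G Q] (g : G) (p : Cotangent E Q) :
    Cotangent E Q :=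
  ⟨g • p.proj, p.2.comp (mfderiv 𝓘(ℝ, E) 𝓘(ℝ, E) (fun q : Q => g • q) p.proj).inverse⟩

namespace System

variable {N : System E Q} {EG : Type*} [NormedAddCommGroup EG] [NormedSpace ℝ EG]
  {G : Type*} [TopologicalSpace G] [ChartedSpace EG G] [Group G] [MulAction G Q]

theorem IsSymmetry.cotangentLift_mem (hG : N.IsSymmetry EG G) (g : G) {p : Cotangent E Q}
    (hp : p ∈ N.constraintSet) : cotangentLift g p ∈ N.constraintSet := by
  have hsm : ∀ g : G, ContMDiff 𝓘(ℝ, E) 𝓘(ℝ, E) ∞ (fun q : Q => g • q) := fun g =>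
    hG.contMDiff_smul.comp (contMDiff_const.prodMk contMDiff_id)
  let Φ : Diffeomorph 𝓘(ℝ, E) 𝓘(ℝ, E) Q Q ∞ :=
    { toEquiv := MulAction.toPerm g
      contMDiff_toFun := hsm g
      contMDiff_invFun := hsm g⁻¹ }
  obtain ⟨⟨q, v⟩, hv, rfl⟩ := hp
  refine ⟨⟨g • q, mfderiv 𝓘(ℝ, E) 𝓘(ℝ, E) (fun q : Q => g • q) q v⟩, hG.D_inv g q v hv, ?_⟩
  let A : TangentSpace 𝓘(ℝ, E) q ≃L[ℝ] TangentSpace 𝓘(ℝ, E) (g • q) :=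
    Φ.mfderivToContinuousLinearEquiv (by simp) q
  have hA : mfderiv 𝓘(ℝ, E) 𝓘(ℝ, E) (fun q : Q => g • q) q = (A : _ →L[ℝ] _) := rfl
  have hL : ∀ u : TangentSpace 𝓘(ℝ, E) q,
      1 / 2 * N.metric.inner (g • q) (A u) (A u) - N.potential (g • q)
        = 1 / 2 * N.metric.inner q u u - N.potential q := fun u => hG.lagrangian_inv g ⟨q, u⟩
  have h0 := hL 0
  simp only [map_zero] at h0
  have hq : ∀ u, N.metric.inner (g • q) (A u) (A u) = N.metric.inner q u u := by
    intro u
    have := hL u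
    linarith
  have hb : ∀ u w, N.metric.inner (g • q) (A u) (A w) = N.metric.inner q u w := by
    intro u w
    have h1 := hq (u + w)
    simp only [map_add, _root_.add_apply, hq] at h1
    have h2 := N.metric.symm (g • q) (A u) (A w)
    have h3 := N.metric.symm q u w
    linarith
  simp only [legendre, cotangentLift, hA]
  congr 1
  ext w
  have hi : (A : TangentSpace 𝓘(ℝ, E) q →L[ℝ] TangentSpace 𝓘(ℝ, E) (g • q)).inverse = A.symm :=
    ContinuousLinearMap.inverse_equiv A
  have := hb v (A.symm w)
  rw [A.apply_symm_apply] at this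
  change _ = N.metric.inner q v
    ((A : TangentSpace 𝓘(ℝ, E) q →L[ℝ] TangentSpace 𝓘(ℝ, E) (g • q)).inverse w)
  rw [hi]
  exact this

/-- The action of `G` on the constraint manifold. -/
def IsSymmetry.act (hG : N.IsSymmetry EG G) (g : G) (m : N.M) : N.M :=
  ⟨cotangentLift g m.1, hG.cotangentLift_mem g m.2⟩

end System

/-! ### Infinitesimal generators and the splitting `TQ = H ⊕ S ⊕ W`

The Lie algebra of `G`, the tangent space at the identity, is as a vector space the model space
`EG` of `G`. -/

section Generators

variable (EG : Type*) [NormedAddCommGroup EG] [NormedSpace ℝ EG]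
  (G : Type*) [TopologicalSpace G] [ChartedSpace EG G] [Group G] [MulAction G Q]

/-- The map `χ ↦ χ_Q(q)`, the derivative at the identity of the orbit map `g ↦ g • q`. -/
def generator (q : Q) : EG →L[ℝ] TangentSpace 𝓘(ℝ, E) q :=
  mfderiv 𝓘(ℝ, EG) 𝓘(ℝ, E) (fun g : G => g • q) 1

/-- The vertical space `V_q`, tangent to the orbit through `q`. -/
def vert (q : Q) : Submodule ℝ (TangentSpace 𝓘(ℝ, E) q) :=
  LinearMap.range (generator EG G q).toLinearMap

namespace System

variable (N : System E Q)

/-- The distribution `S = D ∩ V`. -/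
def S (q : Q) : Submodule ℝ (TangentSpace 𝓘(ℝ, E) q) := N.D q ⊓ vert EG G q

/-- The subspace `(𝔤_S)_q` of the Lie algebra. -/
def gS (q : Q) : Submodule ℝ EG := (N.S EG G q).comap (generator EG G q).toLinearMap

/-- A `G`-invariant vertical complement `W` of `D`, and a `G`-invariant complement `H` of `S` in
`D`. -/
structure Splitting where
  W : ∀ q : Q, Submodule ℝ (TangentSpace 𝓘(ℝ, E) q)
  H : ∀ q : Q, Submodule ℝ (TangentSpace 𝓘(ℝ, E) q)
  smooth_W : IsSmoothDistribution W
  smooth_H : IsSmoothDistribution H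
  W_inv : ∀ (g : G) (q : Q), ∀ v ∈ W q,
    mfderiv 𝓘(ℝ, E) 𝓘(ℝ, E) (fun q : Q => g • q) q v ∈ W (g • q)
  H_inv : ∀ (g : G) (q : Q), ∀ v ∈ H q,
    mfderiv 𝓘(ℝ, E) 𝓘(ℝ, E) (fun q : Q => g • q) q v ∈ H (g • q)
  W_le_vert : ∀ q, W q ≤ vert EG G q
  isCompl_D_W : ∀ q, IsCompl (N.D q) (W q)
  disjoint_H_S : ∀ q, Disjoint (H q) (N.S EG G q)
  H_sup_S : ∀ q, H q ⊔ N.S EG G q = N.D q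

/-- A smooth global basis `η_1, …, η_l` of sections of `𝔤_S`. -/
structure GaugeBasis (l : ℕ) where
  η : ∀ q : Q, Module.Basis (Fin l) ℝ (N.gS EG G q)
  smooth : ∀ i, ContMDiff 𝓘(ℝ, E) 𝓘(ℝ, EG) ∞ (fun q => (η q i : EG))

namespace Splitting

variable {N} {EG} {G} (T : N.Splitting EG G)

/-- The subspace `(𝔤_W)_q` of the Lie algebra. -/
def gW (q : Q) : Submodule ℝ EG := (T.W q).comap (generator EG G q).toLinearMap

/-- `A_W(X) = ξ ∈ 𝔤_W` with `ξ_Q = P_W(X)`. -/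
def AW [FiniteDimensional ℝ E] (q : Q) : TangentSpace 𝓘(ℝ, E) q →L[ℝ] EG :=
  toCovector 𝓘(ℝ, E) ((T.gW q).subtype ∘ₗ
    linLeftInv ((generator EG G q).toLinearMap ∘ₗ (T.gW q).subtype) ∘ₗ projAlong (T.W q) (N.D q))

/-- The connection form: `A_V(X) = ξ` with `ξ_Q = P_V(X)`, for `TQ = H ⊕ V`. -/
def AV [FiniteDimensional ℝ E] (q : Q) : TangentSpace 𝓘(ℝ, E) q →L[ℝ] EG :=
  toCovector 𝓘(ℝ, E)
    (linLeftInv (generator EG G q).toLinearMap ∘ₗ projAlong (vert EG G q) (T.H q))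

/-- The coefficients `A_S^i` of `A_S = A_S^i ⊗ η_i`, where `A_S(X) = η ∈ 𝔤_S` with
`η_Q = P_S(X)`. -/
def AS [FiniteDimensional ℝ E] {l : ℕ} (b : N.GaugeBasis EG G l) (i : Fin l) (q : Q) :
    TangentSpace 𝓘(ℝ, E) q →L[ℝ] ℝ :=
  toCovector 𝓘(ℝ, E) ((b.η q).coord i ∘ₗ
    linLeftInv ((generator EG G q).toLinearMap ∘ₗ (N.gS EG G q).subtype) ∘ₗ
      projAlong (N.S EG G q) (T.H q ⊔ T.W q))

end Splitting

end System

end Generators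

/-! ### The 2-forms `B_1`, `𝓑` and `B` on the constraint manifold -/

namespace System

variable {N : System E Q} {EG : Type*} [NormedAddCommGroup EG] [NormedSpace ℝ EG]
  {G : Type*} [TopologicalSpace G] [ChartedSpace EG G] [Group G] [MulAction G Q]
  (EM : Type*) [NormedAddCommGroup EM] [NormedSpace ℝ EM] [ChartedSpace EM N.M]

/-- The map `χ ↦ χ_M(m)`. -/
def IsSymmetry.generatorM (hG : N.IsSymmetry EG G) (m : N.M) :
    EG →L[ℝ] TangentSpace 𝓘(ℝ, EM) m :=
  let σ : TangentSpace 𝓘(ℝ, EG) (1 : G) →L[ℝ] TangentSpace 𝓘(ℝ, EM) (hG.act 1 m) :=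
    mfderiv 𝓘(ℝ, EG) 𝓘(ℝ, EM) (fun g : G => hG.act g m) 1
  σ

/-- The vertical distribution on `M`, tangent to the orbits. -/
def IsSymmetry.vertM (hG : N.IsSymmetry EG G) (m : N.M) : Submodule ℝ (TangentSpace 𝓘(ℝ, EM) m) :=
  LinearMap.range (hG.generatorM EM m).toLinearMap

/-- The momentum map `J : M → 𝔤^*`. -/
def IsSymmetry.J (hG : N.IsSymmetry EG G) (m : N.M) : EG →L[ℝ] ℝ :=
  (N.liouvilleM EM m).comp (hG.generatorM EM m)

/-- The function `J_i` on `M` associated with the section `η_i`. -/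
def GaugeBasis.J {l : ℕ} (b : N.GaugeBasis EG G l) (hG : N.IsSymmetry EG G) (i : Fin l)
    (m : N.M) : ℝ :=
  hG.J EM m (b.η (N.tau m) i : EG)

/-- The functions `J_i` are first integrals of the nonholonomic vector field, that is, they are
horizontal gauge momenta. -/
def GaugeBasis.AreFirstIntegrals {l : ℕ} (b : N.GaugeBasis EG G l) (hG : N.IsSymmetry EG G) :
    Prop :=
  ∀ (i : Fin l) (m : N.M), mfderiv 𝓘(ℝ, EM) 𝓘(ℝ, ℝ) (b.J EM hG i) m (N.Xnh EM m) = 0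

/-- The functions `J_i` are `G`-invariant. -/
def GaugeBasis.AreInvariant {l : ℕ} (b : N.GaugeBasis EG G l) (hG : N.IsSymmetry EG G) : Prop :=
  ∀ (i : Fin l) (g : G) (m : N.M), b.J EM hG i (hG.act g m) = b.J EM hG i m

variable [FiniteDimensional ℝ E] (hG : N.IsSymmetry EG G) (T : N.Splitting EG G)

namespace Splitting

/-- The distribution `𝓦` on `M`. -/
def distW (m : N.M) : Submodule ℝ (TangentSpace 𝓘(ℝ, EM) m) :=
  (T.gW (N.tau m)).map (hG.generatorM EM m).toLinearMap

/-- The horizontal distribution on `M`, the kernel of the connection `𝓐_V = τ_M^* A_V`. -/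
def distH (m : N.M) : Submodule ℝ (TangentSpace 𝓘(ℝ, EM) m) :=
  LinearMap.ker (pullback 𝓘(ℝ, EM) 𝓘(ℝ, E) N.tau T.AV m).toLinearMap

/-- The projection onto `C` along `𝓦`. -/
def projC (m : N.M) : TangentSpace 𝓘(ℝ, EM) m →ₗ[ℝ] TangentSpace 𝓘(ℝ, EM) m :=
  projAlong (N.distC EM m) (T.distW EM hG m)

/-- The projection onto the horizontal distribution along the vertical one. -/
def projH (m : N.M) : TangentSpace 𝓘(ℝ, EM) m →ₗ[ℝ] TangentSpace 𝓘(ℝ, EM) m :=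
  projAlong (T.distH EM m) (hG.vertM EM m)

/-- The projection onto the vertical distribution along the horizontal one. -/
def projV (m : N.M) : TangentSpace 𝓘(ℝ, EM) m →ₗ[ℝ] TangentSpace 𝓘(ℝ, EM) m :=
  projAlong (hG.vertM EM m) (T.distH EM m)

/-- `d^C θ (u, v) = dθ(P_C u, P_C v)` for a 1-form `θ` on `M`. -/
def dC {F : Type*} [NormedAddCommGroup F] [NormedSpace ℝ F]
    (θ : ∀ m : N.M, TangentSpace 𝓘(ℝ, EM) m →L[ℝ] F) (m : N.M)
    (u v : TangentSpace 𝓘(ℝ, EM) m) : F :=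
  extDer 𝓘(ℝ, EM) θ m ![T.projC EM hG m u, T.projC EM hG m v]

/-- The `𝓦`-curvature `K_W = d^C 𝓐_W`, `𝓐_W = τ_M^* A_W`. -/
def KW (m : N.M) (u v : TangentSpace 𝓘(ℝ, EM) m) : EG :=
  T.dC EM hG (pullback 𝓘(ℝ, EM) 𝓘(ℝ, E) N.tau T.AW) m u v

/-- The curvature `K_V = d^𝓗 𝓐_V` of the connection `𝓐_V = τ_M^* A_V`. -/
def KV (m : N.M) (u v : TangentSpace 𝓘(ℝ, EM) m) : EG :=
  extDer 𝓘(ℝ, EM) (pullback 𝓘(ℝ, EM) 𝓘(ℝ, E) N.tau T.AV) m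
    ![T.projH EM hG m u, T.projH EM hG m v]

variable {l : ℕ} (b : N.GaugeBasis EG G l)

/-- The Lie-algebra-valued 2-form `d^C 𝓐_S^i ⊗ η_i`, `𝓐_S^i = τ_M^* A_S^i`. -/
def dCAS (m : N.M) (u v : TangentSpace 𝓘(ℝ, EM) m) : EG :=
  ∑ i, T.dC EM hG (pullback 𝓘(ℝ, EM) 𝓘(ℝ, E) N.tau (T.AS b i)) m u v • (b.η (N.tau m) i : EG)

/-- `B_1 = ⟨J, K_W⟩ + ⟨J, d^C 𝓐_S^i ⊗ η_i⟩`. -/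
def B₁ (m : N.M) (u v : TangentSpace 𝓘(ℝ, EM) m) : ℝ :=
  hG.J EM m (T.KW EM hG m u v) + hG.J EM m (T.dCAS EM hG b m u v)

/-- The pairing `⟨κ_𝔤(u), χ⟩ = κ(Tτ_M u, χ_Q)`. -/
def kappaG (m : N.M) (u : TangentSpace 𝓘(ℝ, EM) m) (χ : EG) : ℝ :=
  N.metric.inner (N.tau m) (N.dtau EM m u) (generator EG G (N.tau m) χ)

/-- The 2-form `(κ_𝔤 ∧ i_{P_V X_nh} [K_W + d^C 𝓐_S^i ⊗ η_i])_𝓗`. -/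
def kappaWedge (m : N.M) (u v : TangentSpace 𝓘(ℝ, EM) m) : ℝ :=
  let Z := T.projV EM hG m (N.Xnh EM m)
  let hu := T.projH EM hG m u
  let hv := T.projH EM hG m v
  kappaG (G := G) EM m hu (T.KW EM hG m Z hv + T.dCAS EM hG b m Z hv)
    - kappaG (G := G) EM m hv (T.KW EM hG m Z hu + T.dCAS EM hG b m Z hu)

/-- `𝓑 = -⟨J, K_V⟩ - ½ (κ_𝔤 ∧ i_{P_V X_nh} [K_W + d^C 𝓐_S^i ⊗ η_i])_𝓗`. -/
def calB (m : N.M) (u v : TangentSpace 𝓘(ℝ, EM) m) : ℝ :=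
  -hG.J EM m (T.KV EM hG m u v) - 1 / 2 * T.kappaWedge EM hG b m u v

/-- `B = B_1 + 𝓑`. -/
def B (m : N.M) (u v : TangentSpace 𝓘(ℝ, EM) m) : ℝ :=
  T.B₁ EM hG b m u v + T.calB EM hG b m u v

end Splitting

end System

/-! ### Adapted local bases -/

section Frames

variable {N : System E Q} {EG : Type*} [NormedAddCommGroup EG] [NormedSpace ℝ EG]
  {G : Type*} [TopologicalSpace G] [ChartedSpace EG G] [Group G] [MulAction G Q]

/-- A local basis on an open set `U` adapted to `TQ = H ⊕ S ⊕ W`: a `G`-invariant basis `X_α` of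
sections of `H`, the vector fields `Y_i = (η_i)_Q`, and `Z_a = (ξ_a)_Q` for a basis `ξ_a` of sections
of `𝔤_W`. -/
structure AdaptedFrame (T : N.Splitting EG G) {l : ℕ} (b : N.GaugeBasis EG G l) (r k : ℕ) where
  U : Set Q
  isOpen_U : IsOpen U
  X : Fin r → ∀ q : Q, TangentSpace 𝓘(ℝ, E) q
  smooth_X : ∀ α, SmoothFieldOn (X α) U
  X_inv : ∀ α (g : G), ∀ q ∈ U, g • q ∈ U →
    mfderiv 𝓘(ℝ, E) 𝓘(ℝ, E) (fun q : Q => g • q) q (X α q) = X α (g • q)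
  X_linearIndependent : ∀ q ∈ U, LinearIndependent ℝ (fun α => X α q)
  X_span : ∀ q ∈ U, Submodule.span ℝ (range fun α => X α q) = T.H q
  ξ : Fin k → Q → EG
  smooth_ξ : ∀ a, ContMDiffOn 𝓘(ℝ, E) 𝓘(ℝ, EG) ∞ (ξ a) U
  ξ_linearIndependent : ∀ q ∈ U, LinearIndependent ℝ (fun a => ξ a q)
  ξ_span : ∀ q ∈ U, Submodule.span ℝ (range fun a => ξ a q) = T.gW q

namespace AdaptedFrame

variable {T : N.Splitting EG G} {l : ℕ} {b : N.GaugeBasis EG G l} {r k : ℕ}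
  (F : AdaptedFrame T b r k)

/-- The basis `{X_α, Y_i, Z_a}`; the index `.inl α` stands for `α`, and the vertical index `.inr A`
for `A = i` or `A = a`. -/
def field : Fin r ⊕ (Fin l ⊕ Fin k) → ∀ q : Q, TangentSpace 𝓘(ℝ, E) q
  | .inl α, q => F.X α q
  | .inr (.inl i), q => generator EG G q (b.η q i : EG)
  | .inr (.inr a), q => generator EG G q (F.ξ a q)

/-- The dual basis `{X^α, Y^i, ε^a}`. -/
def coframe (I : Fin r ⊕ (Fin l ⊕ Fin k)) (q : Q) : TangentSpace 𝓘(ℝ, E) q →ₗ[ℝ] ℝ :=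
  dualVec (fun J => F.field J q) I

/-- The structure functions `C_{IJ}^K`, the component along `K` of the Lie bracket of the fields `I`
and `J`. -/
def C (K I J : Fin r ⊕ (Fin l ⊕ Fin k)) (q : Q) : ℝ :=
  F.coframe K q (VectorField.mlieBracket 𝓘(ℝ, E) (F.field I) (F.field J) q)

/-- The metric coefficients `κ_{IJ}`. -/
def kappa (I J : Fin r ⊕ (Fin l ⊕ Fin k)) (q : Q) : ℝ :=
  N.metric.inner q (F.field I q) (F.field J q)

/-- The fibre coordinate `p_I` restricted to `M`. -/
def p (I : Fin r ⊕ (Fin l ⊕ Fin k)) (m : N.M) : ℝ := m.1.2 (F.field I (N.tau m))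

/-- The component `v^I` of the velocity corresponding to a point of `M`. -/
def v (I : Fin r ⊕ (Fin l ⊕ Fin k)) (m : N.M) : ℝ := F.coframe I (N.tau m) (N.velocity m.1)

variable (EM : Type*) [NormedAddCommGroup EM] [NormedSpace ℝ EM] [ChartedSpace EM N.M]

/-- The pullbacks to `M` of the 1-forms of the dual basis. -/
def coframeM (I : Fin r ⊕ (Fin l ⊕ Fin k)) (m : N.M) : TangentSpace 𝓘(ℝ, EM) m →ₗ[ℝ] ℝ :=
  F.coframe I (N.tau m) ∘ₗ (N.dtau EM m).toLinearMap

/-- The 2-form `θ^I ∧ θ^J` on `M`, for members `θ^I`, `θ^J` of the pulled back dual basis. -/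
def wedgeM (I J : Fin r ⊕ (Fin l ⊕ Fin k)) (m : N.M) (u w : TangentSpace 𝓘(ℝ, EM) m) : ℝ :=
  wedge (F.coframeM EM I m) (F.coframeM EM J m) u w

end AdaptedFrame

end Frames

end Nonholonomic

end

/-! Every 1-form whose differential enters the three 2-forms is a pullback by τ, and d commutes with
pullback (`extDer_pullback`). The distributions 𝓒 and 𝓗 on M are the preimages of D and H under Tτ,
and the generators on M project to those on Q; hence Tτ intertwines the projections P_𝓒, P_𝓗, P_𝓥
with the projections of TQ = D ⊕ W and TQ = H ⊕ V (`map_projAlong_left`, `map_projAlong_right`). The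
computation therefore takes place on Q, with dA_W, dA_S^i and dA_V evaluated on the adapted fields.

On the fields X_α, Y_i spanning D the forms A_W and A_S^i have constant values, and A_V vanishes on
the X_α. In Cartan's formula dθ(X,Y) = X(θ(Y)) - Y(θ(X)) - θ([X,Y]) only the bracket term survives
(`extDer_eq_neg_of_eventuallyEq_const`). So 𝒦 on the fields I, J of D is -C_{IJ}^A times the section
of 𝔤 with index A, which is η_i or ξ_a (`curvature_fieldD`), and 𝒦_V on the X_α has the same form.
Since ⟨J, χ⟩ = p(χ_Q) (`J_apply`), pairing with J turns that section into p_A. Grouping the terms by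
antisymmetry gives the formula for B₁ and the first term of the formula for 𝓑.

The other term of 𝓑 contains P_𝓥 X_nh. It is found from the second-order condition Tτ(X_nh) = v
(`dtau_Xnh`): as v lies in D, its vertical part is v^i Y_i. The field X_nh is given by a choice
operator, so its defining equation has to be shown solvable (`exists_Xnh`). This is nondegeneracy of
Ω_M on 𝓒: in bundle coordinates Ω is dq ∧ dp, the τ-vertical tangent vectors of M are the covectors
κ(e, ·) with e ∈ D, and κ is positive definite. In the sum B₁ + 𝓑 the terms p_A C_{αβ}^A cancel.

Freeness of the action supplies injectivity of χ ↦ χ_Q(q) (`generator_injective`); with it the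
connection forms return the sections they should, and the adapted fields form a frame. -/

noncomputable section

namespace Nonholonomic

/-! ### 1-forms and vector fields in charts: d of a pullback, and Cartan's formula. -/

section LocalForms

variable {E H M F : Type*} [NormedAddCommGroup E] [NormedSpace ℝ E] [TopologicalSpace H]
  [TopologicalSpace M] [ChartedSpace H M] [NormedAddCommGroup F] [NormedSpace ℝ F]
  {E' H' M' : Type*} [NormedAddCommGroup E'] [NormedSpace ℝ E'] [TopologicalSpace H']
  [TopologicalSpace M'] [ChartedSpace H' M']

/-- The derivative of a map between manifolds, as a map between the model spaces. -/
def modelDeriv (I : ModelWithCorners ℝ E H) (I' : ModelWithCorners ℝ E' H') (f : M → M') (x : M) :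
    E →L[ℝ] E' :=
  mfderiv I I' f x

/-- A 1-form read in the preferred chart at `x`. -/
def localForm (I : ModelWithCorners ℝ E H) (θ : ∀ x : M, TangentSpace I x →L[ℝ] F) (x : M)
    (y : E) : E →L[ℝ] F :=
  (θ ((extChartAt I x).symm y)).comp
    (mfderivWithin 𝓘(ℝ, E) I (extChartAt I x).symm (range I) y)

/-- Differentiability of a 1-form at a point, read in the preferred chart. -/
def FormDifferentiableAt (I : ModelWithCorners ℝ E H) (θ : ∀ x : M, TangentSpace I x →L[ℝ] F)
    (x : M) : Prop :=
  DifferentiableAt ℝ (localForm I θ x) (extChartAt I x x)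

variable {I : ModelWithCorners ℝ E H} {I' : ModelWithCorners ℝ E' H'}

theorem modelDeriv_comp {E'' H'' M'' : Type*} [NormedAddCommGroup E''] [NormedSpace ℝ E'']
    [TopologicalSpace H''] [TopologicalSpace M''] [ChartedSpace H'' M'']
    {I'' : ModelWithCorners ℝ E'' H''} {g : M' → M''} {f : M → M'} {x : M}
    (hg : MDifferentiableAt I' I'' g (f x)) (hf : MDifferentiableAt I I' f x) :
    modelDeriv I I'' (fun z => g (f z)) x = (modelDeriv I' I'' g (f x)).comp (modelDeriv I I' f x) :=
  mfderiv_comp x hg hf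

theorem modelDeriv_eq_fderiv {f : E → E'} {x : E} :
    modelDeriv 𝓘(ℝ, E) 𝓘(ℝ, E') f x = fderiv ℝ f x :=
  mfderiv_eq_fderiv

theorem modelDeriv_id (x : M) : modelDeriv I I (fun z => z) x = ContinuousLinearMap.id ℝ E :=
  mfderiv_id

theorem modelDeriv_congr {f g : M → M'} {x : M} (h : f =ᶠ[𝓝 x] g) :
    modelDeriv I I' f x = modelDeriv I I' g x := by
  have := h.mfderiv_eq (I := I) (I' := I')
  exact this

theorem HasMFDerivAt.modelDeriv_eq {f : M → M'} {x : M} {f' : E →L[ℝ] E'}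
    (h : HasMFDerivAt I I' f x f') : modelDeriv I I' f x = f' :=
  h.mfderiv

theorem modelDeriv_eq_fderiv_written [I.Boundaryless] {f : M → M'} {x : M}
    (h : MDifferentiableAt I I' f x) :
    modelDeriv I I' f x = fderiv ℝ (writtenInExtChartAt I I' x f) (extChartAt I x x) := by
  have h1 : modelDeriv I I' f x =
      fderivWithin ℝ (writtenInExtChartAt I I' x f) (range I) (extChartAt I x x) := by
    have := h.mfderiv
    exact this
  rw [h1, I.range_eq_univ, fderivWithin_univ]

theorem form_congr_point (θ : ∀ x : M, TangentSpace I x →L[ℝ] F) {z x : M} (h : z = x) (v : E) :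
    (show E →L[ℝ] F from θ z) v = (show E →L[ℝ] F from θ x) v := by
  subst h; rfl

theorem field_congr_point (X : ∀ x : M, TangentSpace I x) {z x : M} (h : z = x) :
    (show E from X z) = (show E from X x) := by
  subst h; rfl

/-- The tangent space at `x` is identified with the model space through the preferred chart at `x`,
so the derivative of the inverse chart at the base point is the identity. -/
theorem localForm_self [IsManifold I 1 M] (θ : ∀ x : M, TangentSpace I x →L[ℝ] F) (x : M)
    (v : E) : localForm I θ x (extChartAt I x x) v = (show E →L[ℝ] F from θ x) v := by
  have h := mfderivWithin_range_extChartAt_symm (I := I) (x := x)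
  have h2 : localForm I θ x (extChartAt I x x) v =
      (show E →L[ℝ] F from θ ((extChartAt I x).symm (extChartAt I x x)))
        ((show E →L[ℝ] E from
          mfderivWithin 𝓘(ℝ, E) I (extChartAt I x).symm (range I) (extChartAt I x x)) v) := rfl
  rw [h2]
  have h3 : (show E →L[ℝ] E from
          mfderivWithin 𝓘(ℝ, E) I (extChartAt I x).symm (range I) (extChartAt I x x)) v = v := by
    have := congrArg (fun f => (show E →L[ℝ] E from f) v) h
    exact this
  rw [h3]
  exact form_congr_point θ (extChartAt_to_inv (I := I) x) v

/-- In degree one the alternating sum defining `extDeriv` has two terms, the antisymmetrisation of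
the derivative. Absence of boundary turns derivatives within the range of the model into ordinary
ones. -/
theorem extDer_apply [I.Boundaryless] {θ : ∀ x : M, TangentSpace I x →L[ℝ] F} {x : M}
    (h : FormDifferentiableAt I θ x) (u v : TangentSpace I x) :
    extDer I θ x ![u, v] =
      fderiv ℝ (localForm I θ x) (extChartAt I x x) u v
        - fderiv ℝ (localForm I θ x) (extChartAt I x x) v u := by
  have hr : range I = univ := I.range_eq_univ
  let L : (E →L[ℝ] F) ≃ₗᵢ[ℝ] (E [⋀^Fin 1]→L[ℝ] F) :=
    ContinuousAlternatingMap.ofSubsingletonLIE (0 : Fin 1)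
  have h1 : extDer I θ x =
      (extDeriv (fun y => L (localForm I θ x y)) (extChartAt I x x) : E [⋀^Fin 2]→L[ℝ] F) := by
    rw [← extDerivWithin_univ, ← hr]
    rfl
  rw [h1]
  have hd : DifferentiableAt ℝ (fun y => L (localForm I θ x y)) (extChartAt I x x) :=
    L.toContinuousLinearEquiv.differentiableAt.comp _ h
  have hf : ∀ c d : E, fderiv ℝ (fun y => localForm I θ x y c) (extChartAt I x x) d =
      fderiv ℝ (localForm I θ x) (extChartAt I x x) d c := fun c d => by
    have := (((ContinuousLinearMap.apply ℝ F c).hasFDerivAt (x := localForm I θ x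
      (extChartAt I x x))).comp _ h.hasFDerivAt).fderiv
    exact congrArg (fun g : E →L[ℝ] F => g d) this
  let u' : E := u
  let v' : E := v
  change extDeriv _ _ ![u', v'] = fderiv ℝ (localForm I θ x) (extChartAt I x x) u' v'
        - fderiv ℝ (localForm I θ x) (extChartAt I x x) v' u'
  rw [extDeriv_apply hd]
  rw [Fin.sum_univ_two]
  simp only [Fin.val_zero, Fin.val_one, pow_zero, pow_one, one_smul, neg_smul]
  rw [sub_eq_add_neg, ← hf, ← hf]
  rfl

/-- The chain rule: the derivative of the target chart, contained in that of the coordinate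
expression of `f`, cancels against the derivative of the inverse chart contained in the local form
of `θ`. Equality is needed near the point, not only at it, because both sides will be
differentiated. -/
theorem localForm_pullback_eventuallyEq [I.Boundaryless] [I'.Boundaryless]
    [IsManifold I 1 M] [IsManifold I' 1 M'] {f : M → M'}
    {x : M} (hf : ∀ᶠ z in 𝓝 x, MDifferentiableAt I I' f z)
    (θ : ∀ x : M', TangentSpace I' x →L[ℝ] F) :
    localForm I (pullback I I' f θ) x =ᶠ[𝓝 (extChartAt I x x)] fun y =>
      (localForm I' θ (f x) (writtenInExtChartAt I I' x f y)).comp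
        (fderiv ℝ (writtenInExtChartAt I I' x f) y) := by
  have hr : range I = univ := I.range_eq_univ
  have hr' : range I' = univ := I'.range_eq_univ
  have hfx : MDifferentiableAt I I' f x := hf.self_of_nhds
  have htar : ∀ᶠ y in 𝓝 (extChartAt I x x), y ∈ (extChartAt I x).target :=
    extChartAt_target_mem_nhds x
  have hsymm : ContinuousAt (extChartAt I x).symm (extChartAt I x x) := continuousAt_extChartAt_symm x
  have h0 : (extChartAt I x).symm (extChartAt I x x) = x := extChartAt_to_inv x
  have hdiff : ∀ᶠ y in 𝓝 (extChartAt I x x), MDifferentiableAt I I' f ((extChartAt I x).symm y) :=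
    hsymm.eventually (by rw [h0]; exact hf)
  have hsrc : ∀ᶠ y in 𝓝 (extChartAt I x x),
      f ((extChartAt I x).symm y) ∈ (extChartAt I' (f x)).source := by
    have hc : ContinuousAt (fun y => f ((extChartAt I x).symm y)) (extChartAt I x x) := by
      refine ContinuousAt.comp ?_ hsymm
      rw [h0]; exact hfx.continuousAt
    apply hc.eventually
    simp only [h0]
    exact extChartAt_source_mem_nhds (f x)
  filter_upwards [htar, hdiff, hsrc] with y hy hd hs
  have hsy : MDifferentiableAt 𝓘(ℝ, E) I (extChartAt I x).symm y := by
    have := mdifferentiableWithinAt_extChartAt_symm (I := I) hy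
    rwa [hr, mdifferentiableWithinAt_univ] at this
  have hco : MDifferentiableAt I' 𝓘(ℝ, E') (extChartAt I' (f x)) (f ((extChartAt I x).symm y)) :=
    mdifferentiableAt_extChartAt (by simpa using hs)
  have h1 : fderiv ℝ (writtenInExtChartAt I I' x f) y =
      (modelDeriv I' 𝓘(ℝ, E') (extChartAt I' (f x)) (f ((extChartAt I x).symm y))).comp
        ((modelDeriv I I' f ((extChartAt I x).symm y)).comp
          (modelDeriv 𝓘(ℝ, E) I (extChartAt I x).symm y)) := by
    rw [← modelDeriv_comp hd hsy, ← modelDeriv_comp (f := fun z => f ((extChartAt I x).symm z)) hco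
      (hd.comp y hsy), modelDeriv_eq_fderiv]
    rfl
  have h2 : (mfderivWithin 𝓘(ℝ, E') I' (extChartAt I' (f x)).symm (range I')
      (writtenInExtChartAt I I' x f y)).comp
      (mfderiv I' 𝓘(ℝ, E') (extChartAt I' (f x)) (f ((extChartAt I x).symm y)))
      = ContinuousLinearMap.id ℝ _ :=
    mfderivWithin_extChartAt_symm_comp_mfderiv_extChartAt' hs
  have h3 : (extChartAt I' (f x)).symm (writtenInExtChartAt I I' x f y)
      = f ((extChartAt I x).symm y) := (extChartAt I' (f x)).left_inv hs
  ext v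
  let S : E →L[ℝ] E := mfderiv 𝓘(ℝ, E) I (extChartAt I x).symm y
  let T : E →L[ℝ] E' := mfderiv I I' f ((extChartAt I x).symm y)
  let C : E' →L[ℝ] E' := mfderiv I' 𝓘(ℝ, E') (extChartAt I' (f x)) (f ((extChartAt I x).symm y))
  let D : E' →L[ℝ] E' := mfderivWithin 𝓘(ℝ, E') I' (extChartAt I' (f x)).symm (range I')
      (writtenInExtChartAt I I' x f y)
  have h1' : ∀ v, fderiv ℝ (writtenInExtChartAt I I' x f) y v = C (T (S v)) := fun v =>
    congrArg (fun g => (show E →L[ℝ] E' from g) v) h1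
  have h2' : ∀ v, D (C v) = v := fun v => congrArg (fun g => (show E' →L[ℝ] E' from g) v) h2
  have hl : localForm I (pullback I I' f θ) x y v =
      (show E' →L[ℝ] F from θ (f ((extChartAt I x).symm y))) (T (S v)) := by
    simp only [localForm, hr, mfderivWithin_univ]
    rfl
  have hrr : localForm I' θ (f x) (writtenInExtChartAt I I' x f y)
      (fderiv ℝ (writtenInExtChartAt I I' x f) y v) =
      (show E' →L[ℝ] F from θ ((extChartAt I' (f x)).symm (writtenInExtChartAt I I' x f y)))
        (D (fderiv ℝ (writtenInExtChartAt I I' x f) y v)) := rfl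
  rw [ContinuousLinearMap.comp_apply, hl, hrr, h1', h2', form_congr_point θ h3]

/-- Differentiating the coordinate expression of the pullback yields the wanted term and one with
the second derivative of `f`. The latter is symmetric and drops out on antisymmetrising, which is
why `f` is required to be C². -/
theorem extDer_pullback [I.Boundaryless] [I'.Boundaryless]
    [IsManifold I 1 M] [IsManifold I' 1 M'] {f : M → M'} {x : M}
    (hf : ∀ᶠ z in 𝓝 x, MDifferentiableAt I I' f z)
    (hf2 : ContMDiffAt I I' 2 f x) {θ : ∀ x : M', TangentSpace I' x →L[ℝ] F}
    (hθ : FormDifferentiableAt I' θ (f x)) (u v : TangentSpace I x) :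
    extDer I (pullback I I' f θ) x ![u, v] =
      extDer I' θ (f x) ![mfderiv I I' f x u, mfderiv I I' f x v] := by
  have hr : range I = univ := I.range_eq_univ
  set t := writtenInExtChartAt I I' x f with ht
  set y₀ := extChartAt I x x with hy₀
  have ht0 : t y₀ = extChartAt I' (f x) (f x) := by
    simp [ht, hy₀, writtenInExtChartAt]
  have htc : ContDiffAt ℝ 2 t y₀ := by
    have := (contMDiffAt_iff.1 hf2).2
    rwa [hr, contDiffWithinAt_univ] at this
  have hdt : DifferentiableAt ℝ (fderiv ℝ t) y₀ :=
    (htc.fderiv_right (m := 1) (by norm_num)).differentiableAt (by simp)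
  have htd : DifferentiableAt ℝ t y₀ := htc.differentiableAt (by simp)
  have hfd : ∀ v : E, fderiv ℝ t y₀ v = (show E →L[ℝ] E' from mfderiv I I' f x) v := by
    intro v
    have := modelDeriv_eq_fderiv_written hf.self_of_nhds
    rw [← hy₀, ← ht] at this
    rw [← this]
    rfl
  have hev := localForm_pullback_eventuallyEq hf θ
  have hθ' : HasFDerivAt (localForm I' θ (f x)) (fderiv ℝ (localForm I' θ (f x)) (t y₀)) (t y₀) := by
    rw [ht0]; exact DifferentiableAt.hasFDerivAt hθ
  have hder := ((hθ'.comp y₀ htd.hasFDerivAt).clm_comp hdt.hasFDerivAt).congr_of_eventuallyEq hev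
  have hsymm : IsSymmSndFDerivAt ℝ t y₀ := htc.isSymmSndFDerivAt (by simp)
  let u' : E := u
  let v' : E := v
  rw [extDer_apply hder.differentiableAt, extDer_apply hθ, hder.fderiv]
  have hs := hsymm u' v'
  change _ = fderiv ℝ (localForm I' θ (f x)) (extChartAt I' (f x) (f x))
    ((show E →L[ℝ] E' from mfderiv I I' f x) u') ((show E →L[ℝ] E' from mfderiv I I' f x) v') -
     fderiv ℝ (localForm I' θ (f x)) (extChartAt I' (f x) (f x))
    ((show E →L[ℝ] E' from mfderiv I I' f x) v') ((show E →L[ℝ] E' from mfderiv I I' f x) u')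
  rw [← hfd, ← hfd, ← ht0]
  change _ + fderiv ℝ (localForm I' θ (f x)) (t y₀) (fderiv ℝ t y₀ u') (fderiv ℝ t y₀ v') -
    (_ + fderiv ℝ (localForm I' θ (f x)) (t y₀) (fderiv ℝ t y₀ v') (fderiv ℝ t y₀ u')) = _
  have : (localForm I' θ (f x) (t y₀)) ((fderiv ℝ (fderiv ℝ t) y₀ u') v') =
    (localForm I' θ (f x) (t y₀)) ((fderiv ℝ (fderiv ℝ t) y₀ v') u') := by rw [hs]
  change (localForm I' θ (f x) (t y₀)) ((fderiv ℝ (fderiv ℝ t) y₀ u') v') + _ -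
    ((localForm I' θ (f x) (t y₀)) ((fderiv ℝ (fderiv ℝ t) y₀ v') u') + _) = _
  rw [this]
  abel

/-- A vector field read in the preferred chart at `x`. -/
def localField (I : ModelWithCorners ℝ E H) (V : ∀ x : M, TangentSpace I x) (x : M) (y : E) : E :=
  VectorField.mpullbackWithin 𝓘(ℝ, E) I (extChartAt I x).symm V (range I) y

theorem localField_self [IsManifold I 1 M] (V : ∀ x : M, TangentSpace I x) (x : M) :
    localField I V x (extChartAt I x x) = (show E from V x) :=
  (mfderivWithin_extChartAt_symm_inverse_apply (I := I) (x := x)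
    (show E from V ((extChartAt I x).symm (extChartAt I x x)))).trans
      (field_congr_point V (extChartAt_to_inv x))

theorem localField_differentiableAt [I.Boundaryless] [FiniteDimensional ℝ E] [IsManifold I ∞ M]
    {V : ∀ x : M, TangentSpace I x} {x : M}
    (hV : ContMDiffAt I I.tangent 1 (fun z => (⟨z, V z⟩ : TangentBundle I M)) x) :
    DifferentiableAt ℝ (localField I V x) (extChartAt I x x) := by
  have : IsManifold I (1 + 1) M := by rw [one_add_one_eq_two]; infer_instance
  have hc := VectorField.contMDiffWithinAt_mpullbackWithin_extChartAt_symm (I := I) (x := x)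
    (m := 1) (n := 2) (s := univ) (contMDiffWithinAt_univ.2 hV) uniqueMDiffOn_univ (mem_univ x)
    (by norm_num)
  rw [I.range_eq_univ, preimage_univ, inter_univ] at hc
  replace hc := hc.contMDiffAt (extChartAt_target_mem_nhds x)
  have := (contMDiffAt_vectorSpace_iff_contDiffAt.1 hc).differentiableAt one_ne_zero
  unfold localField
  rw [I.range_eq_univ]
  exact this

/-- The form is composed with the derivative of the inverse chart and the field with the inverse of
that derivative, so the pairing does not see the chart. -/
theorem localForm_localField_eventuallyEq [I.Boundaryless] [IsManifold I 1 M]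
    (θ : ∀ x : M, TangentSpace I x →L[ℝ] F) (V : ∀ x : M, TangentSpace I x) (x : M) :
    ∀ᶠ y in 𝓝 (extChartAt I x x), localForm I θ x y (localField I V x y) =
      θ ((extChartAt I x).symm y) (V ((extChartAt I x).symm y)) := by
  filter_upwards [extChartAt_target_mem_nhds (I := I) x] with y hy
  have hinv := isInvertible_mfderivWithin_extChartAt_symm (I := I) hy
  have := hinv.self_apply_inverse (V ((extChartAt I x).symm y))
  exact congrArg (fun v => (show E →L[ℝ] F from θ ((extChartAt I x).symm y)) v) this

/-- Cartan's formula with the two derivative terms gone, since θ(X) and θ(Y) are constant near the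
point. All curvatures below are computed from it. -/
theorem extDer_eq_neg_of_eventuallyEq_const [I.Boundaryless] [FiniteDimensional ℝ E]
    [IsManifold I ∞ M] {θ : ∀ x : M, TangentSpace I x →L[ℝ] F} {x : M}
    (hθ : FormDifferentiableAt I θ x) {X Y : ∀ x : M, TangentSpace I x}
    (hX : ContMDiffAt I I.tangent 1 (fun z => (⟨z, X z⟩ : TangentBundle I M)) x)
    (hY : ContMDiffAt I I.tangent 1 (fun z => (⟨z, Y z⟩ : TangentBundle I M)) x)
    {a b : F} (ha : ∀ᶠ z in 𝓝 x, θ z (X z) = a) (hb : ∀ᶠ z in 𝓝 x, θ z (Y z) = b) :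
    extDer I θ x ![X x, Y x] = -θ x (VectorField.mlieBracket I X Y x) := by
  have : IsManifold I 1 M := inferInstance
  have hr : range I = univ := I.range_eq_univ
  set y₀ := extChartAt I x x with hy₀
  have h0 : (extChartAt I x).symm y₀ = x := extChartAt_to_inv x
  have hsymm : ContinuousAt (extChartAt I x).symm y₀ := continuousAt_extChartAt_symm x
  -- Product rule applied to the constant function θ(V): the derivative of θ may be traded for minus
  -- the derivative of V. Antisymmetrised, the derivatives of the fields assemble into the bracket.
  have hconst : ∀ (V : ∀ x : M, TangentSpace I x) (c : F),
      ContMDiffAt I I.tangent 1 (fun z => (⟨z, V z⟩ : TangentBundle I M)) x →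
      (∀ᶠ z in 𝓝 x, θ z (V z) = c) → ∀ w : E,
      fderiv ℝ (localForm I θ x) y₀ w (V x) =
        - localForm I θ x y₀ (fderiv ℝ (localField I V x) y₀ w) := by
    intro V c hV hc w
    have hd := (HasFDerivAt.clm_apply (DifferentiableAt.hasFDerivAt hθ)
      (localField_differentiableAt hV).hasFDerivAt)
    have hev : (fun y => localForm I θ x y (localField I V x y)) =ᶠ[𝓝 y₀] fun _ => c := by
      have hc' : ∀ᶠ y in 𝓝 y₀,
          θ ((extChartAt I x).symm y) (V ((extChartAt I x).symm y)) = c :=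
        hsymm.eventually (by rw [h0]; exact hc)
      filter_upwards [localForm_localField_eventuallyEq θ V x, hc'] with y h1 h2
      rw [h1, h2]
    have hz := (hd.congr_of_eventuallyEq hev.symm).unique (hasFDerivAt_const c y₀)
    have hz2 := congrArg (fun g : E →L[ℝ] F => g w) hz
    change localForm I θ x y₀ (fderiv ℝ (localField I V x) y₀ w) +
      fderiv ℝ (localForm I θ x) y₀ w (localField I V x y₀) = 0 at hz2
    rw [localField_self V x] at hz2
    rw [eq_neg_iff_add_eq_zero, add_comm]
    exact hz2
  have hbr : (show E from VectorField.mlieBracket I X Y x) =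
      fderiv ℝ (localField I Y x) y₀ (X x) - fderiv ℝ (localField I X x) y₀ (Y x) := by
    have h1 : (show E from VectorField.mlieBracket I X Y x) =
        (show E →L[ℝ] E from (mfderiv I 𝓘(ℝ, E) (extChartAt I x) x).inverse)
        (VectorField.lieBracketWithin ℝ (localField I X x) (localField I Y x)
          ((extChartAt I x).symm ⁻¹' univ ∩ range I) y₀) := rfl
    have h2 : ∀ v : E,
        (show E →L[ℝ] E from (mfderiv I 𝓘(ℝ, E) (extChartAt I x) x).inverse) v = v := by
      intro v
      have h3 := mfderiv_extChartAt_self (I := I) (x := x)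
      have h4 : ∀ A : E →L[ℝ] E, A = ContinuousLinearMap.id ℝ E → A.inverse v = v := by
        rintro _ rfl
        rw [ContinuousLinearMap.inverse_id]; rfl
      exact h4 _ h3
    rw [h1, h2, hr, preimage_univ, univ_inter, VectorField.lieBracketWithin_univ,
      VectorField.lieBracket, localField_self, localField_self]
  rw [extDer_apply hθ]
  refine (congrArg₂ (fun a b => a - b) (hconst Y b hY hb (X x)) (hconst X a hX ha (Y x))).trans ?_
  have hθx : ∀ v : E, θ x v = localForm I θ x y₀ v := fun v => (localForm_self θ x v).symm
  refine Eq.trans ?_ (congrArg Neg.neg (hθx (VectorField.mlieBracket I X Y x)).symm)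
  have := congrArg (fun v : E => - localForm I θ x y₀ v) hbr
  refine Eq.trans ?_ this.symm
  simp only [map_sub]
  abel

/-- A form with differentiable values on a local frame is differentiable. -/
theorem formDifferentiableAt_of_frame [I.Boundaryless] [FiniteDimensional ℝ E]
    [IsManifold I ∞ M] {θ : ∀ x : M, TangentSpace I x →L[ℝ] F} {x : M} {ι : Type*} [Fintype ι]
    {X : ι → ∀ x : M, TangentSpace I x}
    (hX : ∀ i, ContMDiffAt I I.tangent 1 (fun z => (⟨z, X i z⟩ : TangentBundle I M)) x)
    (hli : LinearIndependent ℝ fun i => X i x)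
    (hsp : ⊤ ≤ Submodule.span ℝ (range fun i => X i x))
    (hθ : ∀ i, MDifferentiableAt I 𝓘(ℝ, F) (fun z => θ z (X i z)) x) :
    FormDifferentiableAt I θ x := by
  have : IsManifold I 1 M := inferInstance
  set y₀ := extChartAt I x x with hy₀
  have h0 : (extChartAt I x).symm y₀ = x := extChartAt_to_inv x
  -- `A` sends coefficients to the combination of the frame and `f` sends them to the value of the
  -- form on it. In the chart the form is thus `f` composed with the inverse of `A`, and inversion
  -- is differentiable at an invertible map.
  let A : E → (ι → ℝ) →L[ℝ] E := fun y =>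
    ∑ i, (ContinuousLinearMap.proj i : (ι → ℝ) →L[ℝ] ℝ).smulRight (localField I (X i) x y)
  let f : E → (ι → ℝ) →L[ℝ] F := fun y =>
    ∑ i, (ContinuousLinearMap.proj i : (ι → ℝ) →L[ℝ] ℝ).smulRight
      (θ ((extChartAt I x).symm y) (X i ((extChartAt I x).symm y)))
  have hA : DifferentiableAt ℝ A y₀ := by
    refine DifferentiableAt.fun_sum fun i _ => ?_
    exact (ContinuousLinearMap.smulRightL ℝ (ι → ℝ) E
      (ContinuousLinearMap.proj i)).differentiableAt.comp y₀ (localField_differentiableAt (hX i))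
  have hf : DifferentiableAt ℝ f y₀ := by
    refine DifferentiableAt.fun_sum fun i _ => ?_
    have h1 : DifferentiableAt ℝ
        (fun y => θ ((extChartAt I x).symm y) (X i ((extChartAt I x).symm y))) y₀ := by
      rw [← mdifferentiableAt_iff_differentiableAt]
      have hs : MDifferentiableAt 𝓘(ℝ, E) I (extChartAt I x).symm y₀ := by
        have := mdifferentiableWithinAt_extChartAt_symm (I := I) (mem_extChartAt_target x)
        rwa [I.range_eq_univ, mdifferentiableWithinAt_univ] at this
      refine MDifferentiableAt.comp y₀ (g := fun z => θ z (X i z)) ?_ hs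
      rw [h0]; exact hθ i
    exact (ContinuousLinearMap.smulRightL ℝ (ι → ℝ) F
      (ContinuousLinearMap.proj i)).differentiableAt.comp y₀ h1
  have hAv : ∀ y c, A y c = ∑ i, c i • localField I (X i) x y := fun y c => by
    simp [A]
  let X₀ : ι → E := fun i => X i x
  have hli' : LinearIndependent ℝ X₀ := hli
  have hsp' : ⊤ ≤ Submodule.span ℝ (range X₀) := hsp
  let bs : Module.Basis ι ℝ E := Module.Basis.mk hli' hsp'
  let e : (ι → ℝ) ≃L[ℝ] E := bs.equivFun.symm.toContinuousLinearEquiv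
  have he : A y₀ = e := by
    ext1 c
    rw [hAv]
    change _ = bs.equivFun.symm c
    rw [Module.Basis.equivFun_symm_apply]
    refine Finset.sum_congr rfl fun i _ => ?_
    rw [localField_self]
    have hb : bs i = X₀ i := Module.Basis.mk_apply hli' hsp' i
    rw [hb]
  have hinv : DifferentiableAt ℝ (fun y => (A y).inverse) y₀ := by
    have h1 := (contDiffAt_map_inverse (𝕜 := ℝ) (n := 1) e).differentiableAt one_ne_zero
    rw [← he] at h1
    exact h1.comp y₀ hA
  have hev : localForm I θ x =ᶠ[𝓝 y₀] fun y => (f y).comp (A y).inverse := by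
    have hinv' : ∀ᶠ y in 𝓝 y₀, (A y).IsInvertible := by
      have := hA.continuousAt.eventually
        ((ContinuousLinearEquiv.isOpen (𝕜 := ℝ) (E := ι → ℝ) (F := E)).mem_nhds ⟨e, he.symm⟩)
      exact this
    have hform : ∀ᶠ y in 𝓝 y₀, ∀ i, localForm I θ x y (localField I (X i) x y) =
        θ ((extChartAt I x).symm y) (X i ((extChartAt I x).symm y)) :=
      Filter.eventually_all.2 fun i => localForm_localField_eventuallyEq θ (X i) x
    filter_upwards [hinv', hform] with y h1 h2
    have h3 : (localForm I θ x y).comp (A y) = f y := by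
      ext1 c
      rw [ContinuousLinearMap.comp_apply, hAv, map_sum]
      simp only [f, map_smul, h2]
      simp
    ext1 v
    rw [← h3, ContinuousLinearMap.comp_apply, ContinuousLinearMap.comp_apply,
      h1.self_apply_inverse]
  exact (hf.clm_comp hinv).congr_of_eventuallyEq hev

end LocalForms

/-! ### Infinitesimal generators: smoothness, and injectivity for a free action. -/

section GeneratorFields

variable {E : Type*} [NormedAddCommGroup E] [NormedSpace ℝ E]
  {Q : Type*} [TopologicalSpace Q] [ChartedSpace E Q]
  {EG : Type*} [NormedAddCommGroup EG] [NormedSpace ℝ EG]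
  {G : Type*} [TopologicalSpace G] [ChartedSpace EG G] [Group G] [MulAction G Q]

theorem contMDiffAt_tangent_fibre {E' H' M' : Type*} [NormedAddCommGroup E'] [NormedSpace ℝ E']
    [TopologicalSpace H'] {I' : ModelWithCorners ℝ E' H'} [TopologicalSpace M'] [ChartedSpace H' M']
    {EM HM M : Type*} [NormedAddCommGroup EM] [NormedSpace ℝ EM] [TopologicalSpace HM]
    [TopologicalSpace M] [ChartedSpace HM M] {I : ModelWithCorners ℝ EM HM}
    [IsManifold I 1 M] {n : WithTop ℕ∞} (x : M) {s : M' → EM} {y : M'}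
    (hs : ContMDiffAt I' 𝓘(ℝ, EM) n s y) :
    ContMDiffAt I' I.tangent n (fun z => (⟨x, s z⟩ : TangentBundle I M)) y := by
  rw [Bundle.contMDiffAt_totalSpace]
  refine ⟨contMDiffAt_const, ?_⟩
  let L : EM →L[ℝ] EM :=
    (trivializationAt EM (TangentSpace I : M → Type _) x).continuousLinearMapAt ℝ x
  have hL : ∀ v : EM, (trivializationAt EM (TangentSpace I : M → Type _) x
      (⟨x, v⟩ : TangentBundle I M)).2 = L v := fun v =>
    (Bundle.Trivialization.continuousLinearMapAt_apply_of_mem ℝ _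
      (FiberBundle.mem_baseSet_trivializationAt EM (TangentSpace I : M → Type _) x) v).symm
  refine ContMDiffAt.congr_of_eventuallyEq ?_ (Filter.Eventually.of_forall fun z => hL (s z))
  exact L.contMDiff.contMDiffAt.comp y hs

theorem contMDiff_smul_left
    (hsm : ContMDiff (𝓘(ℝ, EG).prod 𝓘(ℝ, E)) 𝓘(ℝ, E) ∞ (fun p : G × Q => p.1 • p.2)) (g : G) :
    ContMDiff 𝓘(ℝ, E) 𝓘(ℝ, E) ∞ (fun q : Q => g • q) :=
  hsm.comp (contMDiff_const.prodMk contMDiff_id)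

theorem contMDiff_smul_right
    (hsm : ContMDiff (𝓘(ℝ, EG).prod 𝓘(ℝ, E)) 𝓘(ℝ, E) ∞ (fun p : G × Q => p.1 • p.2)) (q : Q) :
    ContMDiff 𝓘(ℝ, EG) 𝓘(ℝ, E) ∞ (fun g : G => g • q) :=
  hsm.comp (contMDiff_id.prodMk contMDiff_const)

theorem modelDeriv_prod {EM HM M : Type*} [NormedAddCommGroup EM] [NormedSpace ℝ EM]
    [TopologicalSpace HM] [TopologicalSpace M] [ChartedSpace HM M] {I : ModelWithCorners ℝ EM HM}
    {E' H' M' : Type*} [NormedAddCommGroup E'] [NormedSpace ℝ E']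
    [TopologicalSpace H'] {I' : ModelWithCorners ℝ E' H'} [TopologicalSpace M'] [ChartedSpace H' M']
    {E'' H'' M'' : Type*} [NormedAddCommGroup E''] [NormedSpace ℝ E'']
    [TopologicalSpace H''] {I'' : ModelWithCorners ℝ E'' H''} [TopologicalSpace M'']
    [ChartedSpace H'' M''] {f : M × M' → M''} {p : M × M'}
    (hf : MDifferentiableAt (I.prod I') I'' f p) (v : EM × E') :
    modelDeriv (I.prod I') I'' f p v = modelDeriv I I'' (fun z => f (z, p.2)) p.1 v.1 +
      modelDeriv I' I'' (fun z => f (p.1, z)) p.2 v.2 :=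
  mfderiv_prod_eq_add_apply hf

theorem HasMFDerivAt.congr_modelDeriv {EM HM M : Type*} [NormedAddCommGroup EM] [NormedSpace ℝ EM]
    [TopologicalSpace HM] [TopologicalSpace M] [ChartedSpace HM M] {I : ModelWithCorners ℝ EM HM}
    {E' H' M' : Type*} [NormedAddCommGroup E'] [NormedSpace ℝ E']
    [TopologicalSpace H'] {I' : ModelWithCorners ℝ E' H'} [TopologicalSpace M'] [ChartedSpace H' M']
    {f : M → M'} {x : M} {f₁ f₂ : EM →L[ℝ] E'} (h : HasMFDerivAt I I' f x f₁) (he : f₁ = f₂) :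
    HasMFDerivAt I I' f x f₂ := by
  rw [← he]; exact h

theorem tangentBundle_mk_congr {EM HM M : Type*} [NormedAddCommGroup EM] [NormedSpace ℝ EM]
    [TopologicalSpace HM] [TopologicalSpace M] [ChartedSpace HM M] {I : ModelWithCorners ℝ EM HM}
    [IsManifold I 1 M] {x y : M} (h : x = y) {v w : EM} (hv : v = w) :
    (⟨x, v⟩ : TangentBundle I M) = ⟨y, w⟩ := by
  subst h; subst hv; rfl

/-- The tangent map of the action G × Q → Q is smooth, and its value on a pair of tangent vectors is
the sum of the two partial derivatives. With zero vectors on Q it gives smoothness of generators;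
with zero vectors on G, smoothness of the lifted orbit maps. -/
theorem contMDiffAt_tangentMap_smul [IsManifold 𝓘(ℝ, E) ∞ Q] [IsManifold 𝓘(ℝ, EG) ∞ G]
    (hsm : ContMDiff (𝓘(ℝ, EG).prod 𝓘(ℝ, E)) 𝓘(ℝ, E) ∞ (fun p : G × Q => p.1 • p.2))
    {E' H' M' : Type*} [NormedAddCommGroup E'] [NormedSpace ℝ E']
    [TopologicalSpace H'] {I' : ModelWithCorners ℝ E' H'} [TopologicalSpace M'] [ChartedSpace H' M']
    {f : M' → TangentBundle 𝓘(ℝ, EG) G} {h : M' → TangentBundle 𝓘(ℝ, E) Q} {y : M'}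
    (hf : ContMDiffAt I' 𝓘(ℝ, EG).tangent ∞ f y) (hh : ContMDiffAt I' 𝓘(ℝ, E).tangent ∞ h y) :
    ContMDiffAt I' 𝓘(ℝ, E).tangent ∞ (fun z => (⟨(f z).1 • (h z).1,
      modelDeriv 𝓘(ℝ, EG) 𝓘(ℝ, E) (fun g : G => g • (h z).1) (f z).1 (f z).2 +
      modelDeriv 𝓘(ℝ, E) 𝓘(ℝ, E) (fun q : Q => (f z).1 • q) (h z).1 (h z).2⟩ :
        TangentBundle 𝓘(ℝ, E) Q)) y := by
  have h3 : ContMDiff (𝓘(ℝ, EG).prod 𝓘(ℝ, E)).tangent 𝓘(ℝ, E).tangent ∞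
      (tangentMap (𝓘(ℝ, EG).prod 𝓘(ℝ, E)) 𝓘(ℝ, E) (fun p : G × Q => p.1 • p.2)) :=
    ContMDiff.contMDiff_tangentMap hsm (by exact le_rfl)
  have h2 : ContMDiff (𝓘(ℝ, EG).tangent.prod 𝓘(ℝ, E).tangent) (𝓘(ℝ, EG).prod 𝓘(ℝ, E)).tangent ∞
      (equivTangentBundleProd 𝓘(ℝ, EG) G 𝓘(ℝ, E) Q).symm := contMDiff_equivTangentBundleProd_symm
  have := (h3.comp h2).contMDiffAt.comp y (hf.prodMk hh)
  refine this.congr_of_eventuallyEq (Filter.Eventually.of_forall fun z => ?_)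
  have hd : MDifferentiableAt (𝓘(ℝ, EG).prod 𝓘(ℝ, E)) 𝓘(ℝ, E) (fun p : G × Q => p.1 • p.2)
      ((f z).1, (h z).1) := hsm.mdifferentiableAt (by simp)
  exact tangentBundle_mk_congr rfl (modelDeriv_prod hd ((f z).2, (h z).2)).symm

theorem contMDiffAt_generator [IsManifold 𝓘(ℝ, E) ∞ Q] [IsManifold 𝓘(ℝ, EG) ∞ G]
    (hsm : ContMDiff (𝓘(ℝ, EG).prod 𝓘(ℝ, E)) 𝓘(ℝ, E) ∞ (fun p : G × Q => p.1 • p.2))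
    {s : Q → EG} {q₀ : Q} (hs : ContMDiffAt 𝓘(ℝ, E) 𝓘(ℝ, EG) ∞ s q₀) :
    ContMDiffAt 𝓘(ℝ, E) 𝓘(ℝ, E).tangent ∞
      (fun q => (⟨q, generator EG G q (s q)⟩ : TangentBundle 𝓘(ℝ, E) Q)) q₀ := by
  have hf := contMDiffAt_tangent_fibre (I := 𝓘(ℝ, EG)) (1 : G) hs
  have hz : ContMDiff 𝓘(ℝ, E) 𝓘(ℝ, E).tangent ∞
    (Bundle.zeroSection E (TangentSpace 𝓘(ℝ, E) : Q → Type _)) := Bundle.contMDiff_zeroSection _ _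
  refine (contMDiffAt_tangentMap_smul hsm hf hz.contMDiffAt).congr_of_eventuallyEq
    (Filter.Eventually.of_forall fun q => ?_)
  refine tangentBundle_mk_congr (one_smul G q).symm ?_
  have h0 : modelDeriv 𝓘(ℝ, E) 𝓘(ℝ, E) (fun q : Q => (1 : G) • q) q 0 = 0 := map_zero _
  refine Eq.trans ?_ (congrArg (fun v => modelDeriv 𝓘(ℝ, EG) 𝓘(ℝ, E) (fun g : G => g • q) 1 (s q) + v)
    h0).symm
  exact (add_zero _).symm

/-- Suppose χ_Q(q) = 0 and let γ be an integral curve through 1 of the left-invariant field of χ.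
Then γ(t)·q has zero velocity, hence stays at q; freeness makes γ constant near 0, so χ = γ'(0) = 0.
A local integral curve replaces the exponential map. -/
theorem generator_injective [FiniteDimensional ℝ EG] [LieGroup 𝓘(ℝ, EG) ∞ G]
    [FiniteDimensional ℝ E] [IsManifold 𝓘(ℝ, E) ∞ Q]
    (hsm : ContMDiff (𝓘(ℝ, EG).prod 𝓘(ℝ, E)) 𝓘(ℝ, E) ∞ (fun p : G × Q => p.1 • p.2))
    (hfree : ∀ (g : G) (q : Q), g • q = q → g = 1) (q : Q) :
    Function.Injective (generator (E := E) EG G q) := by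
  rw [injective_iff_map_eq_zero]
  intro χ hχ
  have hms2 : minSmoothness ℝ 2 = 2 := minSmoothness_of_isRCLikeNormedField
  have hms3 : minSmoothness ℝ 3 = 3 := minSmoothness_of_isRCLikeNormedField
  have hLG : LieGroup 𝓘(ℝ, EG) (minSmoothness ℝ 3) G := by rw [hms3]; infer_instance
  have hman : IsManifold 𝓘(ℝ, EG) 1 G := inferInstance
  let v : ∀ g : G, TangentSpace 𝓘(ℝ, EG) g := mulInvariantVectorField (I := 𝓘(ℝ, EG)) (G := G) χ
  have hv : ContMDiff 𝓘(ℝ, EG) 𝓘(ℝ, EG).tangent 1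
      (fun g => (⟨g, v g⟩ : TangentBundle 𝓘(ℝ, EG) G)) :=
    (contMDiff_mulInvariantVectorField (I := 𝓘(ℝ, EG)) (G := G) χ).of_le
      (by rw [hms2]; exact one_le_two)
  have hv1 : ∀ g : G, (show EG from v g) = modelDeriv 𝓘(ℝ, EG) 𝓘(ℝ, EG) (fun h : G => g * h) 1 χ :=
    fun g => rfl
  obtain ⟨γ, hγ0, hγ⟩ := exists_isMIntegralCurveAt_of_contMDiffAt_boundaryless 0
    (hv.contMDiffAt (x := 1))
  have hmul : ∀ (g h : G), MDifferentiableAt 𝓘(ℝ, EG) 𝓘(ℝ, EG) (fun h : G => g * h) h := fun g h =>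
    (contMDiff_mul_left (I := 𝓘(ℝ, EG)) (n := ∞) (a := g)).mdifferentiableAt (by simp)
  have hr : ∀ (q : Q) (g : G), MDifferentiableAt 𝓘(ℝ, EG) 𝓘(ℝ, E) (fun g : G => g • q) g :=
    fun q g => (contMDiff_smul_right hsm q).mdifferentiableAt (by simp)
  have hl : ∀ (g : G) (q : Q), MDifferentiableAt 𝓘(ℝ, E) 𝓘(ℝ, E) (fun q : Q => g • q) q :=
    fun g q => (contMDiff_smul_left hsm g).mdifferentiableAt (by simp)
  -- the orbit map kills the left-invariant field
  have hker : ∀ g : G, modelDeriv 𝓘(ℝ, EG) 𝓘(ℝ, E) (fun g : G => g • q) g (v g) = 0 := by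
    intro g
    have h1 := modelDeriv_comp (f := fun h : G => g * h) (g := fun g : G => g • q) (x := (1 : G))
      (hr q _) (hmul g 1)
    have h2 := modelDeriv_comp (f := fun h : G => h • q) (g := fun q : Q => g • q) (x := (1 : G))
      (hl g _) (hr q 1)
    -- The orbit map composed with left translation by `g` is `g` acting after the orbit map, so its
    -- derivative kills χ at `g` as soon as it does at 1.
    have h3 : (fun z : G => (g * z) • q) = fun z : G => g • z • q := by
      ext z; rw [mul_smul]
    rw [h3, h2] at h1
    have h4 := congrArg (fun L : EG →L[ℝ] E => L χ) h1
    have h5 : modelDeriv 𝓘(ℝ, EG) 𝓘(ℝ, E) (fun h : G => h • q) 1 χ = 0 := hχ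
    simp only [ContinuousLinearMap.comp_apply, h5, map_zero] at h4
    rw [mul_one] at h4
    exact h4.symm
  have hφ : IsMIntegralCurveAt (I := 𝓘(ℝ, E)) (fun t => γ t • q) (fun _ => 0) 0 := by
    filter_upwards [hγ] with t ht
    have h1 := HasMFDerivAt.comp t ((hr q (γ t)).hasMFDerivAt) ht
    refine HasMFDerivAt.congr_modelDeriv (f₂ := (1 : ℝ →L[ℝ] ℝ).smulRight (0 : E)) h1 ?_
    ext
    change modelDeriv 𝓘(ℝ, EG) 𝓘(ℝ, E) (fun g : G => g • q) (γ t) ((1 : ℝ) • (v (γ t) : EG)) =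
      (1 : ℝ) • 0
    rw [one_smul, hker, smul_zero]
  have hc : IsMIntegralCurveAt (I := 𝓘(ℝ, E)) (fun _ : ℝ => q) (fun _ => 0) 0 := by
    refine Filter.Eventually.of_forall fun t => ?_
    have h1 : HasMFDerivAt 𝓘(ℝ, ℝ) 𝓘(ℝ, E) (fun _ : ℝ => q) t (0 : ℝ →L[ℝ] E) :=
      hasMFDerivAt_const _ _
    have h2 : (1 : ℝ →L[ℝ] ℝ).smulRight (0 : E) = 0 := by ext; simp
    rw [← h2] at h1
    exact h1
  have hzero : ContMDiff 𝓘(ℝ, E) 𝓘(ℝ, E).tangent 1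
    (Bundle.zeroSection E (TangentSpace 𝓘(ℝ, E) : Q → Type _)) := Bundle.contMDiff_zeroSection _ _
  -- Both γ(t)·q and the constant curve are integral curves of the zero field with the same initial
  -- point.
  have heq := isMIntegralCurveAt_eventuallyEq_of_contMDiffAt_boundaryless
    (v := fun _ => 0) hzero.contMDiffAt hφ hc
    (by rw [hγ0, one_smul])
  have hconst : γ =ᶠ[𝓝 0] fun _ => 1 := heq.mono fun t ht => hfree _ _ ht
  have hd0 : modelDeriv 𝓘(ℝ, ℝ) 𝓘(ℝ, EG) γ 0 =
      (1 : ℝ →L[ℝ] ℝ).smulRight (show EG from v (γ 0)) := by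
    have := hγ.self_of_nhds.mfderiv
    exact this
  have hd1 : modelDeriv 𝓘(ℝ, ℝ) 𝓘(ℝ, EG) γ 0 = 0 := by
    rw [modelDeriv_congr hconst]
    exact mfderiv_const
  have hv0 : (show EG from v (γ 0)) = 0 := by
    have := congrArg (fun L : ℝ →L[ℝ] EG => L 1) (hd0.symm.trans hd1)
    change (1 : ℝ) • (show EG from v (γ 0)) = 0 at this
    rwa [one_smul] at this
  rw [hv1, hγ0] at hv0
  have hid : (fun h : G => 1 * h) = fun h => h := by ext; simp
  rw [hid, modelDeriv_id] at hv0
  exact hv0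

end GeneratorFields

/-! ### The cotangent bundle in its canonical charts: Θ = p dq and Ω = dq ∧ dp. -/

section CotangentBundle

variable {E : Type*} [NormedAddCommGroup E] [NormedSpace ℝ E]
  {Q : Type*} [TopologicalSpace Q] [ChartedSpace E Q] [IsManifold 𝓘(ℝ, E) ∞ Q]

theorem extChartAt_cotangent_symm_proj (p : Cotangent E Q) :
    ∀ᶠ y in 𝓝 (extChartAt (cotModel E) p p), ((extChartAt (cotModel E) p).symm y).proj =
      (extChartAt 𝓘(ℝ, E) p.proj).symm y.1 := by
  filter_upwards [extChartAt_target_mem_nhds (I := cotModel E) p] with y hy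
  rw [FiberBundle.extChartAt_target] at hy
  rw [FiberBundle.extChartAt]
  exact Bundle.Trivialization.proj_symm_apply'
    (trivializationAt (E →L[ℝ] ℝ) (fun q : Q => TangentSpace 𝓘(ℝ, E) q →L[ℝ] ℝ) p.proj) hy.1.2

theorem extChartAt_cotangent_fst (p : Cotangent E Q) :
    (extChartAt (cotModel E) p p).1 = extChartAt 𝓘(ℝ, E) p.proj p.proj := by
  rw [FiberBundle.extChartAt]
  rfl

/-- The cotangent bundle is a bundle of homomorphisms into the trivial line bundle, whose own
trivialization is the identity; only the coordinate change on the tangent side remains. -/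
theorem cotangent_trivializationAt_apply (q : Q) (z : Cotangent E Q) (w : E) :
    ((trivializationAt (E →L[ℝ] ℝ) (fun q : Q => TangentSpace 𝓘(ℝ, E) q →L[ℝ] ℝ) q) z).2 w =
      z.2 ((trivializationAt E (TangentSpace 𝓘(ℝ, E) : Q → Type _) q).symmL ℝ z.proj w) := by
  have h := hom_trivializationAt_apply (σ := RingHom.id ℝ) (F₁ := E)
    (E₁ := (TangentSpace 𝓘(ℝ, E) : Q → Type _)) (F₂ := ℝ) (E₂ := Bundle.Trivial Q ℝ) (x₀ := q) z
  have h2 := congrArg (fun f : Q × (E →L[ℝ] ℝ) => f.2 w) h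
  refine h2.trans ?_
  rw [ContinuousLinearMap.inCoordinates]
  simp only [ContinuousLinearMap.comp_apply]
  have h3 : (trivializationAt ℝ (Bundle.Trivial Q ℝ) q).continuousLinearMapAt ℝ z.proj =
      ContinuousLinearMap.id ℝ ℝ := Bundle.Trivial.continuousLinearMapAt_trivialization ℝ Q ℝ z.proj
  rw [h3]
  rfl

theorem extChartAt_cotangent_snd (p : Cotangent E Q) :
    (extChartAt (cotModel E) p p).2 = p.2 := by
  rw [FiberBundle.extChartAt]
  change ((trivializationAt (E →L[ℝ] ℝ) (fun q : Q => TangentSpace 𝓘(ℝ, E) q →L[ℝ] ℝ) p.proj) p).2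
    = p.2
  ext v
  have h1 : (trivializationAt E (TangentSpace 𝓘(ℝ, E) : Q → Type _) p.proj).symmL ℝ p.proj v = v := by
    have := TangentBundle.symmL_trivializationAt (I := 𝓘(ℝ, E)) (x₀ := p.proj) (x := p.proj)
      (mem_chart_source _ _)
    refine (congrArg (fun f => (show E →L[ℝ] E from f) v) this).trans ?_
    have := mfderivWithin_range_extChartAt_symm (I := 𝓘(ℝ, E)) (x := p.proj)
    exact congrArg (fun f => (show E →L[ℝ] E from f) v) this
  exact (cotangent_trivializationAt_apply p.proj p v).trans
    (congrArg (fun v : E => (show E →L[ℝ] ℝ from p.2) v) h1)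

/-- The trivialization precomposes a covector with the inverse trivialization of the tangent bundle,
which over the chart domain is the derivative of the inverse chart of Q. This is what makes the
second coordinate the momentum conjugate to the first. -/
theorem cotangent_symm_apply (p : Cotangent E Q) :
    ∀ᶠ y in 𝓝 (extChartAt (cotModel E) p p), ∀ w : E,
      (show E →L[ℝ] ℝ from ((extChartAt (cotModel E) p).symm y).2)
        (modelDeriv 𝓘(ℝ, E) 𝓘(ℝ, E) (extChartAt 𝓘(ℝ, E) p.proj).symm y.1 w) = y.2 w := by
  filter_upwards [extChartAt_target_mem_nhds (I := cotModel E) p,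
    extChartAt_cotangent_symm_proj p] with y hy hproj w
  have hinv := (extChartAt (cotModel E) p).right_inv hy
  rw [FiberBundle.extChartAt_target] at hy
  set z := (extChartAt (cotModel E) p).symm y with hz
  rw [FiberBundle.extChartAt] at hinv
  have h2 : ((trivializationAt (E →L[ℝ] ℝ) (fun q : Q => TangentSpace 𝓘(ℝ, E) q →L[ℝ] ℝ) p.proj)
    z).2 = y.2 := congrArg Prod.snd hinv
  have hzs : z.proj ∈ (chartAt E p.proj).source := by
    rw [hproj]
    have := (extChartAt 𝓘(ℝ, E) p.proj).map_target hy.1.1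
    rwa [extChartAt_source] at this
  have hy1 : extChartAt 𝓘(ℝ, E) p.proj z.proj = y.1 := by
    rw [hproj]; exact (extChartAt 𝓘(ℝ, E) p.proj).right_inv hy.1.1
  have h1 : (show E →L[ℝ] E from (trivializationAt E (TangentSpace 𝓘(ℝ, E) : Q → Type _)
      p.proj).symmL ℝ z.proj) =
      modelDeriv 𝓘(ℝ, E) 𝓘(ℝ, E) (extChartAt 𝓘(ℝ, E) p.proj).symm y.1 := by
    have h3 := TangentBundle.symmL_trivializationAt (I := 𝓘(ℝ, E)) hzs
    refine h3.trans ?_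
    rw [hy1, modelWithCornersSelf_coe, range_id, mfderivWithin_univ]
    rfl
  rw [← h1, ← h2]
  exact (cotangent_trivializationAt_apply p.proj z w).symm

theorem mdifferentiableAt_extChartAt_symm' (q : Q) {y : E}
    (hy : y ∈ (extChartAt 𝓘(ℝ, E) q).target) :
    MDifferentiableAt 𝓘(ℝ, E) 𝓘(ℝ, E) (extChartAt 𝓘(ℝ, E) q).symm y := by
  have h := mdifferentiableWithinAt_extChartAt_symm (I := 𝓘(ℝ, E)) hy
  rwa [modelWithCornersSelf_coe, range_id, mdifferentiableWithinAt_univ] at h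

theorem modelDeriv_proj (p : Cotangent E Q) :
    modelDeriv (cotModel E) 𝓘(ℝ, E) (fun p : Cotangent E Q => p.proj) p =
      ContinuousLinearMap.fst ℝ E (E →L[ℝ] ℝ) := by
  have hd : MDifferentiableAt (cotModel E) 𝓘(ℝ, E) (fun p : Cotangent E Q => p.proj) p :=
    (Bundle.contMDiffAt_proj (n := 1) _).mdifferentiableAt one_ne_zero
  rw [modelDeriv_eq_fderiv_written hd]
  have hev : writtenInExtChartAt (cotModel E) 𝓘(ℝ, E) p (fun p : Cotangent E Q => p.proj)
      =ᶠ[𝓝 (extChartAt (cotModel E) p p)] Prod.fst := by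
    filter_upwards [extChartAt_target_mem_nhds (I := cotModel E) p,
      extChartAt_cotangent_symm_proj p] with y hy hproj
    rw [FiberBundle.extChartAt_target] at hy
    change extChartAt 𝓘(ℝ, E) p.proj ((extChartAt (cotModel E) p).symm y).proj = y.1
    rw [hproj]
    exact (extChartAt 𝓘(ℝ, E) p.proj).right_inv hy.1.1
  rw [hev.fderiv_eq]
  exact fderiv_fst

/-- In the canonical chart the bundle projection reads as the first coordinate, so evaluating the
covector on the projected vector is `cotangent_symm_apply`: this is p dq. -/
theorem localForm_liouville (p : Cotangent E Q) :
    localForm (cotModel E) (fun p : Cotangent E Q => liouville p) p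
      =ᶠ[𝓝 (extChartAt (cotModel E) p p)]
      fun y => y.2.comp (ContinuousLinearMap.fst ℝ E (E →L[ℝ] ℝ)) := by
  filter_upwards [extChartAt_target_mem_nhds (I := cotModel E) p, cotangent_symm_apply p,
    (extChartAt_cotangent_symm_proj p).eventually_nhds] with y hy happ hproj
  have hr : range (cotModel E) = univ := (cotModel E).range_eq_univ
  have hd : MDifferentiableAt (cotModel E) 𝓘(ℝ, E) (fun p : Cotangent E Q => p.proj)
      ((extChartAt (cotModel E) p).symm y) :=
    (Bundle.contMDiffAt_proj (n := 1) _).mdifferentiableAt one_ne_zero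
  have hs : MDifferentiableAt 𝓘(ℝ, E × (E →L[ℝ] ℝ)) (cotModel E) (extChartAt (cotModel E) p).symm
      y := by
    have h := mdifferentiableWithinAt_extChartAt_symm (I := cotModel E) hy
    rwa [hr, mdifferentiableWithinAt_univ] at h
  rw [FiberBundle.extChartAt_target] at hy
  refine ContinuousLinearMap.ext fun w => ?_
  have h1 := modelDeriv_comp hd hs
  have h2 := modelDeriv_comp (f := fun y : E × (E →L[ℝ] ℝ) => y.1)
    (I := 𝓘(ℝ, E × (E →L[ℝ] ℝ))) (I' := 𝓘(ℝ, E)) (x := y)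
    (mdifferentiableAt_extChartAt_symm' p.proj hy.1.1)
    (mdifferentiableAt_iff_differentiableAt.2 differentiableAt_fst)
  have h3 : modelDeriv 𝓘(ℝ, E × (E →L[ℝ] ℝ)) 𝓘(ℝ, E)
      (fun z => ((extChartAt (cotModel E) p).symm z).proj) y =
      modelDeriv 𝓘(ℝ, E × (E →L[ℝ] ℝ)) 𝓘(ℝ, E)
        (fun z => (extChartAt 𝓘(ℝ, E) p.proj).symm z.1) y :=
    modelDeriv_congr hproj
  rw [h1, h2, modelDeriv_eq_fderiv, fderiv_fst] at h3
  have h4 : localForm (cotModel E) (fun p : Cotangent E Q => liouville p) p y w =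
      (show E →L[ℝ] ℝ from ((extChartAt (cotModel E) p).symm y).2)
        (((modelDeriv (cotModel E) 𝓘(ℝ, E) (fun p : Cotangent E Q => p.proj)
          ((extChartAt (cotModel E) p).symm y)).comp
          (modelDeriv 𝓘(ℝ, E × (E →L[ℝ] ℝ)) (cotModel E) (extChartAt (cotModel E) p).symm y)) w) := by
    simp only [localForm, hr, mfderivWithin_univ]
    rfl
  rw [h4, h3]
  exact happ w.1

/-- The coordinate expression of the Liouville form depends linearly on the point, so it is its own
derivative, and antisymmetrising gives the constant form dq ∧ dp. -/
theorem canonicalForm_apply (p : Cotangent E Q) (u v : E × (E →L[ℝ] ℝ)) :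
    (show (E × (E →L[ℝ] ℝ)) [⋀^Fin 2]→L[ℝ] ℝ from canonicalForm p) ![u, v] =
      v.2 u.1 - u.2 v.1 := by
  let L : (E →L[ℝ] ℝ) →L[ℝ] ((E × (E →L[ℝ] ℝ)) →L[ℝ] ℝ) :=
    (ContinuousLinearMap.compL ℝ (E × (E →L[ℝ] ℝ)) E ℝ).flip
      (ContinuousLinearMap.fst ℝ E (E →L[ℝ] ℝ))
  have hL : HasFDerivAt (L.comp (ContinuousLinearMap.snd ℝ E (E →L[ℝ] ℝ)))
      (L.comp (ContinuousLinearMap.snd ℝ E (E →L[ℝ] ℝ))) (extChartAt (cotModel E) p p) :=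
    ContinuousLinearMap.hasFDerivAt _
  have hL' := hL.congr_of_eventuallyEq (localForm_liouville p)
  have h1 := extDer_apply (I := cotModel E) (θ := fun p : Cotangent E Q => liouville p)
    (x := p) hL'.differentiableAt u v
  rw [hL'.fderiv] at h1
  refine (congrArg Neg.neg h1).trans ?_
  change -(u.2 v.1 - v.2 u.1) = _
  ring

end CotangentBundle

/-! ### Smoothness of pairings and of the Legendre transform; velocity and Hamiltonian. -/

section LocalParametrization

variable {E : Type*} [NormedAddCommGroup E] [NormedSpace ℝ E]
  {Q : Type*} [TopologicalSpace Q] [ChartedSpace E Q] [IsManifold 𝓘(ℝ, E) ∞ Q]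

theorem hasMFDerivAt_cotangent_fibre {V : Type*} [NormedAddCommGroup V] [NormedSpace ℝ V] (q : Q)
    (L : V →L[ℝ] (E →L[ℝ] ℝ)) (c : V) :
    HasMFDerivAt 𝓘(ℝ, V) (cotModel E) (fun c => (⟨q, L c⟩ : Cotangent E Q)) c
      ((ContinuousLinearMap.inr ℝ E (E →L[ℝ] ℝ)).comp L) := by
  refine ⟨?_, ?_⟩
  · exact ((FiberBundle.continuous_totalSpaceMk (E →L[ℝ] ℝ)
      (fun q : Q => TangentSpace 𝓘(ℝ, E) q →L[ℝ] ℝ) q).comp L.continuous).continuousAt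
  -- The chart of the cotangent bundle at a point depends only on its base point, so the chart at
  -- `c` is also the one at `c'`, where the coordinates are known.
  · have h : ∀ c', writtenInExtChartAt 𝓘(ℝ, V) (cotModel E) c
        (fun c => (⟨q, L c⟩ : Cotangent E Q)) c' = (extChartAt 𝓘(ℝ, E) q q, L c') := fun c' =>
      Prod.ext (extChartAt_cotangent_fst (⟨q, L c'⟩ : Cotangent E Q))
        (extChartAt_cotangent_snd (⟨q, L c'⟩ : Cotangent E Q))
    have h' : writtenInExtChartAt 𝓘(ℝ, V) (cotModel E) c
        (fun c => (⟨q, L c⟩ : Cotangent E Q)) = fun c' => (extChartAt 𝓘(ℝ, E) q q, L c') :=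
      funext h
    refine HasFDerivAt.hasFDerivWithinAt ?_
    rw [h']
    have h2 := (hasFDerivAt_const (extChartAt 𝓘(ℝ, E) q q) (extChartAt 𝓘(ℝ, V) c c)).prodMk
      (L.hasFDerivAt (x := extChartAt 𝓘(ℝ, V) c c))
    refine h2.congr_fderiv ?_
    ext v
    · rfl
    · rfl

variable {E' H' M' : Type*} [NormedAddCommGroup E'] [NormedSpace ℝ E']
  [TopologicalSpace H'] {I' : ModelWithCorners ℝ E' H'} [TopologicalSpace M'] [ChartedSpace H' M']

theorem contMDiffAt_tangent_sum_smul {ι : Type*} [Fintype ι] {g : M' → Q}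
    {V : ι → ∀ z, TangentSpace 𝓘(ℝ, E) (g z)} {c : ι → M' → ℝ} {z₀ : M'}
    (hg : ContMDiffAt I' 𝓘(ℝ, E) ∞ g z₀)
    (hV : ∀ i, ContMDiffAt I' 𝓘(ℝ, E).tangent ∞
      (fun z => (⟨g z, V i z⟩ : TangentBundle 𝓘(ℝ, E) Q)) z₀)
    (hc : ∀ i, ContMDiffAt I' 𝓘(ℝ, ℝ) ∞ (c i) z₀) :
    ContMDiffAt I' 𝓘(ℝ, E).tangent ∞
      (fun z => (⟨g z, ∑ i, c i z • V i z⟩ : TangentBundle 𝓘(ℝ, E) Q)) z₀ := by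
  rw [Bundle.contMDiffAt_totalSpace]
  refine ⟨hg, ?_⟩
  have hV' := fun i => (Bundle.contMDiffAt_totalSpace.1 (hV i)).2
  have hbase : ∀ᶠ z in 𝓝 z₀,
      g z ∈ (trivializationAt E (TangentSpace 𝓘(ℝ, E) : Q → Type _) (g z₀)).baseSet :=
    hg.continuousAt.eventually ((Bundle.Trivialization.open_baseSet _).mem_nhds
      (FiberBundle.mem_baseSet_trivializationAt E (TangentSpace 𝓘(ℝ, E) : Q → Type _) (g z₀)))
  have hs : ContMDiffAt I' 𝓘(ℝ, E) ∞ (fun z => ∑ i, c i z •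
      ((trivializationAt E (TangentSpace 𝓘(ℝ, E) : Q → Type _) (g z₀))
        (⟨g z, V i z⟩ : TangentBundle 𝓘(ℝ, E) Q)).2) z₀ := by
    refine contMDiffAt_finsetSum fun i _ => ?_
    exact (hc i).smul (hV' i)
  refine hs.congr_of_eventuallyEq ?_
  filter_upwards [hbase] with z hz
  have h1 : ∀ v : TangentSpace 𝓘(ℝ, E) (g z),
      ((trivializationAt E (TangentSpace 𝓘(ℝ, E) : Q → Type _) (g z₀))
        (⟨g z, v⟩ : TangentBundle 𝓘(ℝ, E) Q)).2 =
      (trivializationAt E (TangentSpace 𝓘(ℝ, E) : Q → Type _) (g z₀)).continuousLinearMapAt ℝ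
        (g z) v := fun v =>
    (Bundle.Trivialization.continuousLinearMapAt_apply_of_mem ℝ _ hz v).symm
  simp only [h1]
  rw [map_sum]
  simp only [map_smul]

theorem contMDiffAt_pairing {f : M' → Cotangent E Q} {V : ∀ z, TangentSpace 𝓘(ℝ, E) (f z).proj}
    {z₀ : M'} (hf : ContMDiffAt I' (cotModel E) ∞ f z₀)
    (hV : ContMDiffAt I' 𝓘(ℝ, E).tangent ∞
      (fun z => (⟨(f z).proj, V z⟩ : TangentBundle 𝓘(ℝ, E) Q)) z₀) :
    ContMDiffAt I' 𝓘(ℝ, ℝ) ∞ (fun z => (f z).2 (V z)) z₀ := by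
  have : ContMDiffAt I' (𝓘(ℝ, E).prod 𝓘(ℝ)) ∞
      (fun z ↦ Bundle.TotalSpace.mk' ℝ (E := Bundle.Trivial Q ℝ) (f z).proj ((f z).2 (V z))) z₀ := by
    apply ContMDiffAt.clm_bundle_apply (F₁ := E) (E₁ := (TangentSpace 𝓘(ℝ, E) : Q → Type _))
    · exact hf
    · exact hV
  simp only [Bundle.contMDiffAt_totalSpace] at this
  exact this.2

theorem System.contMDiffAt_legendre (N : System E Q) {f : M' → TangentBundle 𝓘(ℝ, E) Q} {z₀ : M'}
    (hf : ContMDiffAt I' 𝓘(ℝ, E).tangent ∞ f z₀) :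
    ContMDiffAt I' (cotModel E) ∞ (fun z => N.legendre (f z)) z₀ := by
  have hb : ContMDiffAt I' 𝓘(ℝ, E) ∞ (fun z => (f z).proj) z₀ :=
    (Bundle.contMDiffAt_totalSpace.1 hf).1
  have hm := N.metric.contMDiff.contMDiffAt.comp z₀ hb
  exact ContMDiffAt.clm_bundle_apply (F₁ := E) (E₁ := (TangentSpace 𝓘(ℝ, E) : Q → Type _))
    (F₂ := E →L[ℝ] ℝ) (E₂ := fun q : Q => TangentSpace 𝓘(ℝ, E) q →L[ℝ] ℝ)
    (ϕ := fun z => N.metric.inner (f z).proj) (v := fun z => (f z).2) hm hf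

namespace System

variable (N : System E Q)

theorem metric_injective (q : Q) : Function.Injective (N.metric.inner q) := by
  rw [injective_iff_map_eq_zero]
  intro v hv
  by_contra hne
  have := N.metric.pos q v hne
  rw [hv] at this
  exact lt_irrefl _ this

theorem velocity_eq {q : Q} (v : TangentSpace 𝓘(ℝ, E) q) :
    N.velocity ⟨q, N.metric.inner q v⟩ = v :=
  Function.leftInverse_invFun (N.metric_injective q) v

theorem velocity_mem (m : N.M) : N.velocity m.1 ∈ N.D (N.tau m) := by
  obtain ⟨_, ⟨⟨q, v⟩, hv, rfl⟩⟩ := m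
  have := N.velocity_eq v
  exact (congrArg (fun w => w ∈ N.D q) this).mpr hv

theorem inner_velocity (m : N.M) : N.metric.inner (N.tau m) (N.velocity m.1) = m.1.2 := by
  obtain ⟨_, ⟨⟨q, v⟩, hv, rfl⟩⟩ := m
  exact congrArg (fun w => N.metric.inner q w) (N.velocity_eq v)

theorem hamiltonian_eq {q : Q} (v : TangentSpace 𝓘(ℝ, E) q) :
    N.hamiltonian ⟨q, N.metric.inner q v⟩ = 1 / 2 * N.metric.inner q v v + N.potential q := by
  have h1 : N.hamiltonian ⟨q, N.metric.inner q v⟩ = N.metric.inner q v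
      (N.velocity ⟨q, N.metric.inner q v⟩) - (1 / 2 * N.metric.inner q
        (N.velocity ⟨q, N.metric.inner q v⟩) (N.velocity ⟨q, N.metric.inner q v⟩)
        - N.potential q) := rfl
  rw [N.velocity_eq] at h1
  rw [h1]
  ring

end System

end LocalParametrization

/-! ### A local parametrization of the constraint manifold by base point and coefficients in a frame
of D. -/

section LocalStructure

variable {E : Type*} [NormedAddCommGroup E] [NormedSpace ℝ E]
  {Q : Type*} [TopologicalSpace Q] [ChartedSpace E Q] [IsManifold 𝓘(ℝ, E) ∞ Q]

namespace System

variable (N : System E Q)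
  {EM : Type*} [NormedAddCommGroup EM] [NormedSpace ℝ EM] [ChartedSpace EM N.M]

theorem contMDiff_tau (hM : IsSmoothEmbedding 𝓘(ℝ, EM) (cotModel E) ∞
    (fun m : N.M => (m.1 : Cotangent E Q))) : ContMDiff 𝓘(ℝ, EM) 𝓘(ℝ, E) ∞ N.tau :=
  (Bundle.contMDiff_proj (n := ∞) (fun q : Q => TangentSpace 𝓘(ℝ, E) q →L[ℝ] ℝ)).comp hM.contMDiff

/-- Smoothness into an embedded submanifold can be tested in the ambient bundle: the subspace
topology provides continuity, and the immersion property does the rest. -/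
theorem contMDiffAt_M_of_val [IsManifold 𝓘(ℝ, EM) ∞ N.M] (hM : IsSmoothEmbedding 𝓘(ℝ, EM) (cotModel E) ∞
    (fun m : N.M => (m.1 : Cotangent E Q)))
    {E' H' M' : Type*} [NormedAddCommGroup E'] [NormedSpace ℝ E']
    [TopologicalSpace H'] {I' : ModelWithCorners ℝ E' H'} [TopologicalSpace M'] [ChartedSpace H' M']
    [IsManifold I' ∞ M']
    {f : M' → N.M} {z : M'} (hf : ContMDiffAt I' (cotModel E) ∞ (fun z => (f z).1) z) :
    ContMDiffAt I' 𝓘(ℝ, EM) ∞ f z :=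
  (ContMDiffAt.iff_comp_isImmersionAt (hM.isImmersion.isImmersionAt (f z))).2
    ⟨Topology.IsInducing.subtypeVal.continuousAt_iff.2 hf.continuousAt, hf⟩

/-- Near `m` the constraint manifold is parametrized by `(q, d) ↦ κ(∑ d_k X_k(q))` for a local frame
`X_k` of `D`, with differentiable inverse `m' ↦ (τ(m'), c(m'))`. -/
theorem exists_local_parametrization [IsManifold 𝓘(ℝ, EM) ∞ N.M] (hM : IsSmoothEmbedding 𝓘(ℝ, EM) (cotModel E) ∞
    (fun m : N.M => (m.1 : Cotangent E Q))) (m : N.M) :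
    ∃ (r : ℕ) (Φ : Q × (Fin r → ℝ) → N.M) (c : N.M → Fin r → ℝ) (L : (Fin r → ℝ) →L[ℝ] E),
      ContMDiffAt (𝓘(ℝ, E).prod 𝓘(ℝ, Fin r → ℝ)) 𝓘(ℝ, EM) ∞ Φ (N.tau m, c m) ∧
      MDifferentiableAt 𝓘(ℝ, EM) 𝓘(ℝ, Fin r → ℝ) c m ∧
      (∀ᶠ m' in 𝓝 m, Φ (N.tau m', c m') = m') ∧
      (∀ᶠ z in 𝓝 (N.tau m, c m), N.tau (Φ z) = z.1) ∧
      (∀ d, (Φ (N.tau m, d)).1 = ⟨N.tau m, N.metric.inner (N.tau m) (L d)⟩) ∧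
      Function.Injective L ∧
      (∀ e : E, e ∈ N.D (N.tau m) ↔ ∃ d, L d = e) ∧
      ContMDiffAt (𝓘(ℝ, E).prod 𝓘(ℝ, Fin r → ℝ)) 𝓘(ℝ, ℝ) ∞
        (fun z => N.hamiltonian (Φ z).1) (N.tau m, c m) := by
  obtain ⟨r, hr⟩ := N.smooth_D
  obtain ⟨U, hU, hmU, X, hX, hXD⟩ := hr (N.tau m)
  have hmem : ∀ (q : Q) (d : Fin r → ℝ), q ∈ U → ∑ k, d k • X k q ∈ N.D q := by
    intro q d hq
    rw [← (hXD q hq).2]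
    exact Submodule.sum_mem _ fun k _ => Submodule.smul_mem _ _ (Submodule.subset_span ⟨k, rfl⟩)
  classical
  -- Outside `U` the frame need not lie in D and the value is a dummy; only points over `U` are
  -- used.
  let Φ : Q × (Fin r → ℝ) → N.M := fun z => if h : z.1 ∈ U then
    ⟨N.legendre ⟨z.1, ∑ k, z.2 k • X k z.1⟩, ⟨_, hmem z.1 z.2 h, rfl⟩⟩ else m
  have hΦ : ∀ z : Q × (Fin r → ℝ), z.1 ∈ U →
      (Φ z).1 = N.legendre ⟨z.1, ∑ k, z.2 k • X k z.1⟩ := fun z hz => by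
    simp only [Φ, dif_pos hz]
  -- smoothness of the fields and of the metric coefficients
  have hXat : ∀ k q, q ∈ U → ContMDiffAt 𝓘(ℝ, E) 𝓘(ℝ, E).tangent ∞
      (fun q => (⟨q, X k q⟩ : TangentBundle 𝓘(ℝ, E) Q)) q := fun k q hq =>
    (hX k q hq).contMDiffAt (hU.mem_nhds hq)
  have hfst : ∀ z : Q × (Fin r → ℝ), ContMDiffAt (𝓘(ℝ, E).prod 𝓘(ℝ, Fin r → ℝ)) 𝓘(ℝ, E) ∞
      (Prod.fst : Q × (Fin r → ℝ) → Q) z := fun z => contMDiffAt_fst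
  have hcoord : ∀ k (z : Q × (Fin r → ℝ)), ContMDiffAt (𝓘(ℝ, E).prod 𝓘(ℝ, Fin r → ℝ)) 𝓘(ℝ, ℝ) ∞
      (fun z : Q × (Fin r → ℝ) => z.2 k) z := fun k z =>
    ((ContinuousLinearMap.proj k : (Fin r → ℝ) →L[ℝ] ℝ).contMDiff.contMDiffAt).comp z
      contMDiffAt_snd
  have hfield : ∀ z : Q × (Fin r → ℝ), z.1 ∈ U →
      ContMDiffAt (𝓘(ℝ, E).prod 𝓘(ℝ, Fin r → ℝ)) 𝓘(ℝ, E).tangent ∞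
      (fun z : Q × (Fin r → ℝ) =>
        (⟨z.1, ∑ k, z.2 k • X k z.1⟩ : TangentBundle 𝓘(ℝ, E) Q)) z := fun z hz =>
    contMDiffAt_tangent_sum_smul (hfst z) (fun k => (hXat k z.1 hz).comp z (hfst z))
      (fun k => hcoord k z)
  have hUev : ∀ z : Q × (Fin r → ℝ), z.1 ∈ U → ∀ᶠ z' in 𝓝 z, z'.1 ∈ U := fun z hz =>
    continuous_fst.continuousAt.eventually (hU.mem_nhds hz)
  have hΦs : ∀ z : Q × (Fin r → ℝ), z.1 ∈ U →
      ContMDiffAt (𝓘(ℝ, E).prod 𝓘(ℝ, Fin r → ℝ)) 𝓘(ℝ, EM) ∞ Φ z := fun z hz => by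
    refine N.contMDiffAt_M_of_val hM ?_
    refine (N.contMDiffAt_legendre (hfield z hz)).congr_of_eventuallyEq ?_
    filter_upwards [hUev z hz] with z' hz'
    exact hΦ z' hz'
  -- the Gram matrix and the fibre coordinates on `M`
  let A : Q → (Fin r → ℝ) →L[ℝ] (Fin r → ℝ) := fun q => ∑ j, ∑ k, N.metric.inner q (X j q) (X k q) •
    ((ContinuousLinearMap.proj k : (Fin r → ℝ) →L[ℝ] ℝ).smulRight (Pi.single j (1 : ℝ)))
  have hA : ∀ q d j, A q d j = N.metric.inner q (X j q) (∑ k, d k • X k q) := by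
    intro q d j
    simp only [A, sum_apply, Finset.sum_apply, map_sum, map_smul]
    rw [Finset.sum_eq_single j]
    · refine Finset.sum_congr rfl fun k _ => ?_
      simp [mul_comm]
    · intro i _ hij
      refine Finset.sum_eq_zero fun k _ => ?_
      simp [hij.symm]
    · simp
  let P : N.M → Fin r → ℝ := fun m' => ∑ j, Pi.single j (m'.1.2 (X j (N.tau m')))
  have hP : ∀ m' j, P m' j = m'.1.2 (X j (N.tau m')) := fun m' j => by
    simp [P, Finset.sum_apply]
  -- If p = κ(∑ d_k X_k, ·), then p(X_j) = ∑ κ(X_j, X_k) d_k; solving with the Gram matrix recovers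
  -- the coefficients, differentiably in the point.
  let c : N.M → Fin r → ℝ := fun m' => (A (N.tau m')).inverse (P m')
  -- The quadratic form of the Gram matrix at `d` is the squared length of ∑ d_k X_k, which vanishes
  -- only for `d = 0`.
  have hAinj : ∀ q ∈ U, Function.Injective (A q) := by
    intro q hq
    rw [injective_iff_map_eq_zero]
    intro d hd
    have h1 : N.metric.inner q (∑ j, d j • X j q) (∑ k, d k • X k q) = 0 := by
      have h2 : N.metric.inner q (∑ j, d j • X j q) (∑ k, d k • X k q) = ∑ j, d j * A q d j := by
        simp only [hA]
        rw [map_sum]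
        refine Finset.sum_congr rfl fun j _ => ?_
        rw [map_smul, N.metric.symm q _ (X j q)]
        rfl
      rw [h2, hd]
      simp
    have h3 : ∑ k, d k • X k q = 0 := by
      by_contra hne
      exact (N.metric.pos q _ hne).ne' h1
    have h4 := Fintype.linearIndependent_iff.1 (hXD q hq).1 d h3
    exact funext h4
  have hAinv : ∀ q ∈ U, (A q).IsInvertible := by
    intro q hq
    let e : (Fin r → ℝ) ≃L[ℝ] (Fin r → ℝ) :=
      (LinearEquiv.ofInjectiveEndo (A q).toLinearMap (hAinj q hq)).toContinuousLinearEquiv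
    exact ⟨e, rfl⟩
  have hcΦ : ∀ m' : N.M, N.tau m' ∈ U → Φ (N.tau m', c m') = m' := by
    intro m' hm'
    obtain ⟨d, hd⟩ : ∃ d : Fin r → ℝ, ∑ k, d k • X k (N.tau m') = N.velocity m'.1 := by
      have := N.velocity_mem m'
      rw [← (hXD _ hm').2] at this
      exact (Submodule.mem_span_range_iff_exists_fun ℝ).1 this
    have h1 : P m' = A (N.tau m') d := by
      ext j
      rw [hP, hA, hd]
      exact (congrArg (fun f : E →L[ℝ] ℝ => f (X j (N.tau m'))) (N.inner_velocity m').symm).trans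
        (N.metric.symm _ _ _)
    have h2 : c m' = d := by
      change (A (N.tau m')).inverse (P m') = d
      rw [h1]
      exact (hAinv _ hm').inverse_apply_eq.2 rfl
    rw [h2]
    refine Subtype.ext ?_
    rw [hΦ _ hm']
    have h3 : N.legendre ⟨N.tau m', ∑ k, d k • X k (N.tau m')⟩ =
      ⟨N.tau m', N.metric.inner (N.tau m') (N.velocity m'.1)⟩ :=
      congrArg (fun v => N.legendre ⟨N.tau m', v⟩) hd
    rw [h3, N.inner_velocity]
    rfl
  have htau : ContMDiff 𝓘(ℝ, EM) 𝓘(ℝ, E) ∞ N.tau := N.contMDiff_tau hM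
  have hmetric : ∀ j k, ContMDiffAt 𝓘(ℝ, E) 𝓘(ℝ, ℝ) ∞
      (fun q => N.metric.inner q (X j q) (X k q)) (N.tau m) := fun j k =>
    contMDiffAt_pairing (f := fun q => N.legendre ⟨q, X j q⟩)
      (N.contMDiffAt_legendre (hXat j _ hmU)) (hXat k _ hmU)
  have hAs : ContMDiffAt 𝓘(ℝ, E) 𝓘(ℝ, (Fin r → ℝ) →L[ℝ] (Fin r → ℝ)) ∞ A (N.tau m) := by
    refine contMDiffAt_finsetSum fun j _ => contMDiffAt_finsetSum fun k _ => ?_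
    exact (hmetric j k).smul contMDiffAt_const
  have hPs : ContMDiffAt 𝓘(ℝ, EM) 𝓘(ℝ, Fin r → ℝ) ∞ P m := by
    refine contMDiffAt_finsetSum fun j _ => ?_
    have h1 : ContMDiffAt 𝓘(ℝ, EM) 𝓘(ℝ, ℝ) ∞ (fun m' : N.M => m'.1.2 (X j (N.tau m'))) m :=
      contMDiffAt_pairing (f := fun m' : N.M => m'.1) hM.contMDiff.contMDiffAt
        ((hXat j _ hmU).comp m htau.contMDiffAt)
    exact (ContinuousLinearMap.single ℝ (fun _ : Fin r => ℝ) j).contMDiff.contMDiffAt.comp m h1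
  have hinvs : MDifferentiableAt 𝓘(ℝ, EM) 𝓘(ℝ, (Fin r → ℝ) →L[ℝ] (Fin r → ℝ))
      (fun m' => (A (N.tau m')).inverse) m := by
    obtain ⟨e, he⟩ := hAinv _ hmU
    have h1 := (contDiffAt_map_inverse (𝕜 := ℝ) (n := 1) e).differentiableAt one_ne_zero
    rw [he] at h1
    have h2 := (hAs.comp m htau.contMDiffAt).mdifferentiableAt (by simp)
    exact (mdifferentiableAt_iff_differentiableAt.2 h1).comp m h2
  have hcs : MDifferentiableAt 𝓘(ℝ, EM) 𝓘(ℝ, Fin r → ℝ) c m :=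
    hinvs.clm_apply (hPs.mdifferentiableAt (by simp))
  let L : (Fin r → ℝ) →L[ℝ] E := ∑ k, (ContinuousLinearMap.proj k : (Fin r → ℝ) →L[ℝ] ℝ).smulRight
    (show E from X k (N.tau m))
  have hL : ∀ d, L d = ∑ k, d k • (show E from X k (N.tau m)) := fun d => by
    simp only [L]
    rw [sum_apply]
    rfl
  refine ⟨r, Φ, c, L, hΦs _ hmU, hcs, ?_, ?_, ?_, ?_, ?_, ?_⟩
  · filter_upwards [htau.continuous.continuousAt.eventually (hU.mem_nhds hmU)] with m' hm'
    exact hcΦ m' hm'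
  · filter_upwards [hUev (N.tau m, c m) hmU] with z hz
    change ((Φ z).1).proj = z.1
    rw [hΦ z hz]
    rfl
  · intro d
    rw [hΦ _ hmU]
    exact congrArg (fun v : E => N.legendre ⟨N.tau m, v⟩) (hL d).symm
  · rw [injective_iff_map_eq_zero]
    intro d hd
    rw [hL] at hd
    exact funext (Fintype.linearIndependent_iff.1 (hXD _ hmU).1 d hd)
  · intro e
    rw [← (hXD _ hmU).2]
    refine (Submodule.mem_span_range_iff_exists_fun (M := TangentSpace 𝓘(ℝ, E) (N.tau m)) ℝ).trans ?_
    exact exists_congr fun d => by rw [hL]; rfl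
  · have h1 : ContMDiffAt (𝓘(ℝ, E).prod 𝓘(ℝ, Fin r → ℝ)) 𝓘(ℝ, ℝ) ∞
        (fun z : Q × (Fin r → ℝ) => N.metric.inner z.1 (∑ k, z.2 k • X k z.1)
          (∑ k, z.2 k • X k z.1)) (N.tau m, c m) :=
      contMDiffAt_pairing (f := fun z : Q × (Fin r → ℝ) => N.legendre ⟨z.1, ∑ k, z.2 k • X k z.1⟩)
        (N.contMDiffAt_legendre (hfield _ hmU)) (hfield _ hmU)
    have h2 : ContMDiffAt (𝓘(ℝ, E).prod 𝓘(ℝ, Fin r → ℝ)) 𝓘(ℝ, ℝ) ∞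
        (fun z : Q × (Fin r → ℝ) => N.potential z.1) (N.tau m, c m) :=
      N.contMDiff_potential.contMDiffAt.comp _ (hfst _)
    refine ((contMDiffAt_const (c := (1 / 2 : ℝ)).mul h1).add h2).congr_of_eventuallyEq ?_
    filter_upwards [hUev (N.tau m, c m) hmU] with z hz
    rw [hΦ z hz]
    exact N.hamiltonian_eq _

end System

end LocalStructure

/-! ### Tangent spaces of the constraint manifold: τ is a submersion with fibres modelled on κ(D).
-/

section LocalConsequences

variable {E : Type*} [NormedAddCommGroup E] [NormedSpace ℝ E]
  {Q : Type*} [TopologicalSpace Q] [ChartedSpace E Q] [IsManifold 𝓘(ℝ, E) ∞ Q]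

namespace System

variable (N : System E Q)
  {EM : Type*} [NormedAddCommGroup EM] [NormedSpace ℝ EM] [ChartedSpace EM N.M]

theorem dincl_fst (hM : IsSmoothEmbedding 𝓘(ℝ, EM) (cotModel E) ∞
    (fun m : N.M => (m.1 : Cotangent E Q))) (m : N.M) (u : EM) :
    (modelDeriv 𝓘(ℝ, EM) (cotModel E) (fun m : N.M => m.1) m u).1 =
      modelDeriv 𝓘(ℝ, EM) 𝓘(ℝ, E) N.tau m u := by
  have h := modelDeriv_comp (I'' := 𝓘(ℝ, E)) (f := fun m : N.M => m.1)
    (g := fun p : Cotangent E Q => p.proj) (x := m)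
    ((Bundle.contMDiffAt_proj (n := 1) _).mdifferentiableAt one_ne_zero)
    (hM.contMDiff.mdifferentiableAt (I := 𝓘(ℝ, EM)) (by simp))
  rw [modelDeriv_proj] at h
  exact (congrArg (fun f : EM →L[ℝ] E => f u) h).symm

/-- The metric as a bilinear form on the model space. -/
def innerModel (q : Q) : E →L[ℝ] E →L[ℝ] ℝ := N.metric.inner q

/-- The projection of the constraint manifold is a submersion whose vertical vectors are the elements
of `κ(D)`, and the fibre derivative of the Hamiltonian is the velocity. -/
theorem dtau_surjective_and_vertical [IsManifold 𝓘(ℝ, EM) ∞ N.M]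
    (hM : IsSmoothEmbedding 𝓘(ℝ, EM) (cotModel E) ∞
      (fun m : N.M => (m.1 : Cotangent E Q))) (m : N.M) :
    (∀ e : E, ∃ u : EM, modelDeriv 𝓘(ℝ, EM) 𝓘(ℝ, E) N.tau m u = e) ∧
    (∀ e : E, e ∈ N.D (N.tau m) → ∃ u : EM,
      modelDeriv 𝓘(ℝ, EM) (cotModel E) (fun m : N.M => m.1) m u =
        (0, N.innerModel (N.tau m) e) ∧
      modelDeriv 𝓘(ℝ, EM) 𝓘(ℝ, ℝ) (fun m : N.M => N.hamiltonian m.1) m u =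
        N.innerModel (N.tau m) (N.velocity m.1) e) ∧
    (∀ u : EM, modelDeriv 𝓘(ℝ, EM) 𝓘(ℝ, E) N.tau m u = 0 → ∃ e : E, e ∈ N.D (N.tau m) ∧
      modelDeriv 𝓘(ℝ, EM) (cotModel E) (fun m : N.M => m.1) m u =
        (0, N.innerModel (N.tau m) e) ∧ (e = 0 → u = 0)) := by
  obtain ⟨r, Φ, c, L, hΦ, hc, hΦc, htauΦ, hfib, hLinj, hLD, hHam⟩ :=
    N.exists_local_parametrization hM m
  have hΦ0 : Φ (N.tau m, c m) = m := hΦc.self_of_nhds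
  have hΦd : MDifferentiableAt (𝓘(ℝ, E).prod 𝓘(ℝ, Fin r → ℝ)) 𝓘(ℝ, EM) Φ (N.tau m, c m) :=
    hΦ.mdifferentiableAt (by simp)
  have htaud : ∀ m', MDifferentiableAt 𝓘(ℝ, EM) 𝓘(ℝ, E) N.tau m' := fun m' =>
    (N.contMDiff_tau hM).mdifferentiableAt (by simp)
  have hind : ∀ m', MDifferentiableAt 𝓘(ℝ, EM) (cotModel E) (fun m : N.M => m.1) m' := fun m' =>
    hM.contMDiff.mdifferentiableAt (I := 𝓘(ℝ, EM)) (by simp)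
  have hHd : MDifferentiableAt (𝓘(ℝ, E).prod 𝓘(ℝ, Fin r → ℝ)) 𝓘(ℝ, ℝ)
      (fun z => N.hamiltonian (Φ z).1) (N.tau m, c m) := hHam.mdifferentiableAt (by simp)
  have htc : MDifferentiableAt 𝓘(ℝ, EM) (𝓘(ℝ, E).prod 𝓘(ℝ, Fin r → ℝ))
      (fun m' => (N.tau m', c m')) m := (htaud m).prodMk hc
  have hHMd : MDifferentiableAt 𝓘(ℝ, EM) 𝓘(ℝ, ℝ) (fun m : N.M => N.hamiltonian m.1) m := by
    refine (MDifferentiableAt.comp (g := fun z => N.hamiltonian (Φ z).1) m hHd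
      htc).congr_of_eventuallyEq ?_
    filter_upwards [hΦc] with m' hm'
    simp only [Function.comp_apply, hm']
  -- the derivative of the parametrization
  have htau : ∀ z : E × (Fin r → ℝ), modelDeriv 𝓘(ℝ, EM) 𝓘(ℝ, E) N.tau m
      (modelDeriv (𝓘(ℝ, E).prod 𝓘(ℝ, Fin r → ℝ)) 𝓘(ℝ, EM) Φ (N.tau m, c m) z) = z.1 := by
    intro z
    have h1 := modelDeriv_comp (htaud (Φ (N.tau m, c m))) hΦd
    have h2 : modelDeriv (𝓘(ℝ, E).prod 𝓘(ℝ, Fin r → ℝ)) 𝓘(ℝ, E) (fun z => N.tau (Φ z))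
        (N.tau m, c m) = modelDeriv (𝓘(ℝ, E).prod 𝓘(ℝ, Fin r → ℝ)) 𝓘(ℝ, E) Prod.fst
        (N.tau m, c m) := modelDeriv_congr htauΦ
    have h3 : modelDeriv (𝓘(ℝ, E).prod 𝓘(ℝ, Fin r → ℝ)) 𝓘(ℝ, E) Prod.fst
        (N.tau m, c m) = ContinuousLinearMap.fst ℝ E (Fin r → ℝ) := mfderiv_fst
    rw [h2, h3, hΦ0] at h1
    exact (congrArg (fun f : E × (Fin r → ℝ) →L[ℝ] E => f z) h1).symm
  have hin : ∀ d : Fin r → ℝ, modelDeriv 𝓘(ℝ, EM) (cotModel E) (fun m : N.M => m.1) m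
      (modelDeriv (𝓘(ℝ, E).prod 𝓘(ℝ, Fin r → ℝ)) 𝓘(ℝ, EM) Φ (N.tau m, c m) (0, d)) =
        (0, N.innerModel (N.tau m) (L d)) := by
    intro d
    have h1 := modelDeriv_comp (hind (Φ (N.tau m, c m))) hΦd
    rw [hΦ0] at h1
    have h2 := modelDeriv_prod ((hind (Φ (N.tau m, c m))).comp _ hΦd) ((0, d) : E × (Fin r → ℝ))
    have h3 := congrArg (fun f : E × (Fin r → ℝ) →L[ℝ] E × (E →L[ℝ] ℝ) => f (0, d)) h1
    refine h3.symm.trans (h2.trans ?_)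
    have h4 : modelDeriv 𝓘(ℝ, Fin r → ℝ) (cotModel E) (fun d => (Φ (N.tau m, d)).1) (c m) =
        (ContinuousLinearMap.inr ℝ E (E →L[ℝ] ℝ)).comp ((N.innerModel (N.tau m)).comp L) := by
      have h5 : (fun d => (Φ (N.tau m, d)).1) = fun d =>
        (⟨N.tau m, ((N.innerModel (N.tau m)).comp L) d⟩ : Cotangent E Q) := funext hfib
      rw [h5]
      exact HasMFDerivAt.modelDeriv_eq (hasMFDerivAt_cotangent_fibre (N.tau m) _ (c m))
    rw [map_zero, zero_add]
    exact congrArg (fun f : (Fin r → ℝ) →L[ℝ] E × (E →L[ℝ] ℝ) => f d) h4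
  have hvel : (show E from N.velocity m.1) = L (c m) := by
    have h1 : (m.1 : Cotangent E Q) = ⟨N.tau m, N.metric.inner (N.tau m) (L (c m))⟩ := by
      rw [← hfib, hΦ0]
    have h2 : m.1.2 = N.metric.inner (N.tau m) (L (c m)) := by
      have h3 : (⟨m.1.proj, m.1.2⟩ : Cotangent E Q) =
        ⟨m.1.proj, N.metric.inner (N.tau m) (L (c m))⟩ := h1
      exact eq_of_heq (Bundle.TotalSpace.mk.inj h3).2
    exact N.metric_injective _ ((N.inner_velocity m).trans h2)
  have hdH : ∀ d : Fin r → ℝ, modelDeriv 𝓘(ℝ, EM) 𝓘(ℝ, ℝ) (fun m : N.M => N.hamiltonian m.1) m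
      (modelDeriv (𝓘(ℝ, E).prod 𝓘(ℝ, Fin r → ℝ)) 𝓘(ℝ, EM) Φ (N.tau m, c m) (0, d)) =
        N.innerModel (N.tau m) (N.velocity m.1) (L d) := by
    intro d
    have hHMd' : MDifferentiableAt 𝓘(ℝ, EM) 𝓘(ℝ, ℝ) (fun m : N.M => N.hamiltonian m.1)
      (Φ (N.tau m, c m)) := by rw [hΦ0]; exact hHMd
    have h1 := modelDeriv_comp hHMd' hΦd
    rw [hΦ0] at h1
    have h2 := modelDeriv_prod hHd ((0, d) : E × (Fin r → ℝ))
    have h3 := congrArg (fun f : E × (Fin r → ℝ) →L[ℝ] ℝ => f (0, d)) h1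
    refine h3.symm.trans (h2.trans ?_)
    rw [map_zero, zero_add]
    -- On a fibre the Hamiltonian is half the squared length of the velocity plus a constant, so its
    -- derivative is κ(velocity, ·).
    have h5 : (fun d => N.hamiltonian (Φ (N.tau m, d)).1) = fun d =>
        1 / 2 * N.innerModel (N.tau m) (L d) (L d) + N.potential (N.tau m) :=
      funext fun d => (congrArg N.hamiltonian (hfib d)).trans (N.hamiltonian_eq _)
    have hL := L.hasFDerivAt (x := c m)
    have h6 := ((((N.innerModel (N.tau m)).comp L).hasFDerivAt (x := c m)).clm_apply hL)
    have h7 := ((h6.const_mul (1 / 2 : ℝ)).add_const (N.potential (N.tau m))).fderiv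
    change modelDeriv 𝓘(ℝ, Fin r → ℝ) 𝓘(ℝ, ℝ) (fun d => N.hamiltonian (Φ (N.tau m, d)).1) (c m) d = _
    rw [h5, modelDeriv_eq_fderiv]
    refine (congrArg (fun f : (Fin r → ℝ) →L[ℝ] ℝ => f d) h7).trans ?_
    have hsymm : N.innerModel (N.tau m) (L d) (L (c m)) = N.innerModel (N.tau m) (L (c m)) (L d) :=
      N.metric.symm _ _ _
    have h8 : N.innerModel (N.tau m) (N.velocity m.1) (L d) =
        N.innerModel (N.tau m) (L (c m)) (L d) :=
      congrArg (fun v : E => N.innerModel (N.tau m) v (L d)) hvel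
    rw [h8]
    change 1 / 2 * (N.innerModel (N.tau m) (L (c m)) (L d) +
      N.innerModel (N.tau m) (L d) (L (c m))) = _
    rw [hsymm]
    ring
  refine ⟨fun e => ⟨_, htau (e, 0)⟩, fun e he => ?_, fun u hu => ?_⟩
  · obtain ⟨d, rfl⟩ := (hLD e).1 he
    exact ⟨_, hin d, hdH d⟩
  -- As Φ ∘ (τ, c) is the identity near `m`, every tangent vector is the image under TΦ of its (τ,
  -- c)-components; a vertical one comes from some `(0, d)`.
  · have h1 : modelDeriv 𝓘(ℝ, EM) 𝓘(ℝ, EM) (fun m' => Φ (N.tau m', c m')) m =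
        ContinuousLinearMap.id ℝ EM := by
      rw [modelDeriv_congr (g := fun m' => m') hΦc, modelDeriv_id]
    have h2 := modelDeriv_comp (f := fun m' => (N.tau m', c m')) hΦd htc
    have h3 : modelDeriv 𝓘(ℝ, EM) (𝓘(ℝ, E).prod 𝓘(ℝ, Fin r → ℝ)) (fun m' => (N.tau m', c m')) m u =
        (modelDeriv 𝓘(ℝ, EM) 𝓘(ℝ, E) N.tau m u, modelDeriv 𝓘(ℝ, EM) 𝓘(ℝ, Fin r → ℝ) c m u) :=
      congrArg (fun f : EM →L[ℝ] E × (Fin r → ℝ) => f u) (mfderiv_prodMk (htaud m) hc)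
    set d := modelDeriv 𝓘(ℝ, EM) 𝓘(ℝ, Fin r → ℝ) c m u with hd
    have h4 : u = modelDeriv (𝓘(ℝ, E).prod 𝓘(ℝ, Fin r → ℝ)) 𝓘(ℝ, EM) Φ (N.tau m, c m) (0, d) := by
      have h5 := congrArg (fun f : EM →L[ℝ] EM => f u) (h1.symm.trans h2)
      refine h5.trans ?_
      rw [hu] at h3
      exact congrArg _ h3
    refine ⟨L d, (hLD _).2 ⟨d, rfl⟩, ?_, fun h0 => ?_⟩
    · rw [h4]; exact hin d
    · have h6 : d = 0 := hLinj (h0.trans (map_zero L).symm)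
      rw [h4, h6]
      exact map_zero _

end System

end LocalConsequences

/-! ### Existence of the nonholonomic field and the second-order condition. -/

section NonholonomicField

variable {E : Type*} [NormedAddCommGroup E] [NormedSpace ℝ E]
  {Q : Type*} [TopologicalSpace Q] [ChartedSpace E Q] [IsManifold 𝓘(ℝ, E) ∞ Q]

namespace System

variable (N : System E Q)
  {EM : Type*} [NormedAddCommGroup EM] [NormedSpace ℝ EM] [ChartedSpace EM N.M]

theorem omegaM_apply (hM : IsSmoothEmbedding 𝓘(ℝ, EM) (cotModel E) ∞
    (fun m : N.M => (m.1 : Cotangent E Q))) (m : N.M) (u v : EM) :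
    N.omegaM EM m u v =
      (modelDeriv 𝓘(ℝ, EM) (cotModel E) (fun m : N.M => m.1) m v).2
        (modelDeriv 𝓘(ℝ, EM) 𝓘(ℝ, E) N.tau m u) -
      (modelDeriv 𝓘(ℝ, EM) (cotModel E) (fun m : N.M => m.1) m u).2
        (modelDeriv 𝓘(ℝ, EM) 𝓘(ℝ, E) N.tau m v) := by
  rw [← N.dincl_fst hM, ← N.dincl_fst hM]
  exact canonicalForm_apply m.1 _ _

/-- Ω_M is nondegenerate on the finite-dimensional space 𝓒, so the restriction of dH to 𝓒 is
represented by a vector of 𝓒. Nondegeneracy comes from positivity of κ, used on the base component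
of a kernel vector and then on its fibre component. -/
theorem exists_Xnh [FiniteDimensional ℝ EM] [IsManifold 𝓘(ℝ, EM) ∞ N.M]
    (hM : IsSmoothEmbedding 𝓘(ℝ, EM) (cotModel E) ∞
      (fun m : N.M => (m.1 : Cotangent E Q))) (m : N.M) :
    ∃ X : TangentSpace 𝓘(ℝ, EM) m,
      X ∈ N.distC EM m ∧ ∀ v ∈ N.distC EM m, N.omegaM EM m X v = N.dH EM m v := by
  obtain ⟨hA, hB, hC⟩ := N.dtau_surjective_and_vertical hM m
  let τ : EM →L[ℝ] E := modelDeriv 𝓘(ℝ, EM) 𝓘(ℝ, E) N.tau m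
  let ι : EM →L[ℝ] E × (E →L[ℝ] ℝ) := modelDeriv 𝓘(ℝ, EM) (cotModel E) (fun m : N.M => m.1) m
  let D' : Submodule ℝ E := N.D (N.tau m)
  let C : Submodule ℝ EM := D'.comap τ.toLinearMap
  let σ : EM →ₗ[ℝ] EM →ₗ[ℝ] ℝ := LinearMap.mk₂ ℝ (fun u v => (ι v).2 (τ u) - (ι u).2 (τ v))
    (fun u u' v => by simp only [map_add, Prod.snd_add, _root_.add_apply]; ring)
    (fun c u v => by simp only [map_smul, Prod.smul_snd, smul_eq_mul, _root_.smul_apply]; ring)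
    (fun u v v' => by simp only [map_add, Prod.snd_add, _root_.add_apply]; ring)
    (fun c u v => by simp only [map_smul, Prod.smul_snd, smul_eq_mul, _root_.smul_apply]; ring)
  have hσ : ∀ u v, σ u v = (ι v).2 (τ u) - (ι u).2 (τ v) := fun u v => rfl
  let Ω : C →ₗ[ℝ] Module.Dual ℝ C := (σ.domRestrict₁₂ C C)
  have hΩ : ∀ u v : C, Ω u v = σ u v := fun u v => rfl
  have hpos : ∀ e : E, N.innerModel (N.tau m) e e = 0 → e = 0 := fun e he => by
    by_contra hne
    exact (N.metric.pos (N.tau m) e hne).ne' he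
  have hinj : Function.Injective Ω := by
    rw [injective_iff_map_eq_zero]
    intro X hX
    have hX' : ∀ v ∈ C, σ X v = 0 := fun v hv => congrArg (fun f : Module.Dual ℝ C => f ⟨v, hv⟩) hX
    have h1 : τ X = 0 := by
      -- Testing `X` against the vertical vector κ(τX, ·), which exists since τX ∈ D, gives κ(τX,
      -- τX) = 0.
      obtain ⟨u, hu, -⟩ := hB (τ X) X.2
      have hτu : τ u = 0 := by
        have := N.dincl_fst hM m u
        rw [hu] at this
        exact this.symm
      have h2 := hX' u (by change τ u ∈ D'; rw [hτu]; exact zero_mem _)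
      rw [hσ, hτu, map_zero, sub_zero] at h2
      have h3 : (ι u).2 (τ X) = N.innerModel (N.tau m) (τ X) (τ X) :=
        congrArg (fun f : E × (E →L[ℝ] ℝ) => f.2 (τ X)) hu
      exact hpos _ (h3.symm.trans h2)
    -- Now `X` is vertical, of the form κ(e, ·) with e ∈ D. Testing it against a lift of `e`, which
    -- belongs to 𝓒, gives κ(e, e) = 0.
    obtain ⟨e, he, hXe, he0⟩ := hC X h1
    obtain ⟨v, hv⟩ := hA e
    have hv' : τ v = e := hv
    have h2 := hX' v (by change τ v ∈ D'; rw [hv']; exact he)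
    rw [hσ, h1, map_zero, zero_sub, neg_eq_zero, hv'] at h2
    have h3 : (ι X).2 e = N.innerModel (N.tau m) e e :=
      congrArg (fun f : E × (E →L[ℝ] ℝ) => f.2 e) hXe
    exact Subtype.ext (he0 (hpos e (h3.symm.trans h2)))
  have hsurj : Function.Surjective Ω :=
    (LinearMap.injective_iff_surjective_of_finrank_eq_finrank
      (Subspace.dual_finrank_eq (K := ℝ) (V := C)).symm).1 hinj
  let h : EM →L[ℝ] ℝ := modelDeriv 𝓘(ℝ, EM) 𝓘(ℝ, ℝ) (fun m : N.M => N.hamiltonian m.1) m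
  obtain ⟨X, hX⟩ := hsurj (h.toLinearMap.domRestrict C)
  refine ⟨X.1, X.2, fun v hv => ?_⟩
  refine (N.omegaM_apply hM m X.1 v).trans ?_
  exact congrArg (fun f : Module.Dual ℝ C => f ⟨v, hv⟩) hX

/-- The second-order condition. On vertical vectors Ω_M(X, ·) sees only τX, while dH is κ(v, ·) by
the fibre derivative of the Hamiltonian; so τX and v, both in D, have the same κ-product with all of
D. -/
theorem dtau_Xnh [FiniteDimensional ℝ EM] [IsManifold 𝓘(ℝ, EM) ∞ N.M]
    (hM : IsSmoothEmbedding 𝓘(ℝ, EM) (cotModel E) ∞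
      (fun m : N.M => (m.1 : Cotangent E Q))) (m : N.M) :
    N.dtau EM m (N.Xnh EM m) = N.velocity m.1 := by
  obtain ⟨hXC, hX⟩ := Classical.epsilon_spec (N.exists_Xnh hM m)
  change N.Xnh EM m ∈ N.distC EM m at hXC
  change ∀ v ∈ N.distC EM m, N.omegaM EM m (N.Xnh EM m) v = N.dH EM m v at hX
  obtain ⟨-, hB, -⟩ := N.dtau_surjective_and_vertical hM m
  let X : EM := N.Xnh EM m
  let w : E := N.dtau EM m X
  let v₀ : E := N.velocity m.1
  let D' : Submodule ℝ E := N.D (N.tau m)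
  have hw : w ∈ D' := hXC
  have hv₀ : v₀ ∈ D' := N.velocity_mem m
  -- The test vector is the vertical lift of the difference itself, so that the equation becomes the
  -- vanishing of its squared length.
  obtain ⟨u, hu, hdu⟩ := hB (w - v₀) (D'.sub_mem hw hv₀)
  have hτu : modelDeriv 𝓘(ℝ, EM) 𝓘(ℝ, E) N.tau m u = 0 := by
    have := N.dincl_fst hM m u
    rw [hu] at this
    exact this.symm
  have h1 := hX u (by
    change modelDeriv 𝓘(ℝ, EM) 𝓘(ℝ, E) N.tau m u ∈ D'
    rw [hτu]; exact zero_mem _)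
  have h2 := N.omegaM_apply hM m X u
  rw [hu, hτu, map_zero, sub_zero] at h2
  have h3 : N.innerModel (N.tau m) (w - v₀) w = N.innerModel (N.tau m) v₀ (w - v₀) :=
    h2.symm.trans (h1.trans hdu)
  have h4 : N.innerModel (N.tau m) v₀ (w - v₀) = N.innerModel (N.tau m) (w - v₀) v₀ :=
    N.metric.symm _ _ _
  have h5 : N.innerModel (N.tau m) (w - v₀) (w - v₀) = 0 := by
    rw [map_sub (N.innerModel (N.tau m) (w - v₀)), h3, h4, sub_self]
  have h6 : w - v₀ = 0 := by
    by_contra hne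
    exact (N.metric.pos (N.tau m) (w - v₀) hne).ne' h5
  exact sub_eq_zero.1 h6

end System

end NonholonomicField

/-! ### Projections along complements related by a linear map. -/

section Projections

variable {V W K' : Type*} [AddCommGroup V] [Module ℝ V] [AddCommGroup W] [Module ℝ W]
  [AddCommGroup K'] [Module ℝ K']

theorem projAlong_add {p q : Submodule ℝ V} (h : IsCompl p q) {x y : V} (hx : x ∈ p) (hy : y ∈ q) :
    projAlong p q (x + y) = x := by
  rw [projAlong, dif_pos h, map_add]
  have h1 : p.projection q h x = x := Submodule.projection_apply_left h ⟨x, hx⟩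
  have h2 : p.projection q h y = 0 := (Submodule.projection_apply_eq_zero_iff h).2 hy
  rw [h1, h2, add_zero]

theorem exists_add_of_isCompl {p q : Submodule ℝ V} (h : IsCompl p q) (x : V) :
    ∃ a ∈ p, ∃ b ∈ q, a + b = x :=
  Submodule.mem_sup.1 (h.sup_eq_top ▸ Submodule.mem_top)

/-- `τ` maps `γ(K)` isomorphically onto `q`, so a complement of `q` pulls back to a complement of
`γ(K)`. In the application `τ` is Tτ and `γ` is χ ↦ χ_M. -/
theorem isCompl_comap_map {τ : V →ₗ[ℝ] W} {γ : K' →ₗ[ℝ] V} {K : Submodule ℝ K'}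
    {p q : Submodule ℝ W} (hinj : Function.Injective (τ ∘ₗ γ)) (hq : K.map (τ ∘ₗ γ) = q)
    (h : IsCompl p q) : IsCompl (p.comap τ) (K.map γ) := by
  subst hq
  constructor
  · rw [Submodule.disjoint_def]
    rintro _ hx ⟨χ, hχ, rfl⟩
    have h1 : (τ ∘ₗ γ) χ = 0 :=
      (Submodule.disjoint_def.1 h.disjoint) _ hx (Submodule.mem_map_of_mem hχ)
    rw [hinj (h1.trans (map_zero _).symm), map_zero]
  · rw [codisjoint_iff, eq_top_iff]
    intro x _
    obtain ⟨a, ha, _, ⟨χ, hχ, rfl⟩, hab⟩ := exists_add_of_isCompl h (τ x)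
    refine Submodule.mem_sup.2 ⟨x - γ χ, ?_, γ χ, Submodule.mem_map_of_mem hχ, sub_add_cancel _ _⟩
    rw [Submodule.mem_comap, map_sub, ← hab]
    simpa using ha

/-- `τ` carries the decomposition upstairs to the one downstairs summand by summand. Used for P_𝓒
and P_𝓗; its companion below serves P_𝓥. -/
theorem map_projAlong_left {τ : V →ₗ[ℝ] W} {γ : K' →ₗ[ℝ] V} {K : Submodule ℝ K'}
    {p q : Submodule ℝ W} (hinj : Function.Injective (τ ∘ₗ γ)) (hq : K.map (τ ∘ₗ γ) = q)
    (h : IsCompl p q) (x : V) :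
    τ (projAlong (p.comap τ) (K.map γ) x) = projAlong p q (τ x) := by
  have h' := isCompl_comap_map hinj hq h
  obtain ⟨a, ha, _, ⟨χ, hχ, rfl⟩, rfl⟩ := exists_add_of_isCompl h' x
  rw [projAlong_add h' ha (Submodule.mem_map_of_mem hχ), map_add, projAlong_add h ha]
  rw [← hq]
  exact Submodule.mem_map_of_mem hχ

theorem map_projAlong_right {τ : V →ₗ[ℝ] W} {γ : K' →ₗ[ℝ] V} {K : Submodule ℝ K'}
    {p q : Submodule ℝ W} (hinj : Function.Injective (τ ∘ₗ γ)) (hq : K.map (τ ∘ₗ γ) = q)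
    (h : IsCompl p q) (x : V) :
    τ (projAlong (K.map γ) (p.comap τ) x) = projAlong q p (τ x) := by
  have h' := (isCompl_comap_map hinj hq h).symm
  obtain ⟨_, ⟨χ, hχ, rfl⟩, a, ha, rfl⟩ := exists_add_of_isCompl h' x
  rw [projAlong_add h' (Submodule.mem_map_of_mem hχ) ha, map_add, projAlong_add h.symm _ ha]
  rw [← hq]
  exact Submodule.mem_map_of_mem hχ

end Projections

/-! ### The lifted action on the constraint manifold, its generators and the momentum map. -/

section SymmetricLift

variable {E : Type*} [NormedAddCommGroup E] [NormedSpace ℝ E]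
  {Q : Type*} [TopologicalSpace Q] [ChartedSpace E Q] [IsManifold 𝓘(ℝ, E) ∞ Q]

namespace System

variable {N : System E Q} {EG : Type*} [NormedAddCommGroup EG] [NormedSpace ℝ EG]
  {G : Type*} [TopologicalSpace G] [ChartedSpace EG G] [Group G] [MulAction G Q]

/-- Invariance of the Lagrangian makes each `g` an isometry of κ, and an isometry intertwines the
Legendre transform with the tangent and cotangent lifts. -/
theorem IsSymmetry.cotangentLift_legendre (hG : N.IsSymmetry EG G) (g : G)
    (q : Q) (v : TangentSpace 𝓘(ℝ, E) q) : cotangentLift g (N.legendre ⟨q, v⟩) =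
      N.legendre ⟨g • q, mfderiv 𝓘(ℝ, E) 𝓘(ℝ, E) (fun q : Q => g • q) q v⟩ := by
  let Φ : Diffeomorph 𝓘(ℝ, E) 𝓘(ℝ, E) Q Q ∞ :=
    { toEquiv := MulAction.toPerm g
      contMDiff_toFun := contMDiff_smul_left hG.contMDiff_smul g
      contMDiff_invFun := contMDiff_smul_left hG.contMDiff_smul g⁻¹ }
  let A : TangentSpace 𝓘(ℝ, E) q ≃L[ℝ] TangentSpace 𝓘(ℝ, E) (g • q) :=
    Φ.mfderivToContinuousLinearEquiv (by simp) q
  have hA : mfderiv 𝓘(ℝ, E) 𝓘(ℝ, E) (fun q : Q => g • q) q = (A : _ →L[ℝ] _) := rfl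
  have hL : ∀ u : TangentSpace 𝓘(ℝ, E) q,
      1 / 2 * N.metric.inner (g • q) (A u) (A u) - N.potential (g • q)
        = 1 / 2 * N.metric.inner q u u - N.potential q := fun u => hG.lagrangian_inv g ⟨q, u⟩
  -- At the zero vector invariance of the Lagrangian is invariance of the potential; the kinetic
  -- part is then invariant too, and polarization gives the bilinear form.
  have h0 := hL 0
  simp only [map_zero] at h0
  have hq : ∀ u, N.metric.inner (g • q) (A u) (A u) = N.metric.inner q u u := by
    intro u
    have := hL u
    linarith
  have hb : ∀ u w, N.metric.inner (g • q) (A u) (A w) = N.metric.inner q u w := by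
    intro u w
    have h1 := hq (u + w)
    simp only [map_add, _root_.add_apply, hq] at h1
    have h2 := N.metric.symm (g • q) (A u) (A w)
    have h3 := N.metric.symm q u w
    linarith
  symm
  simp only [legendre, cotangentLift, hA]
  congr 1
  ext w
  have hi : (A : TangentSpace 𝓘(ℝ, E) q →L[ℝ] TangentSpace 𝓘(ℝ, E) (g • q)).inverse = A.symm :=
    ContinuousLinearMap.inverse_equiv A
  have := hb v (A.symm w)
  rw [A.apply_symm_apply] at this
  change _ = N.metric.inner q v
    ((A : TangentSpace 𝓘(ℝ, E) q →L[ℝ] TangentSpace 𝓘(ℝ, E) (g • q)).inverse w)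
  rw [hi]
  exact this

/-- Written through velocities, the lifted action involves the derivative of `g` and no inverse, so
its smoothness follows from that of the tangent action. -/
theorem IsSymmetry.act_val (hG : N.IsSymmetry EG G) (g : G) (m : N.M) :
    (hG.act g m).1 = N.legendre ⟨g • N.tau m,
      mfderiv 𝓘(ℝ, E) 𝓘(ℝ, E) (fun q : Q => g • q) (N.tau m) (N.velocity m.1)⟩ := by
  refine Eq.trans ?_ (hG.cotangentLift_legendre g _ _)
  have h : N.legendre ⟨N.tau m, N.velocity m.1⟩ = m.1 :=
    congrArg (fun p => (⟨N.tau m, p⟩ : Cotangent E Q)) (N.inner_velocity m)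
  rw [h]
  rfl

theorem IsSymmetry.act_one (hG : N.IsSymmetry EG G) (m : N.M) : hG.act 1 m = m := by
  refine Subtype.ext ?_
  rw [hG.act_val]
  have h : N.legendre ⟨N.tau m, N.velocity m.1⟩ = m.1 :=
    congrArg (fun p => (⟨N.tau m, p⟩ : Cotangent E Q)) (N.inner_velocity m)
  refine Eq.trans (congrArg N.legendre (tangentBundle_mk_congr (one_smul G (N.tau m)) ?_)) h
  have h1 : (fun q : Q => (1 : G) • q) = fun q => q := by ext q; exact one_smul G q
  have h2 : modelDeriv 𝓘(ℝ, E) 𝓘(ℝ, E) (fun q : Q => (1 : G) • q) (N.tau m) =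
      ContinuousLinearMap.id ℝ E := by rw [h1, modelDeriv_id]
  exact congrArg (fun f : E →L[ℝ] E => f (N.velocity m.1)) h2

variable {EM : Type*} [NormedAddCommGroup EM] [NormedSpace ℝ EM] [ChartedSpace EM N.M]
  [IsManifold 𝓘(ℝ, EM) ∞ N.M] [IsManifold 𝓘(ℝ, EG) ∞ G]

theorem IsSymmetry.contMDiffAt_act (hG : N.IsSymmetry EG G)
    (hM : IsSmoothEmbedding 𝓘(ℝ, EM) (cotModel E) ∞ (fun m : N.M => (m.1 : Cotangent E Q)))
    (m : N.M) (g : G) : ContMDiffAt 𝓘(ℝ, EG) 𝓘(ℝ, EM) ∞ (fun g : G => hG.act g m) g := by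
  refine N.contMDiffAt_M_of_val hM ?_
  have hz : ContMDiff 𝓘(ℝ, EG) 𝓘(ℝ, EG).tangent ∞
    (Bundle.zeroSection EG (TangentSpace 𝓘(ℝ, EG) : G → Type _)) := Bundle.contMDiff_zeroSection _ _
  have h1 := contMDiffAt_tangentMap_smul hG.contMDiff_smul (hz.contMDiffAt (x := g))
    (contMDiffAt_const (c := (⟨N.tau m, N.velocity m.1⟩ : TangentBundle 𝓘(ℝ, E) Q)))
  refine (N.contMDiffAt_legendre h1).congr_of_eventuallyEq (Filter.Eventually.of_forall fun g => ?_)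
  refine (hG.act_val g m).trans (congrArg N.legendre (tangentBundle_mk_congr rfl ?_))
  have h0 : modelDeriv 𝓘(ℝ, EG) 𝓘(ℝ, E) (fun g : G => g • N.tau m) g 0 = 0 := map_zero _
  refine Eq.trans ?_ (congrArg (fun v => v + modelDeriv 𝓘(ℝ, E) 𝓘(ℝ, E) (fun q : Q => g • q)
    (N.tau m) (N.velocity m.1)) h0).symm
  exact (zero_add _).symm

/-- τ is equivariant: composed with the orbit map of `m` it is the orbit map of τ(m). -/
theorem IsSymmetry.dtau_generatorM (hG : N.IsSymmetry EG G)
    (hM : IsSmoothEmbedding 𝓘(ℝ, EM) (cotModel E) ∞ (fun m : N.M => (m.1 : Cotangent E Q)))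
    (m : N.M) (χ : EG) :
    N.dtau EM m (hG.generatorM EM m χ) = generator EG G (N.tau m) χ := by
  have h := modelDeriv_comp (f := fun g : G => hG.act g m) (g := N.tau) (x := (1 : G))
    ((N.contMDiff_tau hM).mdifferentiableAt (by simp))
    ((hG.contMDiffAt_act hM m 1).mdifferentiableAt (by simp))
  rw [hG.act_one] at h
  exact (congrArg (fun f : EG →L[ℝ] E => f χ) h).symm

/-- The Liouville form evaluates the covector on the projected vector, and χ_M projects to χ_Q. -/
theorem IsSymmetry.J_apply (hG : N.IsSymmetry EG G)
    (hM : IsSmoothEmbedding 𝓘(ℝ, EM) (cotModel E) ∞ (fun m : N.M => (m.1 : Cotangent E Q)))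
    (m : N.M) (χ : EG) : hG.J EM m χ = m.1.2 (generator EG G (N.tau m) χ) := by
  have h1 : modelDeriv (cotModel E) 𝓘(ℝ, E) (fun p : Cotangent E Q => p.proj) m.1
      (modelDeriv 𝓘(ℝ, EM) (cotModel E) (fun m : N.M => m.1) m (hG.generatorM EM m χ)) =
      generator EG G (N.tau m) χ := by
    rw [modelDeriv_proj]
    exact (N.dincl_fst hM m _).trans (hG.dtau_generatorM hM m χ)
  exact congrArg (fun v : E => (show E →L[ℝ] ℝ from m.1.2) v) h1

end System

end SymmetricLift

/-! ### The splitting TQ = H ⊕ S ⊕ W, the connection forms, and the projections on M. -/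

section SplittingAlgebra

variable {E : Type*} [NormedAddCommGroup E] [NormedSpace ℝ E]
  {Q : Type*} [TopologicalSpace Q] [ChartedSpace E Q] [IsManifold 𝓘(ℝ, E) ∞ Q]

theorem projAlong_apply_left {V : Type*} [AddCommGroup V] [Module ℝ V] {p q : Submodule ℝ V}
    (h : IsCompl p q) {x : V} (hx : x ∈ p) : projAlong p q x = x := by
  have := projAlong_add h hx (zero_mem q)
  rwa [add_zero] at this

theorem projAlong_apply_right {V : Type*} [AddCommGroup V] [Module ℝ V] {p q : Submodule ℝ V}
    (h : IsCompl p q) {y : V} (hy : y ∈ q) : projAlong p q y = 0 := by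
  have := projAlong_add h (zero_mem p) hy
  rwa [zero_add] at this

namespace System.Splitting

variable {N : System E Q} {EG : Type*} [NormedAddCommGroup EG] [NormedSpace ℝ EG]
  {G : Type*} [TopologicalSpace G] [ChartedSpace EG G] [Group G] [MulAction G Q]
  (T : N.Splitting EG G)

/-- H meets V inside D ∩ V = S, hence trivially. As D = H + S with S ≤ V, the dimension assumption D
+ V = TQ says H + V = TQ. -/
theorem isCompl_H_vert {q : Q} (hdim : N.D q ⊔ vert EG G q = ⊤) :
    IsCompl (T.H q) (vert EG G q) := by
  constructor
  · rw [Submodule.disjoint_def]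
    intro x hx hv
    have hD : x ∈ N.D q := T.H_sup_S q ▸ Submodule.mem_sup_left hx
    exact (Submodule.disjoint_def.1 (T.disjoint_H_S q)) x hx ⟨hD, hv⟩
  · rw [codisjoint_iff, eq_top_iff, ← hdim, ← T.H_sup_S q]
    exact sup_le (sup_le le_sup_left (inf_le_right.trans le_sup_right)) le_sup_right

theorem isCompl_S_sup (q : Q) : IsCompl (N.S EG G q) (T.H q ⊔ T.W q) := by
  have h : Disjoint (T.H q ⊔ N.S EG G q) (T.W q) := by
    rw [T.H_sup_S q]; exact (T.isCompl_D_W q).disjoint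
  constructor
  · refine ((T.disjoint_H_S q).symm.disjoint_sup_right_of_disjoint_sup_left ?_)
    rwa [sup_comm]
  · rw [codisjoint_iff, ← sup_assoc, sup_comm (N.S EG G q), T.H_sup_S q]
    exact (T.isCompl_D_W q).sup_eq_top

theorem map_generator_gW (q : Q) :
    (T.gW q).map (generator EG G q).toLinearMap = T.W q := by
  rw [gW, Submodule.map_comap_eq, inf_eq_right]
  exact T.W_le_vert q

theorem vertM_eq {EM : Type*} [NormedAddCommGroup EM] [NormedSpace ℝ EM] [ChartedSpace EM N.M]
    (hG : N.IsSymmetry EG G) (m : N.M) :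
    hG.vertM EM m = (⊤ : Submodule ℝ EG).map (hG.generatorM EM m).toLinearMap :=
  LinearMap.range_eq_map _

theorem dtau_projC {EM : Type*} [NormedAddCommGroup EM] [NormedSpace ℝ EM]
    [ChartedSpace EM N.M] [IsManifold 𝓘(ℝ, EM) ∞ N.M] [IsManifold 𝓘(ℝ, EG) ∞ G]
    (hM : IsSmoothEmbedding 𝓘(ℝ, EM) (cotModel E) ∞
      (fun m : N.M => (m.1 : Cotangent E Q))) (hG : N.IsSymmetry EG G) (m : N.M)
    (hinj : Function.Injective (generator (E := E) EG G (N.tau m)))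
    (u : TangentSpace 𝓘(ℝ, EM) m) :
    N.dtau EM m (T.projC EM hG m u) =
      projAlong (N.D (N.tau m)) (T.W (N.tau m)) (N.dtau EM m u) := by
  have hcomp : (N.dtau EM m).toLinearMap ∘ₗ (hG.generatorM EM m).toLinearMap =
      (generator EG G (N.tau m)).toLinearMap := LinearMap.ext fun χ => hG.dtau_generatorM hM m χ
  refine map_projAlong_left (τ := (N.dtau EM m).toLinearMap)
    (γ := (hG.generatorM EM m).toLinearMap) (K := T.gW (N.tau m)) (p := N.D (N.tau m))
    (q := T.W (N.tau m)) ?_ ?_ (T.isCompl_D_W _) u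
  · rw [hcomp]; exact hinj
  · rw [hcomp]; exact T.map_generator_gW _

variable [FiniteDimensional ℝ E]

theorem AW_of_mem_D {q : Q} {x : TangentSpace 𝓘(ℝ, E) q} (hx : x ∈ N.D q) : T.AW q x = 0 := by
  change (T.gW q).subtype (linLeftInv ((generator EG G q).toLinearMap ∘ₗ (T.gW q).subtype)
    (projAlong (T.W q) (N.D q) x)) = 0
  rw [projAlong_apply_right (T.isCompl_D_W q).symm hx, map_zero, map_zero]

theorem AW_generator {q : Q} (hinj : Function.Injective (generator (E := E) EG G q)) {χ : EG}
    (hχ : χ ∈ T.gW q) : T.AW q (generator EG G q χ) = χ := by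
  change (T.gW q).subtype (linLeftInv ((generator EG G q).toLinearMap ∘ₗ (T.gW q).subtype)
    (projAlong (T.W q) (N.D q) (generator EG G q χ))) = χ
  have hχ' : generator EG G q χ ∈ T.W q := hχ
  rw [projAlong_apply_left (T.isCompl_D_W q).symm hχ']
  exact congrArg Subtype.val (linLeftInv_apply (f := (generator EG G q).toLinearMap ∘ₗ (T.gW q).subtype)
    (hinj.comp Subtype.val_injective) ⟨χ, hχ⟩)

theorem AS_of_mem {l : ℕ} (b : N.GaugeBasis EG G l) (i : Fin l) {q : Q}
    {x : TangentSpace 𝓘(ℝ, E) q} (hx : x ∈ T.H q ⊔ T.W q) : T.AS b i q x = 0 := by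
  change (b.η q).coord i (linLeftInv ((generator EG G q).toLinearMap ∘ₗ (N.gS EG G q).subtype)
    (projAlong (N.S EG G q) (T.H q ⊔ T.W q) x)) = 0
  rw [projAlong_apply_right (T.isCompl_S_sup q) hx, map_zero, map_zero]

theorem AS_generator {l : ℕ} (b : N.GaugeBasis EG G l) (i j : Fin l) {q : Q}
    (hinj : Function.Injective (generator (E := E) EG G q)) :
    T.AS b i q (generator EG G q (b.η q j : EG)) = if j = i then 1 else 0 := by
  change (b.η q).coord i (linLeftInv ((generator EG G q).toLinearMap ∘ₗ (N.gS EG G q).subtype)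
    (projAlong (N.S EG G q) (T.H q ⊔ T.W q) (generator EG G q (b.η q j : EG)))) = _
  have hη : generator EG G q (b.η q j : EG) ∈ N.S EG G q := (b.η q j).2
  rw [projAlong_apply_left (T.isCompl_S_sup q) hη]
  have h := linLeftInv_apply (f := (generator EG G q).toLinearMap ∘ₗ (N.gS EG G q).subtype)
    (hinj.comp Subtype.val_injective) (b.η q j)
  refine (congrArg ((b.η q).coord i) h).trans ?_
  rw [Module.Basis.coord_apply, Module.Basis.repr_self, Finsupp.single_apply]

theorem AV_of_mem_H {q : Q} (hdim : N.D q ⊔ vert EG G q = ⊤) {x : TangentSpace 𝓘(ℝ, E) q}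
    (hx : x ∈ T.H q) : T.AV q x = 0 := by
  change linLeftInv (generator EG G q).toLinearMap (projAlong (vert EG G q) (T.H q) x) = 0
  rw [projAlong_apply_right (T.isCompl_H_vert hdim).symm hx, map_zero]

theorem AV_generator {q : Q} (hdim : N.D q ⊔ vert EG G q = ⊤)
    (hinj : Function.Injective (generator (E := E) EG G q)) (χ : EG) :
    T.AV q (generator EG G q χ) = χ := by
  change linLeftInv (generator EG G q).toLinearMap
    (projAlong (vert EG G q) (T.H q) (generator EG G q χ)) = χ
  have hv : generator EG G q χ ∈ vert (E := E) EG G q := ⟨χ, rfl⟩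
  rw [projAlong_apply_left (T.isCompl_H_vert hdim).symm hv]
  exact linLeftInv_apply (f := (generator EG G q).toLinearMap) hinj χ

theorem AV_eq_zero_iff {q : Q} (hdim : N.D q ⊔ vert EG G q = ⊤)
    (hinj : Function.Injective (generator (E := E) EG G q)) (x : TangentSpace 𝓘(ℝ, E) q) :
    T.AV q x = 0 ↔ x ∈ T.H q := by
  refine ⟨fun h => ?_, T.AV_of_mem_H hdim⟩
  obtain ⟨a, ha, _, ⟨χ, rfl⟩, rfl⟩ := exists_add_of_isCompl (T.isCompl_H_vert hdim) x
  have h1 : T.AV q (a + generator EG G q χ) = χ := by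
    rw [map_add, T.AV_of_mem_H hdim ha, T.AV_generator hdim hinj, zero_add]
  have h2 : χ = 0 := h1.symm.trans h
  rw [h2, map_zero, add_zero]
  exact ha

variable {EM : Type*} [NormedAddCommGroup EM] [NormedSpace ℝ EM] [ChartedSpace EM N.M]

/-- The kernel of A_V is H, so the kernel of its pullback is the preimage of H. This brings the
horizontal distribution to the form that the transfer of projections requires. -/
theorem distH_eq (m : N.M) (hdim : N.D (N.tau m) ⊔ vert EG G (N.tau m) = ⊤)
    (hinj : Function.Injective (generator (E := E) EG G (N.tau m))) :
    T.distH EM m = (T.H (N.tau m)).comap (N.dtau EM m).toLinearMap :=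
  Submodule.ext fun u => T.AV_eq_zero_iff hdim hinj (N.dtau EM m u)

variable [IsManifold 𝓘(ℝ, EM) ∞ N.M] [IsManifold 𝓘(ℝ, EG) ∞ G]

theorem dtau_projH (hM : IsSmoothEmbedding 𝓘(ℝ, EM) (cotModel E) ∞
      (fun m : N.M => (m.1 : Cotangent E Q))) (hG : N.IsSymmetry EG G) (m : N.M)
    (hdim : N.D (N.tau m) ⊔ vert EG G (N.tau m) = ⊤)
    (hinj : Function.Injective (generator (E := E) EG G (N.tau m)))
    (u : TangentSpace 𝓘(ℝ, EM) m) :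
    N.dtau EM m (T.projH EM hG m u) =
      projAlong (T.H (N.tau m)) (vert EG G (N.tau m)) (N.dtau EM m u) := by
  have hcomp : (N.dtau EM m).toLinearMap ∘ₗ (hG.generatorM EM m).toLinearMap =
      (generator EG G (N.tau m)).toLinearMap := LinearMap.ext fun χ => hG.dtau_generatorM hM m χ
  rw [projH, T.distH_eq m hdim hinj, vertM_eq]
  refine map_projAlong_left (τ := (N.dtau EM m).toLinearMap)
    (γ := (hG.generatorM EM m).toLinearMap) (K := ⊤) (p := T.H (N.tau m))
    (q := vert EG G (N.tau m)) ?_ ?_ (T.isCompl_H_vert hdim) u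
  · rw [hcomp]; exact hinj
  · rw [hcomp]; exact (LinearMap.range_eq_map _).symm

theorem dtau_projV (hM : IsSmoothEmbedding 𝓘(ℝ, EM) (cotModel E) ∞
      (fun m : N.M => (m.1 : Cotangent E Q))) (hG : N.IsSymmetry EG G) (m : N.M)
    (hdim : N.D (N.tau m) ⊔ vert EG G (N.tau m) = ⊤)
    (hinj : Function.Injective (generator (E := E) EG G (N.tau m)))
    (u : TangentSpace 𝓘(ℝ, EM) m) :
    N.dtau EM m (T.projV EM hG m u) =
      projAlong (vert EG G (N.tau m)) (T.H (N.tau m)) (N.dtau EM m u) := by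
  have hcomp : (N.dtau EM m).toLinearMap ∘ₗ (hG.generatorM EM m).toLinearMap =
      (generator EG G (N.tau m)).toLinearMap := LinearMap.ext fun χ => hG.dtau_generatorM hM m χ
  rw [projV, T.distH_eq m hdim hinj, vertM_eq]
  refine map_projAlong_right (τ := (N.dtau EM m).toLinearMap)
    (γ := (hG.generatorM EM m).toLinearMap) (K := ⊤) (p := T.H (N.tau m))
    (q := vert EG G (N.tau m)) ?_ ?_ (T.isCompl_H_vert hdim) u
  · rw [hcomp]; exact hinj
  · rw [hcomp]; exact (LinearMap.range_eq_map _).symm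

end System.Splitting

end SplittingAlgebra

/-! ### Alternating 2-forms as bilinear maps. -/

section AlternatingForms

variable {V W : Type*} [NormedAddCommGroup V] [NormedSpace ℝ V] [NormedAddCommGroup W]
  [NormedSpace ℝ W]

/-- An alternating 2-form as a bilinear map. -/
def bilinOfAlternating (f : V [⋀^Fin 2]→L[ℝ] W) : V →ₗ[ℝ] V →ₗ[ℝ] W :=
  have hswap : ∀ u v : V, f ![u, v] = -f ![v, u] := fun u v => by
    have h := f.toAlternatingMap.map_swap ![v, u] (i := 0) (j := 1) (by decide)
    have h2 : (![v, u] ∘ Equiv.swap (0 : Fin 2) 1) = ![u, v] := by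
      ext i; fin_cases i <;> simp
    rw [h2] at h
    exact h
  have hadd : ∀ u u' v : V, f ![u + u', v] = f ![u, v] + f ![u', v] := fun u u' v =>
    f.toMultilinearMap.cons_add ![v] u u'
  have hsmul : ∀ (c : ℝ) (u v : V), f ![c • u, v] = c • f ![u, v] := fun c u v =>
    f.toMultilinearMap.cons_smul ![v] c u
  LinearMap.mk₂ ℝ (fun u v => f ![u, v]) hadd hsmul
    (fun u v v' => by rw [hswap, hadd, neg_add, ← hswap, ← hswap])
    (fun c u v => by rw [hswap, hsmul, ← smul_neg, ← hswap])

end AlternatingForms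

/-! ### The adapted fields as a basis of the tangent space, and the projections in that basis. -/

section FrameAlgebra

variable {E : Type*} [NormedAddCommGroup E] [NormedSpace ℝ E]
  {Q : Type*} [TopologicalSpace Q] [ChartedSpace E Q] [IsManifold 𝓘(ℝ, E) ∞ Q]
  {N : System E Q} {EG : Type*} [NormedAddCommGroup EG] [NormedSpace ℝ EG]
  {G : Type*} [TopologicalSpace G] [ChartedSpace EG G] [Group G] [MulAction G Q]

namespace AdaptedFrame

variable {T : N.Splitting EG G} {l : ℕ} {b : N.GaugeBasis EG G l} {r k : ℕ}
  (F : AdaptedFrame T b r k)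

/-- The basis of sections of `𝔤` consisting of the `η_i` and the `ξ_a`. -/
def algebraSection : Fin l ⊕ Fin k → Q → EG
  | .inl i, q => (b.η q i : EG)
  | .inr a, q => F.ξ a q

theorem field_inr (A : Fin l ⊕ Fin k) (q : Q) :
    F.field (.inr A) q = generator EG G q (F.algebraSection A q) := by
  cases A <;> rfl

theorem field_mem_H {q : Q} (hq : q ∈ F.U) (α : Fin r) : F.field (.inl α) q ∈ T.H q :=
  F.X_span q hq ▸ Submodule.subset_span ⟨α, rfl⟩

theorem field_mem_S (q : Q) (i : Fin l) : F.field (.inr (.inl i)) q ∈ N.S EG G q := (b.η q i).2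

theorem ξ_mem {q : Q} (hq : q ∈ F.U) (a : Fin k) : F.ξ a q ∈ T.gW q :=
  F.ξ_span q hq ▸ Submodule.subset_span ⟨a, rfl⟩

theorem field_mem_W {q : Q} (hq : q ∈ F.U) (a : Fin k) : F.field (.inr (.inr a)) q ∈ T.W q :=
  F.ξ_mem hq a

theorem H_le_D (T : N.Splitting EG G) (q : Q) : T.H q ≤ N.D q := T.H_sup_S q ▸ le_sup_left

theorem span_Y (q : Q) :
    Submodule.span ℝ (range fun i => F.field (.inr (.inl i)) q) = N.S EG G q := by
  have h1 : (range fun i => F.field (.inr (.inl i)) q) =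
      (generator (E := E) EG G q).toLinearMap ''
        ((N.gS EG G q).subtype '' range (b.η q)) := by
    rw [← range_comp, ← range_comp]
    rfl
  rw [h1, Submodule.span_image, Submodule.span_image, (b.η q).span_eq, Submodule.map_top,
    Submodule.range_subtype, System.gS, Submodule.map_comap_eq, inf_eq_right]
  exact inf_le_right

theorem span_Z {q : Q} (hq : q ∈ F.U) :
    Submodule.span ℝ (range fun a => F.field (.inr (.inr a)) q) = T.W q := by
  have h1 : (range fun a => F.field (.inr (.inr a)) q) =
      (generator (E := E) EG G q).toLinearMap '' (range fun a => F.ξ a q) := by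
    rw [← range_comp]
    rfl
  rw [h1, Submodule.span_image, F.ξ_span q hq, T.map_generator_gW]

theorem field_eq_elim (q : Q) : (fun J => F.field J q) =
    Sum.elim (fun α => F.X α q) (Sum.elim (fun i => F.field (.inr (.inl i)) q)
      (fun a => F.field (.inr (.inr a)) q)) := by
  funext J
  rcases J with α | i | a <;> rfl

theorem span_vertical {q : Q} (hq : q ∈ F.U) :
    Submodule.span ℝ (range (Sum.elim (fun i => F.field (.inr (.inl i)) q)
      (fun a => F.field (.inr (.inr a)) q))) = N.S EG G q ⊔ T.W q := by
  rw [Sum.elim_range, Submodule.span_union, F.span_Y, F.span_Z hq]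

/-- Injectivity of the generator map keeps the Y_i and the Z_a independent; the three families span
H, S and W, whose sum is direct. -/
theorem field_linearIndependent {q : Q} (hq : q ∈ F.U)
    (hinj : Function.Injective (generator (E := E) EG G q)) :
    LinearIndependent ℝ (fun J => F.field J q) := by
  have hker : LinearMap.ker (generator (E := E) EG G q).toLinearMap = ⊥ :=
    LinearMap.ker_eq_bot.2 hinj
  have hY : LinearIndependent ℝ (fun i => F.field (.inr (.inl i)) q) :=
    ((b.η q).linearIndependent.map' _ (N.gS EG G q).ker_subtype).map' _ hker
  have hZ : LinearIndependent ℝ (fun a => F.field (.inr (.inr a)) q) :=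
    (F.ξ_linearIndependent q hq).map' _ hker
  rw [F.field_eq_elim]
  refine (F.X_linearIndependent q hq).sum_type (hY.sum_type hZ ?_) ?_
  · rw [F.span_Y, F.span_Z hq]
    exact (T.isCompl_D_W q).disjoint.mono_left inf_le_left
  · rw [F.X_span q hq, F.span_vertical hq]
    refine (T.disjoint_H_S q).disjoint_sup_right_of_disjoint_sup_left ?_
    rw [T.H_sup_S q]
    exact (T.isCompl_D_W q).disjoint

theorem field_span {q : Q} (hq : q ∈ F.U) :
    ⊤ ≤ Submodule.span ℝ (range fun J => F.field J q) := by
  rw [F.field_eq_elim, Sum.elim_range, Submodule.span_union, F.X_span q hq, F.span_vertical hq,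
    ← sup_assoc, T.H_sup_S q, (T.isCompl_D_W q).sup_eq_top]

/-- Over `F.U` the adapted fields are a basis, so the default branch of `dualVec` does not occur. -/
theorem coframe_eq {q : Q} (hq : q ∈ F.U)
    (hinj : Function.Injective (generator (E := E) EG G q)) (I : Fin r ⊕ (Fin l ⊕ Fin k)) :
    F.coframe I q =
      (Module.Basis.mk (F.field_linearIndependent hq hinj) (F.field_span hq)).coord I :=
  dif_pos ⟨F.field_linearIndependent hq hinj, F.field_span hq⟩

theorem sum_coframe_smul {q : Q} (hq : q ∈ F.U)
    (hinj : Function.Injective (generator (E := E) EG G q)) (x : TangentSpace 𝓘(ℝ, E) q) :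
    ∑ I, F.coframe I q x • F.field I q = x := by
  have h := (Module.Basis.mk (F.field_linearIndependent hq hinj) (F.field_span hq)).sum_repr x
  refine Eq.trans (Finset.sum_congr rfl fun I _ => ?_) h
  rw [F.coframe_eq hq hinj, Module.Basis.mk_apply]
  rfl

theorem coframe_eq_zero_of_mem_D {q : Q} (hq : q ∈ F.U)
    (hinj : Function.Injective (generator (E := E) EG G q)) {x : TangentSpace 𝓘(ℝ, E) q}
    (hx : x ∈ N.D q) (a : Fin k) : F.coframe (.inr (.inr a)) q x = 0 := by
  have hle : N.D q ≤ LinearMap.ker (F.coframe (.inr (.inr a)) q) := by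
    rw [← T.H_sup_S q, ← F.X_span q hq, ← F.span_Y, ← Submodule.span_union, Submodule.span_le]
    have h : ∀ J, J ≠ .inr (.inr a) → F.coframe (.inr (.inr a)) q (F.field J q) = 0 := by
      intro J hJ
      have h1 := Module.Basis.mk_coord_apply_ne (hli := F.field_linearIndependent hq hinj)
        (hsp := F.field_span hq) hJ
      rw [F.coframe_eq hq hinj]
      exact h1
    rintro _ (⟨α, rfl⟩ | ⟨i, rfl⟩)
    · exact h (.inl α) (by simp)
    · exact h (.inr (.inl i)) (by simp)
  exact hle hx

/-- The part of the frame spanning `D`. -/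
def fieldD : Fin r ⊕ Fin l → ∀ q : Q, TangentSpace 𝓘(ℝ, E) q
  | .inl α => F.field (.inl α)
  | .inr i => F.field (.inr (.inl i))

theorem sum_horizontal_add_sum_vertical {q : Q} (hq : q ∈ F.U)
    (hinj : Function.Injective (generator (E := E) EG G q)) (x : TangentSpace 𝓘(ℝ, E) q) :
    ∑ α, F.coframe (.inl α) q x • F.field (.inl α) q +
      (∑ i, F.coframe (.inr (.inl i)) q x • F.field (.inr (.inl i)) q +
        ∑ a, F.coframe (.inr (.inr a)) q x • F.field (.inr (.inr a)) q) = x := by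
  rw [← Fintype.sum_sum_type (fun A => F.coframe (.inr A) q x • F.field (.inr A) q),
    ← Fintype.sum_sum_type (fun I => F.coframe I q x • F.field I q)]
  exact F.sum_coframe_smul hq hinj x

theorem projAlong_D {q : Q} (hq : q ∈ F.U)
    (hinj : Function.Injective (generator (E := E) EG G q)) (x : TangentSpace 𝓘(ℝ, E) q) :
    projAlong (N.D q) (T.W q) x = ∑ α, F.coframe (.inl α) q x • F.field (.inl α) q +
      ∑ i, F.coframe (.inr (.inl i)) q x • F.field (.inr (.inl i)) q := by
  have h := F.sum_horizontal_add_sum_vertical hq hinj x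
  rw [← add_assoc] at h
  refine (congrArg (projAlong (N.D q) (T.W q)) h.symm).trans (projAlong_add (T.isCompl_D_W q) ?_ ?_)
  · exact add_mem (Submodule.sum_mem _ fun α _ => Submodule.smul_mem _ _
      (H_le_D T q (F.field_mem_H hq α)))
      (Submodule.sum_mem _ fun i _ => Submodule.smul_mem _ _ (F.field_mem_S q i).1)
  · exact Submodule.sum_mem _ fun a _ => Submodule.smul_mem _ _ (F.field_mem_W hq a)

theorem vertical_sum_mem {q : Q} (c : Fin l ⊕ Fin k → ℝ) :
    ∑ i, c (.inl i) • F.field (.inr (.inl i)) q + ∑ a, c (.inr a) • F.field (.inr (.inr a)) q ∈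
      vert EG G q :=
  add_mem (Submodule.sum_mem _ fun _ _ => Submodule.smul_mem _ _ ⟨_, rfl⟩)
    (Submodule.sum_mem _ fun _ _ => Submodule.smul_mem _ _ ⟨_, rfl⟩)

theorem projAlong_H {q : Q} (hq : q ∈ F.U) (hdim : N.D q ⊔ vert EG G q = ⊤)
    (hinj : Function.Injective (generator (E := E) EG G q)) (x : TangentSpace 𝓘(ℝ, E) q) :
    projAlong (T.H q) (vert EG G q) x =
      ∑ α, F.coframe (.inl α) q x • F.field (.inl α) q := by
  have h := F.sum_horizontal_add_sum_vertical hq hinj x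
  refine (congrArg (projAlong (T.H q) (vert EG G q)) h.symm).trans
    (projAlong_add (T.isCompl_H_vert hdim) ?_ ?_)
  · exact Submodule.sum_mem _ fun α _ => Submodule.smul_mem _ _ (F.field_mem_H hq α)
  · exact F.vertical_sum_mem fun A => F.coframe (.inr A) q x

/-- A vector of D has no Z_a components. Applied to the velocity, this is why only the v^i occur in
the final formulas. -/
theorem projAlong_vert_of_mem_D {q : Q} (hq : q ∈ F.U) (hdim : N.D q ⊔ vert EG G q = ⊤)
    (hinj : Function.Injective (generator (E := E) EG G q)) {x : TangentSpace 𝓘(ℝ, E) q}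
    (hx : x ∈ N.D q) : projAlong (vert EG G q) (T.H q) x =
      ∑ i, F.coframe (.inr (.inl i)) q x • F.field (.inr (.inl i)) q := by
  have h := F.sum_horizontal_add_sum_vertical hq hinj x
  have h0 : ∑ a, F.coframe (.inr (.inr a)) q x • F.field (.inr (.inr a)) q = 0 :=
    Finset.sum_eq_zero fun a _ => by rw [F.coframe_eq_zero_of_mem_D hq hinj hx, zero_smul]
  rw [add_comm] at h
  refine (congrArg (projAlong (vert EG G q) (T.H q)) h.symm).trans
    ((projAlong_add (T.isCompl_H_vert hdim).symm ?_ ?_).trans ?_)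
  · exact F.vertical_sum_mem fun A => F.coframe (.inr A) q x
  · exact Submodule.sum_mem _ fun α _ => Submodule.smul_mem _ _ (F.field_mem_H hq α)
  · rw [h0, add_zero]

end AdaptedFrame

end FrameAlgebra

/-! ### Differentials of the connection forms on the adapted fields. -/

section FrameCurvature

variable {E : Type*} [NormedAddCommGroup E] [NormedSpace ℝ E]
  {Q : Type*} [TopologicalSpace Q] [ChartedSpace E Q] [IsManifold 𝓘(ℝ, E) ∞ Q]
  {N : System E Q} {EG : Type*} [NormedAddCommGroup EG] [NormedSpace ℝ EG]
  {G : Type*} [TopologicalSpace G] [ChartedSpace EG G] [Group G] [MulAction G Q]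

namespace AdaptedFrame

variable {T : N.Splitting EG G} {l : ℕ} {b : N.GaugeBasis EG G l} {r k : ℕ}
  (F : AdaptedFrame T b r k)

section Values

variable {q : Q}

theorem form_apply {F' : Type*} [NormedAddCommGroup F'] [NormedSpace ℝ F'] (hq : q ∈ F.U)
    (hinj : Function.Injective (generator (E := E) EG G q)) (θ : TangentSpace 𝓘(ℝ, E) q →L[ℝ] F')
    (x : TangentSpace 𝓘(ℝ, E) q) :
    θ x = ∑ α, F.coframe (.inl α) q x • θ (F.field (.inl α) q) +
      (∑ i, F.coframe (.inr (.inl i)) q x • θ (F.field (.inr (.inl i)) q) +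
        ∑ a, F.coframe (.inr (.inr a)) q x • θ (F.field (.inr (.inr a)) q)) := by
  refine (congrArg θ (F.sum_horizontal_add_sum_vertical hq hinj x).symm).trans ?_
  simp only [map_add, map_sum, map_smul]

variable [FiniteDimensional ℝ E]

theorem AW_fieldD (hq : q ∈ F.U) (I : Fin r ⊕ Fin l) : T.AW q (F.fieldD I q) = 0 := by
  refine T.AW_of_mem_D ?_
  rcases I with α | i
  · exact H_le_D T q (F.field_mem_H hq α)
  · exact (F.field_mem_S q i).1

theorem AW_Z (hq : q ∈ F.U) (hinj : Function.Injective (generator (E := E) EG G q)) (a : Fin k) :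
    T.AW q (F.field (.inr (.inr a)) q) = F.ξ a q :=
  T.AW_generator hinj (F.ξ_mem hq a)

theorem AS_field (hq : q ∈ F.U) (hinj : Function.Injective (generator (E := E) EG G q))
    (i : Fin l) (J : Fin r ⊕ (Fin l ⊕ Fin k)) :
    T.AS b i q (F.field J q) = if J = .inr (.inl i) then 1 else 0 := by
  rcases J with α | j | a
  · rw [if_neg (by simp)]
    exact T.AS_of_mem b i (Submodule.mem_sup_left (F.field_mem_H hq α))
  · refine (T.AS_generator b i j hinj).trans ?_
    simp
  · rw [if_neg (by simp)]
    exact T.AS_of_mem b i (Submodule.mem_sup_right (F.field_mem_W hq a))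

theorem AV_X (hq : q ∈ F.U) (hdim : N.D q ⊔ vert EG G q = ⊤) (α : Fin r) :
    T.AV q (F.field (.inl α) q) = 0 :=
  T.AV_of_mem_H hdim (F.field_mem_H hq α)

theorem AV_vertical (hdim : N.D q ⊔ vert EG G q = ⊤)
    (hinj : Function.Injective (generator (E := E) EG G q)) (A : Fin l ⊕ Fin k) :
    T.AV q (F.field (.inr A) q) = F.algebraSection A q := by
  rw [F.field_inr]
  exact T.AV_generator hdim hinj _

theorem AW_apply (hq : q ∈ F.U) (hinj : Function.Injective (generator (E := E) EG G q))
    (x : TangentSpace 𝓘(ℝ, E) q) :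
    T.AW q x = ∑ a, F.coframe (.inr (.inr a)) q x • F.ξ a q := by
  rw [F.form_apply hq hinj]
  have h1 : ∀ α, T.AW q (F.field (.inl α) q) = 0 := fun α => F.AW_fieldD hq (.inl α)
  have h2 : ∀ i, T.AW q (F.field (.inr (.inl i)) q) = 0 := fun i => F.AW_fieldD hq (.inr i)
  simp only [h1, h2, F.AW_Z hq hinj, smul_zero, Finset.sum_const_zero, zero_add]

theorem AS_apply (hq : q ∈ F.U) (hinj : Function.Injective (generator (E := E) EG G q))
    (i : Fin l) (x : TangentSpace 𝓘(ℝ, E) q) :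
    T.AS b i q x = F.coframe (.inr (.inl i)) q x := by
  rw [F.form_apply hq hinj]
  simp [F.AS_field hq hinj]

theorem AV_apply (hq : q ∈ F.U) (hdim : N.D q ⊔ vert EG G q = ⊤)
    (hinj : Function.Injective (generator (E := E) EG G q)) (x : TangentSpace 𝓘(ℝ, E) q) :
    T.AV q x = ∑ A, F.coframe (.inr A) q x • F.algebraSection A q := by
  rw [F.form_apply hq hinj, Fintype.sum_sum_type]
  simp only [F.AV_X hq hdim, F.AV_vertical hdim hinj, smul_zero, Finset.sum_const_zero, zero_add]

end Values

section Smoothness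

variable {q : Q}

theorem contMDiffAt_algebraSection (hq : q ∈ F.U) (A : Fin l ⊕ Fin k) :
    ContMDiffAt 𝓘(ℝ, E) 𝓘(ℝ, EG) ∞ (F.algebraSection A) q := by
  rcases A with i | a
  · exact (b.smooth i).contMDiffAt
  · exact (F.smooth_ξ a).contMDiffAt (F.isOpen_U.mem_nhds hq)

variable [IsManifold 𝓘(ℝ, EG) ∞ G]

theorem contMDiffAt_field (hG : N.IsSymmetry EG G) (hq : q ∈ F.U)
    (J : Fin r ⊕ (Fin l ⊕ Fin k)) : ContMDiffAt 𝓘(ℝ, E) 𝓘(ℝ, E).tangent 1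
      (fun q => (⟨q, F.field J q⟩ : TangentBundle 𝓘(ℝ, E) Q)) q := by
  refine ContMDiffAt.of_le (n := ∞) ?_ (by simp)
  rcases J with α | A
  · exact (F.smooth_X α).contMDiffAt (F.isOpen_U.mem_nhds hq)
  · have h := contMDiffAt_generator hG.contMDiff_smul (F.contMDiffAt_algebraSection hq A)
    refine h.congr_of_eventuallyEq (Filter.Eventually.of_forall fun q => ?_)
    exact congrArg (fun v => (⟨q, v⟩ : TangentBundle 𝓘(ℝ, E) Q)) (F.field_inr A q)

/-- The connection forms are defined pointwise by choices of projections and left inverses, so their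
regularity has to be read off from their values on the frame. -/
theorem formDifferentiableAt (hG : N.IsSymmetry EG G) [FiniteDimensional ℝ E] {F' : Type*}
    [NormedAddCommGroup F'] [NormedSpace ℝ F'] (hq : q ∈ F.U)
    (hinj : Function.Injective (generator (E := E) EG G q))
    {θ : ∀ q : Q, TangentSpace 𝓘(ℝ, E) q →L[ℝ] F'} {f : Fin r ⊕ (Fin l ⊕ Fin k) → Q → F'}
    (hf : ∀ J, ContMDiffAt 𝓘(ℝ, E) 𝓘(ℝ, F') ∞ (f J) q)
    (hθ : ∀ J, ∀ q ∈ F.U, θ q (F.field J q) = f J q) : FormDifferentiableAt 𝓘(ℝ, E) θ q := by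
  refine formDifferentiableAt_of_frame (X := F.field) (F.contMDiffAt_field hG hq)
    (F.field_linearIndependent hq hinj) (F.field_span hq) fun J => ?_
  refine ((hf J).mdifferentiableAt (by simp)).congr_of_eventuallyEq ?_
  filter_upwards [F.isOpen_U.mem_nhds hq] with q' hq'
  exact hθ J q' hq'

end Smoothness

section Derivatives

variable [FiniteDimensional ℝ E] [IsManifold 𝓘(ℝ, EG) ∞ G] {q : Q}

theorem formDifferentiableAt_AW (hG : N.IsSymmetry EG G) (hq : q ∈ F.U)
    (hinj : ∀ q : Q, Function.Injective (generator (E := E) EG G q)) :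
    FormDifferentiableAt 𝓘(ℝ, E) T.AW q := by
  refine F.formDifferentiableAt hG hq (hinj q)
    (f := Sum.elim (fun _ _ => 0) (Sum.elim (fun _ _ => 0) F.ξ)) ?_ ?_
  · rintro (α | i | a)
    · exact contMDiffAt_const
    · exact contMDiffAt_const
    · exact F.contMDiffAt_algebraSection hq (.inr a)
  · rintro (α | i | a) q' hq'
    · exact F.AW_fieldD hq' (.inl α)
    · exact F.AW_fieldD hq' (.inr i)
    · exact F.AW_Z hq' (hinj q') a

theorem formDifferentiableAt_AS (hG : N.IsSymmetry EG G) (hq : q ∈ F.U)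
    (hinj : ∀ q : Q, Function.Injective (generator (E := E) EG G q)) (i : Fin l) :
    FormDifferentiableAt 𝓘(ℝ, E) (T.AS b i) q :=
  F.formDifferentiableAt hG hq (hinj q)
    (f := fun J _ => if J = .inr (.inl i) then 1 else 0) (fun _ => contMDiffAt_const)
    fun J q' hq' => F.AS_field hq' (hinj q') i J

theorem formDifferentiableAt_AV (hG : N.IsSymmetry EG G) (hq : q ∈ F.U)
    (hdim : ∀ q : Q, N.D q ⊔ vert EG G q = ⊤)
    (hinj : ∀ q : Q, Function.Injective (generator (E := E) EG G q)) :
    FormDifferentiableAt 𝓘(ℝ, E) T.AV q := by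
  refine F.formDifferentiableAt hG hq (hinj q)
    (f := Sum.elim (fun _ _ => 0) F.algebraSection) ?_ ?_
  · rintro (α | A)
    · exact contMDiffAt_const
    · exact F.contMDiffAt_algebraSection hq A
  · rintro (α | A) q' hq'
    · exact F.AV_X hq' (hdim q') α
    · exact F.AV_vertical (hdim q') (hinj q') A

/-- A_W vanishes identically on the fields spanning D. The restriction to these fields matters: on
Z_a its value is ξ_a, which varies. -/
theorem extDer_AW (hG : N.IsSymmetry EG G) (hq : q ∈ F.U)
    (hinj : ∀ q : Q, Function.Injective (generator (E := E) EG G q)) (I J : Fin r ⊕ Fin l) :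
    extDer 𝓘(ℝ, E) T.AW q ![F.fieldD I q, F.fieldD J q] =
      -T.AW q (VectorField.mlieBracket 𝓘(ℝ, E) (F.fieldD I) (F.fieldD J) q) := by
  have hs : ∀ I, ContMDiffAt 𝓘(ℝ, E) 𝓘(ℝ, E).tangent 1
      (fun q => (⟨q, F.fieldD I q⟩ : TangentBundle 𝓘(ℝ, E) Q)) q := by
    rintro (α | i)
    · exact F.contMDiffAt_field hG hq (.inl α)
    · exact F.contMDiffAt_field hG hq (.inr (.inl i))
  have hv : ∀ I, ∀ᶠ z in 𝓝 q, T.AW z (F.fieldD I z) = 0 := fun I => by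
    filter_upwards [F.isOpen_U.mem_nhds hq] with z hz
    exact F.AW_fieldD hz I
  exact extDer_eq_neg_of_eventuallyEq_const (F.formDifferentiableAt_AW hG hq hinj) (hs I) (hs J)
    (hv I) (hv J)

/-- The scalar form A_S^i takes the constant values 0 and 1 on the whole frame. The 𝔤-valued A_S
would not do, since its value on Y_i is the section η_i. -/
theorem extDer_AS (hG : N.IsSymmetry EG G) (hq : q ∈ F.U)
    (hinj : ∀ q : Q, Function.Injective (generator (E := E) EG G q)) (i : Fin l)
    (I J : Fin r ⊕ (Fin l ⊕ Fin k)) :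
    extDer 𝓘(ℝ, E) (T.AS b i) q ![F.field I q, F.field J q] =
      -T.AS b i q (VectorField.mlieBracket 𝓘(ℝ, E) (F.field I) (F.field J) q) := by
  have hv : ∀ I, ∀ᶠ z in 𝓝 q, T.AS b i z (F.field I z) = if I = .inr (.inl i) then 1 else 0 :=
    fun I => by
      filter_upwards [F.isOpen_U.mem_nhds hq] with z hz
      exact F.AS_field hz (hinj z) i I
  exact extDer_eq_neg_of_eventuallyEq_const (F.formDifferentiableAt_AS hG hq hinj i)
    (F.contMDiffAt_field hG hq I) (F.contMDiffAt_field hG hq J) (hv I) (hv J)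

theorem extDer_AV (hG : N.IsSymmetry EG G) (hq : q ∈ F.U)
    (hdim : ∀ q : Q, N.D q ⊔ vert EG G q = ⊤)
    (hinj : ∀ q : Q, Function.Injective (generator (E := E) EG G q)) (α β : Fin r) :
    extDer 𝓘(ℝ, E) T.AV q ![F.field (.inl α) q, F.field (.inl β) q] =
      -T.AV q (VectorField.mlieBracket 𝓘(ℝ, E) (F.field (.inl α)) (F.field (.inl β)) q) := by
  have hv : ∀ α, ∀ᶠ z in 𝓝 q, T.AV z (F.field (.inl α) z) = 0 := fun α => by
    filter_upwards [F.isOpen_U.mem_nhds hq] with z hz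
    exact F.AV_X hz (hdim z) α
  exact extDer_eq_neg_of_eventuallyEq_const (F.formDifferentiableAt_AV hG hq hdim hinj)
    (F.contMDiffAt_field hG hq _) (F.contMDiffAt_field hG hq _) (hv α) (hv β)

end Derivatives

end AdaptedFrame

end FrameCurvature

/-! ### Curvature on D in terms of the structure functions. -/

section CoordinateExpressions

/-- The two terms of the wedge contribute equally when the coefficients are antisymmetric. The
factors ½ in front of the YY and XX blocks with coefficients p_A C originate here. -/
theorem sum_mul_wedge_of_antisymm {ι : Type*} [Fintype ι] {a : ι → ι → ℝ}
    (ha : ∀ i j, a i j = -a j i) (x y : ι → ℝ) :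
    ∑ i, ∑ j, a i j * (x i * y j - y i * x j) = 2 * ∑ i, ∑ j, a i j * (x i * y j) := by
  have h : ∑ i, ∑ j, a i j * (y i * x j) = -∑ i, ∑ j, a i j * (x i * y j) := by
    rw [Finset.sum_comm, ← Finset.sum_neg_distrib]
    refine Finset.sum_congr rfl fun i _ => ?_
    rw [← Finset.sum_neg_distrib]
    refine Finset.sum_congr rfl fun j _ => ?_
    rw [ha j i]
    ring
  simp only [mul_sub, Finset.sum_sub_distrib, h]
  ring

theorem bilin_sum_smul {V W ι κ : Type*} [AddCommGroup V] [Module ℝ V] [AddCommGroup W]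
    [Module ℝ W] [Fintype ι] [Fintype κ] (f : V →ₗ[ℝ] V →ₗ[ℝ] W) (x : ι → ℝ) (y : κ → ℝ)
    (X : ι → V) (Y : κ → V) :
    f (∑ i, x i • X i) (∑ j, y j • Y j) = ∑ i, ∑ j, (x i * y j) • f (X i) (Y j) := by
  rw [map_sum f, LinearMap.sum_apply]
  refine Finset.sum_congr rfl fun i _ => ?_
  rw [map_sum]
  refine Finset.sum_congr rfl fun j _ => ?_
  rw [map_smul, map_smul, LinearMap.smul_apply, smul_smul, mul_comm]

variable {E : Type*} [NormedAddCommGroup E] [NormedSpace ℝ E]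
  {Q : Type*} [TopologicalSpace Q] [ChartedSpace E Q] [IsManifold 𝓘(ℝ, E) ∞ Q]
  {N : System E Q} {EG : Type*} [NormedAddCommGroup EG] [NormedSpace ℝ EG]
  {G : Type*} [TopologicalSpace G] [ChartedSpace EG G] [Group G] [MulAction G Q]

/-- The curvature `dA_W + dA_S^i ⊗ η_i` on the configuration manifold. -/
def System.Splitting.curvature [FiniteDimensional ℝ E] (T : N.Splitting EG G) {l : ℕ} (b : N.GaugeBasis EG G l) (q : Q) :
    E →ₗ[ℝ] E →ₗ[ℝ] EG :=
  bilinOfAlternating (V := E) (extDer 𝓘(ℝ, E) T.AW q) +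
    ∑ i, (bilinOfAlternating (V := E) (extDer 𝓘(ℝ, E) (T.AS b i) q)).compr₂
      (LinearMap.toSpanSingleton ℝ EG (b.η q i : EG))

namespace AdaptedFrame

variable {T : N.Splitting EG G} {l : ℕ} {b : N.GaugeBasis EG G l} {r k : ℕ}
  (F : AdaptedFrame T b r k)

/-- The inclusion of the indices of the part of the frame spanning `D`. -/
def indexD : Fin r ⊕ Fin l → Fin r ⊕ (Fin l ⊕ Fin k)
  | .inl α => .inl α
  | .inr i => .inr (.inl i)

theorem fieldD_eq (I : Fin r ⊕ Fin l) : F.fieldD I = F.field (indexD I) := by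
  rcases I with α | i <;> rfl

theorem projAlong_D_eq {q : Q} (hq : q ∈ F.U)
    (hinj : Function.Injective (generator (E := E) EG G q)) (x : TangentSpace 𝓘(ℝ, E) q) :
    projAlong (N.D q) (T.W q) x = ∑ I, F.coframe (indexD I) q x • F.fieldD I q := by
  rw [F.projAlong_D hq hinj, Fintype.sum_sum_type]
  rfl

theorem C_antisymm (K I J : Fin r ⊕ (Fin l ⊕ Fin k)) (q : Q) : F.C K I J q = -F.C K J I q := by
  have h := congrFun (VectorField.mlieBracket_swap (I := 𝓘(ℝ, E)) (V := F.field I)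
    (W := F.field J)) q
  rw [C, C, ← map_neg]
  exact congrArg (F.coframe K q) h

variable {EM : Type*} [NormedAddCommGroup EM] [NormedSpace ℝ EM] [ChartedSpace EM N.M]
  [IsManifold 𝓘(ℝ, EM) ∞ N.M]

theorem extDer_pullback_tau
    (hM : IsSmoothEmbedding 𝓘(ℝ, EM) (cotModel E) ∞ (fun m : N.M => (m.1 : Cotangent E Q)))
    {F' : Type*} [NormedAddCommGroup F'] [NormedSpace ℝ F']
    {θ : ∀ q : Q, TangentSpace 𝓘(ℝ, E) q →L[ℝ] F'} {m : N.M}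
    (hθ : FormDifferentiableAt 𝓘(ℝ, E) θ (N.tau m)) (u v : TangentSpace 𝓘(ℝ, EM) m) :
    extDer 𝓘(ℝ, EM) (pullback 𝓘(ℝ, EM) 𝓘(ℝ, E) N.tau θ) m ![u, v] =
      extDer 𝓘(ℝ, E) θ (N.tau m) ![N.dtau EM m u, N.dtau EM m v] :=
  extDer_pullback (Filter.Eventually.of_forall fun z =>
    (N.contMDiff_tau hM).mdifferentiableAt (by simp))
    ((N.contMDiff_tau hM).contMDiffAt.of_le ENat.LEInfty.out) hθ u v

theorem J_algebraSection [IsManifold 𝓘(ℝ, EG) ∞ G]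
    (hM : IsSmoothEmbedding 𝓘(ℝ, EM) (cotModel E) ∞ (fun m : N.M => (m.1 : Cotangent E Q)))
    (hG : N.IsSymmetry EG G) (m : N.M) (A : Fin l ⊕ Fin k) :
    hG.J EM m (F.algebraSection A (N.tau m)) = F.p (.inr A) m := by
  rw [hG.J_apply hM, p, F.field_inr]

variable [FiniteDimensional ℝ E]

theorem curvature_apply (q : Q) (x y : E) : T.curvature b q x y =
    extDer 𝓘(ℝ, E) T.AW q ![x, y] + ∑ i, extDer 𝓘(ℝ, E) (T.AS b i) q ![x, y] • (b.η q i : EG) := by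
  simp only [System.Splitting.curvature, LinearMap.add_apply, LinearMap.sum_apply,
    LinearMap.compr₂_apply, LinearMap.toSpanSingleton_apply]
  rfl

variable [IsManifold 𝓘(ℝ, EG) ∞ G]

/-- The S-part of the bracket is recorded by dA_S^i ⊗ η_i and the W-part by dA_W, so together they
return the whole vertical part of the bracket, as an element of 𝔤 and with a minus sign. -/
theorem curvature_fieldD (hG : N.IsSymmetry EG G) {q : Q} (hq : q ∈ F.U)
    (hinj : ∀ q : Q, Function.Injective (generator (E := E) EG G q)) (I J : Fin r ⊕ Fin l) :
    T.curvature b q (F.fieldD I q) (F.fieldD J q) =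
      -∑ A, F.C (.inr A) (indexD I) (indexD J) q • F.algebraSection A q := by
  have h1 := F.extDer_AW hG hq hinj I J
  have h2 := fun i => F.extDer_AS hG hq hinj i (indexD I) (indexD J)
  rw [F.AW_apply hq (hinj q)] at h1
  simp only [F.AS_apply hq (hinj q), ← F.fieldD_eq] at h2
  refine (curvature_apply q _ _).trans ?_
  rw [Fintype.sum_sum_type, neg_add, add_comm, ← Finset.sum_neg_distrib]
  refine congrArg₂ _ (Finset.sum_congr rfl fun i _ => ?_) ?_
  · refine (congrArg (fun c : ℝ => c • (b.η q i : EG)) (h2 i)).trans ?_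
    rw [neg_smul, C, ← F.fieldD_eq, ← F.fieldD_eq]
    rfl
  · refine h1.trans ?_
    simp only [C, ← F.fieldD_eq]
    rfl

/-- Both summands of 𝒦 are differentials of pullbacks restricted by P_𝓒, and P_𝓒 lies over the
projection onto D along W. -/
theorem KW_add_dCAS
    (hM : IsSmoothEmbedding 𝓘(ℝ, EM) (cotModel E) ∞ (fun m : N.M => (m.1 : Cotangent E Q)))
    (hG : N.IsSymmetry EG G) {m : N.M} (hm : N.tau m ∈ F.U)
    (hinj : ∀ q : Q, Function.Injective (generator (E := E) EG G q))
    (u v : TangentSpace 𝓘(ℝ, EM) m) :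
    T.KW EM hG m u v + T.dCAS EM hG b m u v = T.curvature b (N.tau m)
      (projAlong (N.D (N.tau m)) (T.W (N.tau m)) (N.dtau EM m u))
      (projAlong (N.D (N.tau m)) (T.W (N.tau m)) (N.dtau EM m v)) := by
  refine Eq.trans ?_ (curvature_apply _ _ _).symm
  have h : ∀ u, N.dtau EM m (T.projC EM hG m u) =
      projAlong (N.D (N.tau m)) (T.W (N.tau m)) (N.dtau EM m u) := fun u =>
    T.dtau_projC hM hG m (hinj _) u
  rw [← h, ← h]
  refine congrArg₂ _ (extDer_pullback_tau hM (F.formDifferentiableAt_AW hG hm hinj) _ _)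
    (Finset.sum_congr rfl fun i _ => ?_)
  exact congrArg (fun c : ℝ => c • (b.η (N.tau m) i : EG))
    (extDer_pullback_tau hM (F.formDifferentiableAt_AS hG hm hinj i) _ _)

end AdaptedFrame

end CoordinateExpressions

/-! ### Rearrangement of finite sums. -/

section Sums

theorem sum_rotate {ι κ A M : Type*} [Fintype ι] [Fintype κ] [Fintype A] [AddCommMonoid M]
    (f : ι → κ → A → M) : ∑ i, ∑ j, ∑ a, f i j a = ∑ a, ∑ i, ∑ j, f i j a :=
  (Finset.sum_congr rfl fun _ _ => Finset.sum_comm).trans Finset.sum_comm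

/-- The two mixed blocks are equal by antisymmetry and merge into one, which is why the mixed term
carries no factor ½ while the diagonal blocks do. -/
theorem sum_sum_antisymm {ι κ : Type*} [Fintype ι] [Fintype κ] {a : ι ⊕ κ → ι ⊕ κ → ℝ}
    (ha : ∀ I J, a I J = -a J I) (x y : ι ⊕ κ → ℝ) :
    ∑ I, ∑ J, a I J * (x I * y J) =
      1 / 2 * ∑ i, ∑ j, a (.inr i) (.inr j) * (x (.inr i) * y (.inr j) - y (.inr i) * x (.inr j)) +
      ∑ i, ∑ α, a (.inr i) (.inl α) * (x (.inr i) * y (.inl α) - y (.inr i) * x (.inl α)) +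
      1 / 2 * ∑ α, ∑ β, a (.inl α) (.inl β) * (x (.inl α) * y (.inl β) - y (.inl α) * x (.inl β)) := by
  have h := sum_mul_wedge_of_antisymm ha x y
  simp only [Fintype.sum_sum_type, Finset.sum_add_distrib] at h
  have h2 : ∑ α, ∑ i, a (.inl α) (.inr i) * (x (.inl α) * y (.inr i) - y (.inl α) * x (.inr i)) =
      ∑ i, ∑ α, a (.inr i) (.inl α) * (x (.inr i) * y (.inl α) - y (.inr i) * x (.inl α)) := by
    rw [Finset.sum_comm]
    refine Finset.sum_congr rfl fun i _ => Finset.sum_congr rfl fun α _ => ?_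
    rw [ha (.inl α) (.inr i)]
    ring
  rw [h2] at h
  simp only [Fintype.sum_sum_type, Finset.sum_add_distrib]
  linarith

end Sums

/-! ### The coordinate formulas for B₁, 𝓑 and B. -/

section MainFormulas

variable {E : Type*} [NormedAddCommGroup E] [NormedSpace ℝ E] [FiniteDimensional ℝ E]
  {Q : Type*} [TopologicalSpace Q] [ChartedSpace E Q] [IsManifold 𝓘(ℝ, E) ∞ Q]
  {N : System E Q} {EG : Type*} [NormedAddCommGroup EG] [NormedSpace ℝ EG]
  {G : Type*} [TopologicalSpace G] [ChartedSpace EG G] [Group G] [MulAction G Q]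
  [IsManifold 𝓘(ℝ, EG) ∞ G]
  {EM : Type*} [NormedAddCommGroup EM] [NormedSpace ℝ EM] [ChartedSpace EM N.M]
  [IsManifold 𝓘(ℝ, EM) ∞ N.M]

namespace AdaptedFrame

variable {T : N.Splitting EG G} {l : ℕ} {b : N.GaugeBasis EG G l} {r k : ℕ}
  (F : AdaptedFrame T b r k)

theorem curvature_sum_sum (hG : N.IsSymmetry EG G) {q : Q} (hq : q ∈ F.U)
    (hinj : ∀ q : Q, Function.Injective (generator (E := E) EG G q)) {ι κ : Type*} [Fintype ι]
    [Fintype κ] (f : ι → Fin r ⊕ Fin l) (g : κ → Fin r ⊕ Fin l) (x : ι → ℝ) (y : κ → ℝ) :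
    T.curvature b q (∑ i, x i • F.fieldD (f i) q) (∑ j, y j • F.fieldD (g j) q) =
      -∑ A, (∑ i, ∑ j, x i * y j * F.C (.inr A) (indexD (f i)) (indexD (g j)) q) •
        F.algebraSection A q := by
  refine (bilin_sum_smul (V := E) (T.curvature b q) x y (fun i => F.fieldD (f i) q)
    (fun j => F.fieldD (g j) q)).trans ?_
  have h := fun i j => F.curvature_fieldD hG hq hinj (f i) (g j)
  refine (Finset.sum_congr rfl fun i _ => Finset.sum_congr rfl fun j _ =>
    congrArg (fun v : EG => (x i * y j) • v) (h i j)).trans ?_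
  simp only [smul_neg, Finset.sum_neg_distrib, Finset.smul_sum, smul_smul, Finset.sum_smul]
  rw [neg_inj, sum_rotate]

theorem B₁_eq (hM : IsSmoothEmbedding 𝓘(ℝ, EM) (cotModel E) ∞
      (fun m : N.M => (m.1 : Cotangent E Q))) (hG : N.IsSymmetry EG G)
    {m : N.M} (hm : N.tau m ∈ F.U)
    (hinj : ∀ q : Q, Function.Injective (generator (E := E) EG G q))
    (u w : TangentSpace 𝓘(ℝ, EM) m) :
    T.B₁ EM hG b m u w = -∑ A, F.p (.inr A) m * ∑ I, ∑ J,
      F.coframeM EM (indexD I) m u * F.coframeM EM (indexD J) m w *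
        F.C (.inr A) (indexD I) (indexD J) (N.tau m) := by
  have h1 : T.B₁ EM hG b m u w = hG.J EM m (T.KW EM hG m u w + T.dCAS EM hG b m u w) :=
    (map_add _ _ _).symm
  rw [h1, F.KW_add_dCAS hM hG hm hinj, F.projAlong_D_eq hm (hinj _), F.projAlong_D_eq hm (hinj _)]
  have h2 := F.curvature_sum_sum hG hm hinj id id
    (fun I => F.coframeM EM (indexD I) m u) (fun I => F.coframeM EM (indexD I) m w)
  refine (congrArg (hG.J EM m) h2).trans ?_
  rw [map_neg, map_sum]
  refine congrArg _ (Finset.sum_congr rfl fun A _ => ?_)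
  rw [map_smul, F.J_algebraSection hM, smul_eq_mul, mul_comm]
  rfl

theorem KV_eq (hM : IsSmoothEmbedding 𝓘(ℝ, EM) (cotModel E) ∞
      (fun m : N.M => (m.1 : Cotangent E Q))) (hG : N.IsSymmetry EG G)
    {m : N.M} (hm : N.tau m ∈ F.U) (hdim : ∀ q : Q, N.D q ⊔ vert EG G q = ⊤)
    (hinj : ∀ q : Q, Function.Injective (generator (E := E) EG G q))
    (u w : TangentSpace 𝓘(ℝ, EM) m) :
    hG.J EM m (T.KV EM hG m u w) = -∑ A, F.p (.inr A) m * ∑ α, ∑ β,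
      F.coframeM EM (.inl α) m u * F.coframeM EM (.inl β) m w *
        F.C (.inr A) (.inl α) (.inl β) (N.tau m) := by
  have h0 : T.KV EM hG m u w = extDer 𝓘(ℝ, E) T.AV (N.tau m)
      ![N.dtau EM m (T.projH EM hG m u), N.dtau EM m (T.projH EM hG m w)] :=
    extDer_pullback_tau hM (F.formDifferentiableAt_AV hG hm hdim hinj) _ _
  rw [T.dtau_projH hM hG m (hdim _) (hinj _), T.dtau_projH hM hG m (hdim _) (hinj _),
    F.projAlong_H hm (hdim _) (hinj _), F.projAlong_H hm (hdim _) (hinj _)] at h0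
  have h1 := bilin_sum_smul (V := E)
    (bilinOfAlternating (V := E) (extDer 𝓘(ℝ, E) T.AV (N.tau m)))
    (fun α => F.coframeM EM (.inl α) m u) (fun α => F.coframeM EM (.inl α) m w)
    (fun α => F.field (.inl α) (N.tau m)) (fun α => F.field (.inl α) (N.tau m))
  have h2 := fun α β => (F.extDer_AV hG hm hdim hinj α β).trans
    (congrArg Neg.neg (F.AV_apply hm (hdim _) (hinj _) _))
  have h3 : T.KV EM hG m u w = ∑ α, ∑ β, (F.coframeM EM (.inl α) m u *
      F.coframeM EM (.inl β) m w) • -∑ A, F.C (.inr A) (.inl α) (.inl β) (N.tau m) •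
        F.algebraSection A (N.tau m) :=
    h0.trans (h1.trans (Finset.sum_congr rfl fun α _ => Finset.sum_congr rfl fun β _ =>
      congrArg (fun v : EG => (F.coframeM EM (.inl α) m u * F.coframeM EM (.inl β) m w) • v)
        (h2 α β)))
  rw [h3]
  simp only [map_sum, map_smul, map_neg, F.J_algebraSection hM, smul_eq_mul, mul_neg,
    Finset.sum_neg_distrib, Finset.mul_sum]
  rw [neg_inj, sum_rotate]
  refine Finset.sum_congr rfl fun A _ => Finset.sum_congr rfl fun α _ =>
    Finset.sum_congr rfl fun β _ => ?_
  ring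

/-- With P_𝓥 X_nh lying over v^i Y_i, the curvature term is -v^i C_{iβ}^A on X_β, and κ_𝔤 of X_α on
the section with index A is κ_{αA}. Antisymmetrising in the two arguments produces the wedge
directly, without a factor two, as the coefficients need not be antisymmetric in α, β. -/
theorem kappaWedge_eq [FiniteDimensional ℝ EM] (hM : IsSmoothEmbedding 𝓘(ℝ, EM) (cotModel E) ∞
      (fun m : N.M => (m.1 : Cotangent E Q))) (hG : N.IsSymmetry EG G)
    {m : N.M} (hm : N.tau m ∈ F.U) (hdim : ∀ q : Q, N.D q ⊔ vert EG G q = ⊤)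
    (hinj : ∀ q : Q, Function.Injective (generator (E := E) EG G q))
    (u w : TangentSpace 𝓘(ℝ, EM) m) :
    T.kappaWedge EM hG b m u w = -∑ α, ∑ β,
      (∑ A, ∑ i, F.v (.inr (.inl i)) m * F.kappa (.inl α) (.inr A) (N.tau m)
              * F.C (.inr A) (.inr (.inl i)) (.inl β) (N.tau m)) *
        F.wedgeM EM (.inl α) (.inl β) m u w := by
  set q := N.tau m with hq
  have hZ : N.dtau EM m (T.projV EM hG m (N.Xnh EM m)) =
      ∑ i, F.v (.inr (.inl i)) m • F.fieldD (.inr i) q := by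
    rw [T.dtau_projV hM hG m (hdim _) (hinj _), N.dtau_Xnh hM]
    exact F.projAlong_vert_of_mem_D hm (hdim _) (hinj _) (N.velocity_mem m)
  have hH : ∀ u, N.dtau EM m (T.projH EM hG m u) =
      ∑ α, F.coframeM EM (.inl α) m u • F.fieldD (.inl α) q := fun u => by
    rw [T.dtau_projH hM hG m (hdim _) (hinj _)]
    exact F.projAlong_H hm (hdim _) (hinj _) _
  have hmem : ∀ I, F.fieldD I q ∈ N.D q := by
    rintro (α | i)
    · exact H_le_D T _ (F.field_mem_H hm α)
    · exact (F.field_mem_S _ i).1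
  have hK : ∀ w, T.KW EM hG m (T.projV EM hG m (N.Xnh EM m)) (T.projH EM hG m w) +
      T.dCAS EM hG b m (T.projV EM hG m (N.Xnh EM m)) (T.projH EM hG m w) =
      -∑ A, (∑ i, ∑ β, F.v (.inr (.inl i)) m * F.coframeM EM (.inl β) m w *
        F.C (.inr A) (.inr (.inl i)) (.inl β) q) • F.algebraSection A q := fun w => by
    -- Both arguments already project into D, so the projection onto D built into 𝒦 acts as the
    -- identity.
    rw [F.KW_add_dCAS hM hG hm hinj, hZ, hH,
      projAlong_apply_left (T.isCompl_D_W _)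
        (Submodule.sum_mem _ fun i _ => Submodule.smul_mem _ _ (hmem (.inr i))),
      projAlong_apply_left (T.isCompl_D_W _)
        (Submodule.sum_mem _ fun α _ => Submodule.smul_mem _ _ (hmem (.inl α)))]
    exact F.curvature_sum_sum hG hm hinj Sum.inr Sum.inl _ _
  have hκ : ∀ u w, System.Splitting.kappaG (G := G) EM m (T.projH EM hG m u)
      (T.KW EM hG m (T.projV EM hG m (N.Xnh EM m)) (T.projH EM hG m w) +
        T.dCAS EM hG b m (T.projV EM hG m (N.Xnh EM m)) (T.projH EM hG m w)) =
      -∑ α, ∑ β, (∑ A, ∑ i, F.v (.inr (.inl i)) m * F.kappa (.inl α) (.inr A) q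
        * F.C (.inr A) (.inr (.inl i)) (.inl β) q) *
        (F.coframeM EM (.inl α) m u * F.coframeM EM (.inl β) m w) := fun u w => by
    let φ : EG →L[ℝ] ℝ := (N.innerModel q (N.dtau EM m (T.projH EM hG m u))).comp
      (show EG →L[ℝ] E from generator EG G q)
    have hφ : ∀ A, φ (F.algebraSection A q) =
        ∑ α, F.coframeM EM (.inl α) m u * F.kappa (.inl α) (.inr A) q := fun A => by
      let ψ : E →L[ℝ] ℝ := N.innerModel q (F.field (.inr A) q)
      have h1 : φ (F.algebraSection A q) = ψ (N.dtau EM m (T.projH EM hG m u)) :=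
        (congrArg (fun v : E => N.innerModel q (N.dtau EM m (T.projH EM hG m u)) v)
          (F.field_inr A q).symm).trans (N.metric.symm q _ _)
      have h2 := congrArg ψ (hH u)
      refine (h1.trans h2).trans ((map_sum ψ _ _).trans (Finset.sum_congr rfl fun α _ => ?_))
      refine (map_smul ψ _ _).trans (congrArg (fun c => F.coframeM EM (.inl α) m u * c) ?_)
      exact N.metric.symm q _ _
    refine (congrArg φ (hK w)).trans ?_
    simp only [map_neg, map_sum, map_smul, hφ, smul_eq_mul, Finset.sum_mul, Finset.mul_sum]
    rw [neg_inj]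
    refine Eq.trans ?_ (sum_rotate _).symm
    refine Finset.sum_congr rfl fun A _ => Finset.sum_congr rfl fun α _ => ?_
    rw [Finset.sum_comm]
    refine Finset.sum_congr rfl fun β _ => Finset.sum_congr rfl fun i _ => ?_
    ring
  -- The sum for `(u, w)` minus the same sum for `(w, u)`, with the sign reversed, is the sum
  -- against the wedge.
  have h := congrArg₂ (· - ·) (hκ u w) (hκ w u)
  refine h.trans ?_
  rw [neg_sub_neg, ← neg_sub, neg_inj, ← Finset.sum_sub_distrib]
  refine Finset.sum_congr rfl fun α _ => ?_
  rw [← Finset.sum_sub_distrib]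
  refine Finset.sum_congr rfl fun β _ => ?_
  rw [wedgeM, wedge]
  ring

theorem B₁_formula (hM : IsSmoothEmbedding 𝓘(ℝ, EM) (cotModel E) ∞
      (fun m : N.M => (m.1 : Cotangent E Q))) (hG : N.IsSymmetry EG G)
    {m : N.M} (hm : N.tau m ∈ F.U)
    (hinj : ∀ q : Q, Function.Injective (generator (E := E) EG G q))
    (u w : TangentSpace 𝓘(ℝ, EM) m) :
    T.B₁ EM hG b m u w =
      - (1 / 2) * ∑ A, ∑ i, ∑ j, F.p (.inr A) m * F.C (.inr A) (.inr (.inl i)) (.inr (.inl j))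
          (N.tau m) * F.wedgeM EM (.inr (.inl i)) (.inr (.inl j)) m u w
      - ∑ A, ∑ i, ∑ α, F.p (.inr A) m * F.C (.inr A) (.inr (.inl i)) (.inl α) (N.tau m)
          * F.wedgeM EM (.inr (.inl i)) (.inl α) m u w
      - (1 / 2) * ∑ A, ∑ α, ∑ β, F.p (.inr A) m * F.C (.inr A) (.inl α) (.inl β) (N.tau m)
          * F.wedgeM EM (.inl α) (.inl β) m u w := by
  have h : ∀ A, F.p (.inr A) m * ∑ I, ∑ J,
      F.coframeM EM (indexD I) m u * F.coframeM EM (indexD J) m w *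
        F.C (.inr A) (indexD I) (indexD J) (N.tau m) =
      1 / 2 * ∑ i, ∑ j, F.p (.inr A) m * F.C (.inr A) (.inr (.inl i)) (.inr (.inl j))
          (N.tau m) * F.wedgeM EM (.inr (.inl i)) (.inr (.inl j)) m u w
      + ∑ i, ∑ α, F.p (.inr A) m * F.C (.inr A) (.inr (.inl i)) (.inl α) (N.tau m)
          * F.wedgeM EM (.inr (.inl i)) (.inl α) m u w
      + 1 / 2 * ∑ α, ∑ β, F.p (.inr A) m * F.C (.inr A) (.inl α) (.inl β) (N.tau m)
          * F.wedgeM EM (.inl α) (.inl β) m u w := fun A => by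
    have h1 := sum_sum_antisymm (a := fun I J => F.p (.inr A) m *
        F.C (.inr A) (indexD I) (indexD J) (N.tau m))
      (fun I J => by rw [F.C_antisymm _ (indexD I)]; ring)
      (fun I => F.coframeM EM (indexD I) m u) (fun I => F.coframeM EM (indexD I) m w)
    refine Eq.trans ?_ h1
    simp only [Finset.mul_sum]
    refine Finset.sum_congr rfl fun I _ => Finset.sum_congr rfl fun J _ => ?_
    ring
  rw [F.B₁_eq hM hG hm hinj, Finset.sum_congr rfl fun A _ => h A, Finset.sum_add_distrib,
    Finset.sum_add_distrib, ← Finset.mul_sum, ← Finset.mul_sum]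
  ring

/-- The two halves have different origins: for p_A C_{αβ}^A it comes from antisymmetry of the
bracket, for the κ-term it is the ½ in the definition of 𝓑. Both signs turn positive because each
curvature is minus a bracket. -/
theorem calB_formula [FiniteDimensional ℝ EM] (hM : IsSmoothEmbedding 𝓘(ℝ, EM) (cotModel E) ∞
      (fun m : N.M => (m.1 : Cotangent E Q))) (hG : N.IsSymmetry EG G)
    {m : N.M} (hm : N.tau m ∈ F.U) (hdim : ∀ q : Q, N.D q ⊔ vert EG G q = ⊤)
    (hinj : ∀ q : Q, Function.Injective (generator (E := E) EG G q))
    (u w : TangentSpace 𝓘(ℝ, EM) m) :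
    T.calB EM hG b m u w =
      (1 / 2) * ∑ α, ∑ β,
        (∑ A, F.p (.inr A) m * F.C (.inr A) (.inl α) (.inl β) (N.tau m)
          + ∑ A, ∑ i, F.v (.inr (.inl i)) m * F.kappa (.inl α) (.inr A) (N.tau m)
              * F.C (.inr A) (.inr (.inl i)) (.inl β) (N.tau m))
          * F.wedgeM EM (.inl α) (.inl β) m u w := by
  have hJ : ∑ A, F.p (.inr A) m * ∑ α, ∑ β,
      F.coframeM EM (.inl α) m u * F.coframeM EM (.inl β) m w *
        F.C (.inr A) (.inl α) (.inl β) (N.tau m) =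
      1 / 2 * ∑ α, ∑ β, (∑ A, F.p (.inr A) m * F.C (.inr A) (.inl α) (.inl β) (N.tau m)) *
        F.wedgeM EM (.inl α) (.inl β) m u w := by
    have h1 := sum_mul_wedge_of_antisymm
      (a := fun α β => ∑ A, F.p (.inr A) m * F.C (.inr A) (.inl α) (.inl β) (N.tau m))
      (fun α β => by
        rw [← Finset.sum_neg_distrib]
        refine Finset.sum_congr rfl fun A _ => ?_
        rw [F.C_antisymm _ (.inl α)]
        ring)
      (fun α => F.coframeM EM (.inl α) m u) (fun α => F.coframeM EM (.inl α) m w)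
    have h2 : ∑ α, ∑ β, (∑ A, F.p (.inr A) m * F.C (.inr A) (.inl α) (.inl β) (N.tau m)) *
        F.wedgeM EM (.inl α) (.inl β) m u w = _ := h1
    rw [h2, ← mul_assoc, one_div_mul_cancel two_ne_zero, one_mul]
    simp only [Finset.sum_mul, Finset.mul_sum]
    refine Eq.trans ?_ (sum_rotate _).symm
    refine Finset.sum_congr rfl fun A _ => Finset.sum_congr rfl fun α _ =>
      Finset.sum_congr rfl fun β _ => ?_
    ring
  rw [System.Splitting.calB, F.KV_eq hM hG hm hdim hinj, F.kappaWedge_eq hM hG hm hdim hinj, hJ]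
  simp only [add_mul, Finset.sum_add_distrib]
  ring

/-- The contribution of -⟨J, 𝒦_V⟩ to 𝓑 is exactly the opposite of the purely horizontal block of B₁.
-/
theorem B_formula [FiniteDimensional ℝ EM] (hM : IsSmoothEmbedding 𝓘(ℝ, EM) (cotModel E) ∞
      (fun m : N.M => (m.1 : Cotangent E Q))) (hG : N.IsSymmetry EG G)
    {m : N.M} (hm : N.tau m ∈ F.U) (hdim : ∀ q : Q, N.D q ⊔ vert EG G q = ⊤)
    (hinj : ∀ q : Q, Function.Injective (generator (E := E) EG G q))
    (u w : TangentSpace 𝓘(ℝ, EM) m) :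
    T.B EM hG b m u w =
      - (1 / 2) * ∑ A, ∑ i, ∑ j, F.p (.inr A) m * F.C (.inr A) (.inr (.inl i)) (.inr (.inl j))
          (N.tau m) * F.wedgeM EM (.inr (.inl i)) (.inr (.inl j)) m u w
      - ∑ A, ∑ i, ∑ α, F.p (.inr A) m * F.C (.inr A) (.inr (.inl i)) (.inl α) (N.tau m)
          * F.wedgeM EM (.inr (.inl i)) (.inl α) m u w
      + (1 / 2) * ∑ A, ∑ i, ∑ α, ∑ β,
          F.v (.inr (.inl i)) m * F.kappa (.inl α) (.inr A) (N.tau m)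
            * F.C (.inr A) (.inr (.inl i)) (.inl β) (N.tau m)
            * F.wedgeM EM (.inl α) (.inl β) m u w := by
  rw [System.Splitting.B, F.B₁_formula hM hG hm hinj, F.calB_formula hM hG hm hdim hinj]
  simp only [add_mul, Finset.sum_add_distrib, Finset.sum_mul]
  have h1 : ∑ α, ∑ β, ∑ A, F.p (.inr A) m * F.C (.inr A) (.inl α) (.inl β) (N.tau m)
      * F.wedgeM EM (.inl α) (.inl β) m u w = _ := sum_rotate _
  have h2 : ∑ α, ∑ β, ∑ A, ∑ i, F.v (.inr (.inl i)) m * F.kappa (.inl α) (.inr A) (N.tau m)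
      * F.C (.inr A) (.inr (.inl i)) (.inl β) (N.tau m) * F.wedgeM EM (.inl α) (.inl β) m u w =
      ∑ A, ∑ i, ∑ α, ∑ β, F.v (.inr (.inl i)) m * F.kappa (.inl α) (.inr A) (N.tau m)
      * F.C (.inr A) (.inr (.inl i)) (.inl β) (N.tau m) * F.wedgeM EM (.inl α) (.inl β) m u w :=
    (sum_rotate _).trans (Finset.sum_congr rfl fun A _ => sum_rotate _)
  rw [h1, h2]
  ring

end AdaptedFrame

end MainFormulas

end Nonholonomic

end

theorem mainTheorem5
    {E : Type*} [NormedAddCommGroup E] [NormedSpace ℝ E] [FiniteDimensional ℝ E]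
    {Q : Type*} [TopologicalSpace Q] [T2Space Q] [SecondCountableTopology Q]
    [ChartedSpace E Q] [IsManifold 𝓘(ℝ, E) ∞ Q]
    {EG : Type*} [NormedAddCommGroup EG] [NormedSpace ℝ EG] [FiniteDimensional ℝ EG]
    {G : Type*} [TopologicalSpace G] [ConnectedSpace G] [ChartedSpace EG G] [Group G]
    [LieGroup 𝓘(ℝ, EG) ∞ G]
    [MulAction G Q] [ProperSMul G Q]
    (N : Nonholonomic.System E Q)
    -- the manifold structure of the constraint manifold as an embedded submanifold of `T^*Q`
    {EM : Type*} [NormedAddCommGroup EM] [NormedSpace ℝ EM] [FiniteDimensional ℝ EM]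
    [ChartedSpace EM N.M] [IsManifold 𝓘(ℝ, EM) ∞ N.M]
    (hM : IsSmoothEmbedding 𝓘(ℝ, EM) (Nonholonomic.cotModel E) ∞
      (fun m : N.M => (m.1 : Nonholonomic.Cotangent E Q)))
    -- the symmetry, free and satisfying the dimension assumption
    (hG : N.IsSymmetry EG G)
    (hfree : ∀ (g : G) (q : Q), g • q = q → g = 1)
    (hdim : ∀ q : Q, N.D q ⊔ Nonholonomic.vert EG G q = ⊤)
    (T : N.Splitting EG G)
    -- the horizontal gauge symmetries and momenta
    {l : ℕ} (b : N.GaugeBasis EG G l)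
    (hJ : b.AreFirstIntegrals EM hG) (hJinv : b.AreInvariant EM hG)
    {r k : ℕ} (F : Nonholonomic.AdaptedFrame T b r k)
    (m : N.M) (hm : N.tau m ∈ F.U) (u w : TangentSpace 𝓘(ℝ, EM) m) :
    (T.B₁ EM hG b m u w =
      - (1 / 2) * ∑ A, ∑ i, ∑ j, F.p (.inr A) m * F.C (.inr A) (.inr (.inl i)) (.inr (.inl j))
          (N.tau m) * F.wedgeM EM (.inr (.inl i)) (.inr (.inl j)) m u w
      - ∑ A, ∑ i, ∑ α, F.p (.inr A) m * F.C (.inr A) (.inr (.inl i)) (.inl α) (N.tau m)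
          * F.wedgeM EM (.inr (.inl i)) (.inl α) m u w
      - (1 / 2) * ∑ A, ∑ α, ∑ β, F.p (.inr A) m * F.C (.inr A) (.inl α) (.inl β) (N.tau m)
          * F.wedgeM EM (.inl α) (.inl β) m u w) ∧
    (T.calB EM hG b m u w =
      (1 / 2) * ∑ α, ∑ β,
        (∑ A, F.p (.inr A) m * F.C (.inr A) (.inl α) (.inl β) (N.tau m)
          + ∑ A, ∑ i, F.v (.inr (.inl i)) m * F.kappa (.inl α) (.inr A) (N.tau m)
              * F.C (.inr A) (.inr (.inl i)) (.inl β) (N.tau m))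
          * F.wedgeM EM (.inl α) (.inl β) m u w) ∧
    (T.B EM hG b m u w =
      - (1 / 2) * ∑ A, ∑ i, ∑ j, F.p (.inr A) m * F.C (.inr A) (.inr (.inl i)) (.inr (.inl j))
          (N.tau m) * F.wedgeM EM (.inr (.inl i)) (.inr (.inl j)) m u w
      - ∑ A, ∑ i, ∑ α, F.p (.inr A) m * F.C (.inr A) (.inr (.inl i)) (.inl α) (N.tau m)
          * F.wedgeM EM (.inr (.inl i)) (.inl α) m u w
      + (1 / 2) * ∑ A, ∑ i, ∑ α, ∑ β,
          F.v (.inr (.inl i)) m * F.kappa (.inl α) (.inr A) (N.tau m)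
            * F.C (.inr A) (.inr (.inl i)) (.inl β) (N.tau m)
            * F.wedgeM EM (.inl α) (.inl β) m u w) := by
  -- Freeness of the action enters the argument only through this injectivity.
  have hinj : ∀ q : Q, Function.Injective (Nonholonomic.generator (E := E) EG G q) :=
    Nonholonomic.generator_injective hG.contMDiff_smul hfree
  exact ⟨F.B₁_formula hM hG hm hinj u w, F.calB_formula hM hG hm hdim hinj u w,
    F.B_formula hM hG hm hdim hinj u w⟩
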